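/- Conventions. A quasi-Banach lattice is a real vector lattice $E$ with a quasi-norm $\|\cdot\|$ (so $\|x\|=0$ iff $x=0$, $\|\lambda x\|=|\lambda|\|x\|$, $\|x+y\|\le C_E(\|x\|+\|y\|)$) for which it is complete and such that $\|x\|\le\|y\|$ whenever $|x|\le|y|$. A pair $(X_0,X_1)$ of quasi-Banach lattices is compatible if there are a Hausdorff, locally solid topological vector lattice $X$ and injective, continuous, interval preserving lattice homomorphisms $X_j\hookrightarrow X$ ($j=0,1$); $X_0$, $X_1$, $X_0\cap X_1$ and $X_0+X_1$ are then regarded as ideals of $X$. A linear operator $T:E\to F$ from a vector lattice with quasi-norm $\|\cdot\|_E$ to one with quasi-norm $\|\cdot\|_F$ is $(\infty,1)$-regular if there is $K>0$ with $$\Big\|\bigvee_{i=1}^n|Tx_i|\Big\|_F\le K\Big\|\sum_{i=1}^n|x_i|\Big\|_E\qquad\text{for all } n\ge 1,\ x_1,\dots,x_n\in E,$$ and $\rho_{\infty,1}(T)$ denotes the infimum of such $K$. $\mathcal P$ is the set of functions $\varphi:(0,\infty)^2\to[0,\infty)$ with $\varphi(\lambda s,\lambda t)=\lambda\varphi(s,t)$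 for all $\lambda,s,t>0$ that are non-decreasing in each variable; such a $\varphi$ is extended by continuity to $[0,\infty)^2$, and to $\mathbb R^2$ by $\varphi(s\vee0,t\vee0)$, and $\varphi(x_0,x_1)$ for $0\le x_0\in X_0$, $0\le x_1\in X_1$ is defined in $X_0+X_1$ by Krivine's functional calculus. Put $$\varphi(X_0,X_1)=\{x\in X_0+X_1:\ |x|\le\varphi(x_0,x_1)\text{ for some }0\le x_0\in X_0,\ 0\le x_1\in X_1\},$$ $$\|x\|_{\varphi(X_0,X_1)}=\inf\{\lambda>0:\ |x|\le\lambda\varphi(x_0,x_1),\ 0\le x_j\in X_j,\ \|x_j\|_{X_j}\le1\ (j=0,1)\},$$ and let $\varphi^0(X_0,X_1)$ be the closure of $X_0\cap X_1$ in $\varphi(X_0,X_1)$ with this quasi-norm (for $\varphi\equiv0$, where $\varphi(X_0,X_1)=\{0\}$, this is read as $\{0\}$). Theorem. Let $X_0,X_1,Y_0,Y_1$ be quasi-Banach lattices and let $\varphi\in\mathcal P$. There is a constant $C>0$, depending only on $X_0,X_1,Y_0,Y_1$ and $\varphi$, such that the following holds. Whenever $(X_0,X_1)$ and $(Y_0,Y_1)$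 are realised as compatible pairs and $T:X_0+X_1\to Y_0+Y_1$ is a linear operator which maps $X_j$ into $Y_j$ and whose restriction $T|_{X_j}:X_j\to Y_j$ is $(\infty,1)$-regular for $j=0,1$, the operator $T$ maps $\varphi^0(X_0,X_1)$ into $\varphi^0(Y_0,Y_1)$, the map $T:\varphi^0(X_0,X_1)\to\varphi^0(Y_0,Y_1)$ is $(\infty,1)$-regular, and $$\rho_{\infty,1}\big(T|_{\varphi^0(X_0,X_1)}\big)\le C\max\{\rho_{\infty,1}(T|_{X_0}),\rho_{\infty,1}(T|_{X_1})\}.$$ -/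

import Mathlib

open Set Filter Topology

/-! ### Quasi-Banach lattices and compatible pairs -/

/-- A (real) quasi-Banach lattice: a vector lattice with a complete, lattice (i.e. monotone in the
modulus) quasi-norm. -/
class QuasiBanachLattice (E : Type*) [AddCommGroup E] [Module ℝ E] [Lattice E] : Type _
    extends IsOrderedAddMonoid E, IsOrderedModule ℝ E where
  qnorm : E → ℝ
  qnorm_nonneg : ∀ x, 0 ≤ qnorm x
  qnorm_eq_zero_iff : ∀ x, qnorm x = 0 ↔ x = 0
  qnorm_smul : ∀ (a : ℝ) (x : E), qnorm (a • x) = |a| * qnorm x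
  qnorm_add_le : ∃ C : ℝ, 1 ≤ C ∧ ∀ x y, qnorm (x + y) ≤ C * (qnorm x + qnorm y)
  qnorm_le_of_abs_le : ∀ x y : E, |x| ≤ |y| → qnorm x ≤ qnorm y
  complete : ∀ x : ℕ → E,
    (∀ ε : ℝ, 0 < ε → ∃ N : ℕ, ∀ m ≥ N, ∀ n ≥ N, qnorm (x m - x n) < ε) →
    ∃ l : E, Tendsto (fun n => qnorm (x n - l)) atTop (𝓝 0)

/-- A Hausdorff, locally solid topological vector lattice. -/
class LocallySolidVectorLattice (X : Type*) [AddCommGroup X] [Module ℝ X] [Lattice X]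
    [TopologicalSpace X] : Prop
    extends IsOrderedAddMonoid X, IsOrderedModule ℝ X, IsTopologicalAddGroup X,
      ContinuousSMul ℝ X, T2Space X where
  locally_solid : ∀ U ∈ 𝓝 (0 : X), ∃ V ∈ 𝓝 (0 : X), V ⊆ U ∧
    ∀ x y : X, |x| ≤ |y| → y ∈ V → x ∈ V

/-- An inclusion of a quasi-Banach lattice into a locally solid vector lattice: an injective,
continuous, interval preserving lattice homomorphism. -/
structure LatticeInclusion (E X : Type*) [AddCommGroup E] [Module ℝ E] [Lattice E]
    [QuasiBanachLattice E] [AddCommGroup X] [Module ℝ X] [Lattice X] [TopologicalSpace X]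
    extends E →ₗ[ℝ] X where
  injective' : Function.Injective toFun
  map_sup' : ∀ x y : E, toFun (x ⊔ y) = toFun x ⊔ toFun y
  image_Icc' : ∀ x : E, 0 ≤ x → toFun '' Icc 0 x = Icc 0 (toFun x)
  continuous_zero' : ∀ U ∈ 𝓝 (0 : X), ∃ ε : ℝ, 0 < ε ∧
    ∀ x : E, QuasiBanachLattice.qnorm x < ε → toFun x ∈ U

theorem LatticeInclusion.abs_apply {E X : Type*} [AddCommGroup E] [Module ℝ E] [Lattice E]
    [QuasiBanachLattice E] [AddCommGroup X] [Module ℝ X] [Lattice X] [TopologicalSpace X]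
    (j : LatticeInclusion E X) (x : E) :
    |j.toLinearMap x| = j.toLinearMap |x| := by
  have h : j.toLinearMap (x ⊔ -x) = j.toLinearMap x ⊔ j.toLinearMap (-x) := j.map_sup' x (-x)
  rw [map_neg] at h
  exact h.symm

/-- `(X₀, X₁)` is a compatible pair of quasi-Banach lattices, realised inside `X`. -/
structure CompatiblePair (X₀ X₁ X : Type*)
    [AddCommGroup X₀] [Module ℝ X₀] [Lattice X₀] [QuasiBanachLattice X₀]
    [AddCommGroup X₁] [Module ℝ X₁] [Lattice X₁] [QuasiBanachLattice X₁]
    [AddCommGroup X] [Module ℝ X] [Lattice X] [TopologicalSpace X]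
    [LocallySolidVectorLattice X] where
  incl₀ : LatticeInclusion X₀ X
  incl₁ : LatticeInclusion X₁ X

namespace CompatiblePair

section

variable {X₀ X₁ X : Type*}
  [AddCommGroup X₀] [Module ℝ X₀] [Lattice X₀] [QuasiBanachLattice X₀]
  [AddCommGroup X₁] [Module ℝ X₁] [Lattice X₁] [QuasiBanachLattice X₁]
  [AddCommGroup X] [Module ℝ X] [Lattice X] [TopologicalSpace X]
  [LocallySolidVectorLattice X]

/-- The space `X₀ + X₁` inside `X`. -/
def sum (P : CompatiblePair X₀ X₁ X) : Submodule ℝ X :=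
  LinearMap.range P.incl₀.toLinearMap ⊔ LinearMap.range P.incl₁.toLinearMap

theorem mem_sum_of_nonneg_of_le (P : CompatiblePair X₀ X₁ X) {z : X} (hz : 0 ≤ z)
    {p : X₀} {q : X₁} (hp : 0 ≤ p) (hq : 0 ≤ q)
    (h : z ≤ P.incl₀.toLinearMap p + P.incl₁.toLinearMap q) : z ∈ P.sum := by
  have hjp : 0 ≤ P.incl₀.toLinearMap p := by
    have := (P.incl₀.image_Icc' p hp).subset ⟨p, ⟨hp, le_rfl⟩, rfl⟩
    exact this.1
  have hjq : 0 ≤ P.incl₁.toLinearMap q := by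
    have := (P.incl₁.image_Icc' q hq).subset ⟨q, ⟨hq, le_rfl⟩, rfl⟩
    exact this.1
  obtain ⟨a, -, ha⟩ := (P.incl₀.image_Icc' p hp).superset
    (show z ⊓ P.incl₀.toLinearMap p ∈ _ from ⟨le_inf hz hjp, inf_le_right⟩)
  have h2 : z - z ⊓ P.incl₀.toLinearMap p ≤ P.incl₁.toLinearMap q := by
    rw [sub_le_iff_le_add, add_inf]
    refine le_inf ?_ ?_
    · exact le_add_of_nonneg_left hjq
    · rwa [add_comm]
  obtain ⟨b, -, hb⟩ := (P.incl₁.image_Icc' q hq).superset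
    (show z - z ⊓ P.incl₀.toLinearMap p ∈ _ from ⟨sub_nonneg.2 inf_le_left, h2⟩)
  have : z = P.incl₀.toLinearMap a + P.incl₁.toLinearMap b := by
    change P.incl₀.toLinearMap a = _ at ha
    change P.incl₁.toLinearMap b = _ at hb
    rw [ha, hb]; abel
  rw [this]
  exact Submodule.add_mem_sup ⟨a, rfl⟩ ⟨b, rfl⟩

/-- `X₀ + X₁` is an ideal of `X`. -/
theorem sum_solid (P : CompatiblePair X₀ X₁ X) {x y : X} (hy : y ∈ P.sum) (h : |x| ≤ |y|) :
    x ∈ P.sum := by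
  obtain ⟨_, ⟨a, rfl⟩, _, ⟨b, rfl⟩, rfl⟩ := Submodule.mem_sup.1 hy
  have h1 : |x| ≤ P.incl₀.toLinearMap |a| + P.incl₁.toLinearMap |b| := by
    rw [← P.incl₀.abs_apply, ← P.incl₁.abs_apply]
    exact h.trans (abs_add_le _ _)
  have hp : x⁺ ∈ P.sum := P.mem_sum_of_nonneg_of_le (posPart_nonneg x) (abs_nonneg a)
    (abs_nonneg b) ((sup_le (le_abs_self x) (abs_nonneg x)).trans h1)
  have hn : x⁻ ∈ P.sum := P.mem_sum_of_nonneg_of_le (negPart_nonneg x) (abs_nonneg a)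
    (abs_nonneg b) ((sup_le (neg_le_abs x) (abs_nonneg x)).trans h1)
  rw [← posPart_sub_negPart x]
  exact P.sum.sub_mem hp hn

theorem sup_mem_sum (P : CompatiblePair X₀ X₁ X) {x y : X} (hx : x ∈ P.sum) (hy : y ∈ P.sum) :
    x ⊔ y ∈ P.sum := by
  have habs : ∀ {z : X}, z ∈ P.sum → |z| ∈ P.sum := fun hz =>
    P.sum_solid hz (abs_abs _).le
  refine P.sum_solid (P.sum.add_mem (habs hx) (habs hy)) ?_
  rw [abs_of_nonneg (add_nonneg (abs_nonneg x) (abs_nonneg y))]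
  refine abs_le'.2 ⟨sup_le ?_ ?_, ?_⟩
  · exact (le_abs_self x).trans (le_add_of_nonneg_right (abs_nonneg y))
  · exact (le_abs_self y).trans (le_add_of_nonneg_left (abs_nonneg x))
  · rw [neg_sup]
    exact inf_le_left.trans ((neg_le_abs x).trans (le_add_of_nonneg_right (abs_nonneg y)))

theorem inf_mem_sum (P : CompatiblePair X₀ X₁ X) {x y : X} (hx : x ∈ P.sum) (hy : y ∈ P.sum) :
    x ⊓ y ∈ P.sum := by
  have h := P.sum.neg_mem (P.sup_mem_sum (P.sum.neg_mem hx) (P.sum.neg_mem hy))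
  rwa [neg_sup, neg_neg, neg_neg] at h

/-- `X₀ + X₁` is a vector lattice for the operations and the order of `X`. -/
instance instLatticeSum (P : CompatiblePair X₀ X₁ X) : Lattice P.sum :=
  Subtype.lattice (fun _ _ hx hy => P.sup_mem_sum hx hy) (fun _ _ hx hy => P.inf_mem_sum hx hy)

/-- The inclusion `X₀ → X₀ + X₁`. -/
def toSum₀ (P : CompatiblePair X₀ X₁ X) : X₀ →ₗ[ℝ] P.sum :=
  P.incl₀.toLinearMap.codRestrict P.sum fun x => Submodule.mem_sup_left ⟨x, rfl⟩

/-- The inclusion `X₁ → X₀ + X₁`. -/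
def toSum₁ (P : CompatiblePair X₀ X₁ X) : X₁ →ₗ[ℝ] P.sum :=
  P.incl₁.toLinearMap.codRestrict P.sum fun x => Submodule.mem_sup_right ⟨x, rfl⟩

/-- The intersection `X₀ ∩ X₁`, as a subset of `X₀ + X₁`. -/
def inter (P : CompatiblePair X₀ X₁ X) : Set P.sum :=
  range P.toSum₀ ∩ range P.toSum₁

end

end CompatiblePair

/-! ### Krivine's functional calculus for two elements of a vector lattice -/

/-- The continuous positively 1-homogeneous functions on `ℝ²`. -/
def HomFun : Submodule ℝ C(ℝ × ℝ, ℝ) where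
  carrier := {h | ∀ a : ℝ, 0 ≤ a → ∀ p : ℝ × ℝ, h (a • p) = a * h p}
  add_mem' := by
    intro f g hf hg a ha p
    simp only [ContinuousMap.add_apply, hf a ha p, hg a ha p]
    ring
  zero_mem' := by
    intro a _ p
    simp
  smul_mem' := by
    intro c f hf a ha p
    simp only [ContinuousMap.smul_apply, hf a ha p, smul_eq_mul]
    ring

/-- `τ` is Krivine's functional calculus at `(u, v)`: the linear lattice homomorphism on the
continuous positively homogeneous functions taking the two coordinate functions to `u` and `v`.
(In a uniformly complete Archimedean vector lattice, e.g. a quasi-Banach lattice, there is exactly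
one such `τ`.) -/
structure IsKrivineCalculus {E : Type*} [AddCommGroup E] [Module ℝ E] [Lattice E] (u v : E)
    (τ : HomFun →ₗ[ℝ] E) : Prop where
  map_fst : ∀ h : HomFun, (∀ p : ℝ × ℝ, h.1 p = p.1) → τ h = u
  map_snd : ∀ h : HomFun, (∀ p : ℝ × ℝ, h.1 p = p.2) → τ h = v
  map_sup : ∀ f g h : HomFun, (∀ p : ℝ × ℝ, h.1 p = f.1 p ⊔ g.1 p) → τ h = τ f ⊔ τ g

/-- `y = h(u, v)` in the sense of Krivine's functional calculus. -/
def IsKrivineValue {E : Type*} [AddCommGroup E] [Module ℝ E] [Lattice E] (h : HomFun)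
    (u v y : E) : Prop :=
  ∃ τ : HomFun →ₗ[ℝ] E, IsKrivineCalculus u v τ ∧ τ h = y

/-! ### The class of functions `φ` -/

/-- The class `𝒫` of the functions `φ : (0,∞) × (0,∞) → [0,∞)` that are homogeneous and
non-decreasing in each variable; only the values at positive arguments matter. -/
structure ClassP where
  toFun : ℝ → ℝ → ℝ
  nonneg : ∀ s t : ℝ, 0 < s → 0 < t → 0 ≤ toFun s t
  homogeneous : ∀ a s t : ℝ, 0 < a → 0 < s → 0 < t → toFun (a * s) (a * t) = a * toFun s t
  mono_left : ∀ t : ℝ, 0 < t → MonotoneOn (fun s => toFun s t) (Ioi 0)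
  mono_right : ∀ s : ℝ, 0 < s → MonotoneOn (fun t => toFun s t) (Ioi 0)

namespace ClassP

/-- The class is symmetric in the two variables. -/
def swap (φ : ClassP) : ClassP where
  toFun s t := φ.toFun t s
  nonneg s t hs ht := φ.nonneg t s ht hs
  homogeneous a s t ha hs ht := φ.homogeneous a t s ha ht hs
  mono_left := φ.mono_right
  mono_right := φ.mono_left

/-- `φ(1, 0⁺)`: the right limit at `0` of the non-decreasing function `φ(1, ·)`. -/
noncomputable def rightLim₁ (φ : ClassP) : ℝ := sInf ((fun t => φ.toFun 1 t) '' Ioi 0)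

/-- `φ(0⁺, 1)`: the right limit at `0` of the non-decreasing function `φ(·, 1)`. -/
noncomputable def rightLim₀ (φ : ClassP) : ℝ := sInf ((fun s => φ.toFun s 1) '' Ioi 0)

/-- The function `(s, t) ↦ φ(s ∨ 0, t ∨ 0)` on `ℝ²`, where `φ` is extended by continuity to the
closed quadrant: `φ(s, 0) = s φ(1, 0⁺)`, `φ(0, t) = t φ(0⁺, 1)`, `φ(0, 0) = 0`. -/
noncomputable def hatFun (φ : ClassP) (p : ℝ × ℝ) : ℝ :=
  if 0 < p.1 then (if 0 < p.2 then φ.toFun p.1 p.2 else p.1 * φ.rightLim₁)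
  else (if 0 < p.2 then p.2 * φ.rightLim₀ else 0)

/-- The continuous extension of `φ(1, ·)` to `[0, ∞)`, and then to `ℝ` as a constant. -/
noncomputable def ext₁ (φ : ClassP) (t : ℝ) : ℝ := if 0 < t then φ.toFun 1 t else φ.rightLim₁

theorem bddBelow₁ (φ : ClassP) : BddBelow ((fun t => φ.toFun 1 t) '' Ioi 0) :=
  ⟨0, by rintro _ ⟨t, ht, rfl⟩; exact φ.nonneg 1 t one_pos ht⟩

theorem monotone_ext₁ (φ : ClassP) : Monotone φ.ext₁ := by
  intro s t hst
  unfold ext₁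
  split_ifs with h1 h2 h2
  · exact φ.mono_right 1 one_pos h1 h2 hst
  · exact absurd (h1.trans_le hst) h2
  · exact csInf_le φ.bddBelow₁ ⟨t, h2, rfl⟩
  · exact le_rfl

theorem mul_ext₁_le (φ : ClassP) {s t : ℝ} (hs : 0 < s) (hst : s ≤ t) :
    s * φ.ext₁ t ≤ t * φ.ext₁ s := by
  have ht := hs.trans_le hst
  simp only [ext₁, hs, ht, if_true]
  rw [← φ.homogeneous s 1 t hs one_pos ht, ← φ.homogeneous t 1 s ht one_pos hs, mul_comm t s]
  refine φ.mono_left (s * t) (by positivity) ?_ ?_ ?_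
  · simpa using hs
  · simpa using ht
  · simpa using hst

theorem continuous_ext₁ (φ : ClassP) : Continuous φ.ext₁ := by
  rw [continuous_iff_continuousAt]
  intro t
  by_cases ht : 0 < t
  · have hnn : 0 ≤ φ.ext₁ t := by
      simp only [ext₁, ht, if_true]
      exact φ.nonneg 1 t one_pos ht
    have hl : Tendsto (fun u : ℝ => min 1 (u / t) * φ.ext₁ t) (𝓝 t) (𝓝 (φ.ext₁ t)) := by
      have hc : Continuous fun u : ℝ => min 1 (u / t) * φ.ext₁ t := by fun_prop
      simpa [ht.ne'] using hc.tendsto t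
    have hr : Tendsto (fun u : ℝ => max 1 (u / t) * φ.ext₁ t) (𝓝 t) (𝓝 (φ.ext₁ t)) := by
      have hc : Continuous fun u : ℝ => max 1 (u / t) * φ.ext₁ t := by fun_prop
      simpa [ht.ne'] using hc.tendsto t
    refine tendsto_of_tendsto_of_tendsto_of_le_of_le' hl hr ?_ ?_
    · filter_upwards [lt_mem_nhds ht] with u hu
      rcases le_total u t with h | h
      · calc min 1 (u / t) * φ.ext₁ t ≤ u / t * φ.ext₁ t :=
              mul_le_mul_of_nonneg_right (min_le_right _ _) hnn
          _ ≤ φ.ext₁ u := by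
              rw [div_mul_eq_mul_div, div_le_iff₀ ht, mul_comm _ t]
              exact φ.mul_ext₁_le hu h
      · calc min 1 (u / t) * φ.ext₁ t ≤ 1 * φ.ext₁ t :=
              mul_le_mul_of_nonneg_right (min_le_left _ _) hnn
          _ ≤ φ.ext₁ u := by rw [one_mul]; exact φ.monotone_ext₁ h
    · filter_upwards [lt_mem_nhds ht] with u hu
      rcases le_total u t with h | h
      · calc φ.ext₁ u ≤ 1 * φ.ext₁ t := by rw [one_mul]; exact φ.monotone_ext₁ h
          _ ≤ max 1 (u / t) * φ.ext₁ t := mul_le_mul_of_nonneg_right (le_max_left _ _) hnn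
      · calc φ.ext₁ u ≤ u / t * φ.ext₁ t := by
              rw [div_mul_eq_mul_div, le_div_iff₀ ht, mul_comm _ t]
              exact φ.mul_ext₁_le ht h
          _ ≤ max 1 (u / t) * φ.ext₁ t := mul_le_mul_of_nonneg_right (le_max_right _ _) hnn
  · have e : φ.ext₁ t = φ.rightLim₁ := by simp only [ext₁, ht, if_false]
    rw [ContinuousAt, e, tendsto_order]
    constructor
    · intro a ha
      refine Eventually.of_forall fun u => ha.trans_le ?_
      have hm : ¬ 0 < min u 0 := not_lt.2 (min_le_right _ _)
      have := φ.monotone_ext₁ (min_le_left u 0)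
      rwa [show φ.ext₁ (min u 0) = φ.rightLim₁ by simp only [ext₁, hm, if_false]] at this
    · intro a ha
      obtain ⟨_, ⟨r, hr, rfl⟩, hra⟩ := exists_lt_of_csInf_lt
        (⟨_, 1, mem_Ioi.2 one_pos, rfl⟩ : ((fun t => φ.toFun 1 t) '' Ioi 0).Nonempty) ha
      filter_upwards [gt_mem_nhds ((not_lt.1 ht).trans_lt hr)] with u hu
      refine (φ.monotone_ext₁ hu.le).trans_lt ?_
      simp only [mem_Ioi] at hr
      simpa only [ext₁, hr, if_true] using hra

theorem hatFun_of_fst_pos (φ : ClassP) {p : ℝ × ℝ} (hp : 0 < p.1) :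
    φ.hatFun p = p.1 * φ.ext₁ (p.2 / p.1) := by
  unfold hatFun ext₁
  by_cases h : 0 < p.2
  · have h' : 0 < p.2 / p.1 := div_pos h hp
    simp only [hp, h, h', if_true]
    rw [← φ.homogeneous p.1 1 _ hp one_pos h', mul_one, mul_div_cancel₀ _ hp.ne']
  · have h' : ¬ 0 < p.2 / p.1 := by
      rw [not_lt] at h ⊢
      exact div_nonpos_of_nonpos_of_nonneg h hp.le
    simp only [hp, h, h', if_true, if_false]

theorem hatFun_swap (φ : ClassP) (p : ℝ × ℝ) : φ.swap.hatFun p.swap = φ.hatFun p := by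
  unfold hatFun
  by_cases h1 : 0 < p.1 <;> by_cases h2 : 0 < p.2 <;>
    simp [h1, h2, swap, rightLim₀, rightLim₁]

theorem hatFun_nonneg (φ : ClassP) (p : ℝ × ℝ) : 0 ≤ φ.hatFun p := by
  have h1 : 0 ≤ φ.rightLim₁ := Real.sInf_nonneg
    (by rintro _ ⟨t, ht, rfl⟩; exact φ.nonneg 1 t one_pos ht)
  have h0 : 0 ≤ φ.rightLim₀ := Real.sInf_nonneg
    (by rintro _ ⟨t, ht, rfl⟩; exact φ.nonneg t 1 ht one_pos)
  unfold hatFun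
  split_ifs with h h' h'
  · exact φ.nonneg _ _ h h'
  · exact mul_nonneg h.le h1
  · exact mul_nonneg h'.le h0
  · exact le_rfl

theorem hatFun_le_of_fst_pos (φ : ClassP) {p : ℝ × ℝ} (hp : 0 < p.1) :
    φ.hatFun p ≤ (p.1 ⊔ p.2) * φ.toFun 1 1 := by
  have e1 : φ.ext₁ 1 = φ.toFun 1 1 := by simp [ext₁]
  rw [φ.hatFun_of_fst_pos hp, ← e1]
  have hnn : 0 ≤ φ.ext₁ 1 := by rw [e1]; exact φ.nonneg 1 1 one_pos one_pos
  rcases le_total (p.2 / p.1) 1 with h | h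
  · calc p.1 * φ.ext₁ (p.2 / p.1) ≤ p.1 * φ.ext₁ 1 :=
          mul_le_mul_of_nonneg_left (φ.monotone_ext₁ h) hp.le
      _ ≤ _ := mul_le_mul_of_nonneg_right le_sup_left hnn
  · have := φ.mul_ext₁_le one_pos h
    rw [one_mul] at this
    calc p.1 * φ.ext₁ (p.2 / p.1) ≤ p.1 * (p.2 / p.1 * φ.ext₁ 1) :=
          mul_le_mul_of_nonneg_left this hp.le
      _ = p.2 * φ.ext₁ 1 := by field_simp
      _ ≤ _ := mul_le_mul_of_nonneg_right le_sup_right hnn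

theorem hatFun_le (φ : ClassP) (p : ℝ × ℝ) :
    φ.hatFun p ≤ (p.1 ⊔ p.2 ⊔ 0) * φ.toFun 1 1 := by
  have hnn : 0 ≤ φ.toFun 1 1 := φ.nonneg 1 1 one_pos one_pos
  by_cases h1 : 0 < p.1
  · exact (φ.hatFun_le_of_fst_pos h1).trans (mul_le_mul_of_nonneg_right le_sup_left hnn)
  by_cases h2 : 0 < p.2
  · rw [← φ.hatFun_swap]
    refine (φ.swap.hatFun_le_of_fst_pos (p := p.swap) h2).trans ?_
    refine mul_le_mul_of_nonneg_right ?_ hnn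
    rw [sup_comm]
    exact le_sup_left
  · simp only [hatFun, h1, h2, if_false]
    exact mul_nonneg le_sup_right hnn

theorem continuous_hatFun (φ : ClassP) : Continuous φ.hatFun := by
  have key : ∀ (ψ : ClassP) (p : ℝ × ℝ), 0 < p.1 → ContinuousAt ψ.hatFun p := by
    intro ψ p hp
    have h1 : ContinuousAt (fun q : ℝ × ℝ => q.1 * ψ.ext₁ (q.2 / q.1)) p := by
      refine continuousAt_fst.mul ?_
      exact ψ.continuous_ext₁.continuousAt.comp
        (continuousAt_snd.div continuousAt_fst hp.ne')
    refine h1.congr ?_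
    filter_upwards [continuousAt_fst.eventually (lt_mem_nhds hp)] with q hq
    exact (ψ.hatFun_of_fst_pos hq).symm
  rw [continuous_iff_continuousAt]
  intro p
  by_cases h1 : 0 < p.1
  · exact key φ p h1
  by_cases h2 : 0 < p.2
  · have h := ContinuousAt.comp (f := Prod.swap) (x := p) (key φ.swap p.swap h2)
      continuous_swap.continuousAt
    refine h.congr (Eventually.of_forall fun q => φ.hatFun_swap q)
  · have h0 : φ.hatFun p = 0 := by simp only [hatFun, h1, h2, if_false]
    rw [ContinuousAt, h0]
    refine squeeze_zero φ.hatFun_nonneg φ.hatFun_le ?_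
    have hc : Continuous fun q : ℝ × ℝ => (q.1 ⊔ q.2 ⊔ 0) * φ.toFun 1 1 := by fun_prop
    have := hc.tendsto p
    rwa [sup_eq_right.2 (sup_le (not_lt.1 h1) (not_lt.1 h2)), zero_mul] at this

theorem hatFun_smul (φ : ClassP) (a : ℝ) (ha : 0 ≤ a) (p : ℝ × ℝ) :
    φ.hatFun (a • p) = a * φ.hatFun p := by
  rcases ha.eq_or_lt with rfl | ha
  · simp [hatFun]
  · unfold hatFun
    simp only [Prod.smul_fst, Prod.smul_snd, smul_eq_mul, mul_pos_iff_of_pos_left ha]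
    split_ifs with h h' h'
    · exact φ.homogeneous a _ _ ha h h'
    · ring
    · ring
    · ring

/-- The extension of `φ` to a continuous positively homogeneous function on `ℝ²`. -/
noncomputable def hat (φ : ClassP) : HomFun :=
  ⟨⟨φ.hatFun, φ.continuous_hatFun⟩, fun a ha p => φ.hatFun_smul a ha p⟩

end ClassP

/-! ### The spaces `φ(X₀, X₁)` and `φ⁰(X₀, X₁)` -/

namespace CompatiblePair

section

variable {X₀ X₁ X : Type*}
  [AddCommGroup X₀] [Module ℝ X₀] [Lattice X₀] [QuasiBanachLattice X₀]
  [AddCommGroup X₁] [Module ℝ X₁] [Lattice X₁] [QuasiBanachLattice X₁]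
  [AddCommGroup X] [Module ℝ X] [Lattice X] [TopologicalSpace X]
  [LocallySolidVectorLattice X]

/-- The Calderón-Lozanovskii space `φ(X₀, X₁)`. -/
def calderonLozanovskii (P : CompatiblePair X₀ X₁ X) (φ : ClassP) : Set P.sum :=
  {x | ∃ (x₀ : X₀) (x₁ : X₁) (y : P.sum), 0 ≤ x₀ ∧ 0 ≤ x₁ ∧
    IsKrivineValue φ.hat (P.toSum₀ x₀) (P.toSum₁ x₁) y ∧ |x| ≤ y}

/-- The quasi-norm of `φ(X₀, X₁)` (meaningful on `calderonLozanovskii` only). -/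
noncomputable def clNorm (P : CompatiblePair X₀ X₁ X) (φ : ClassP) (x : P.sum) : ℝ :=
  sInf {r : ℝ | 0 < r ∧ ∃ (x₀ : X₀) (x₁ : X₁) (y : P.sum), 0 ≤ x₀ ∧ 0 ≤ x₁ ∧
    QuasiBanachLattice.qnorm x₀ ≤ 1 ∧ QuasiBanachLattice.qnorm x₁ ≤ 1 ∧
    IsKrivineValue φ.hat (P.toSum₀ x₀) (P.toSum₁ x₁) y ∧ |x| ≤ r • y}

/-- The space `φ⁰(X₀, X₁)`: the closure of `X₀ ∩ X₁` in `φ(X₀, X₁)`.  (The approximants `y` are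
required to lie in `φ(X₀, X₁)`, which is automatic unless `φ = 0`.) -/
def phiZero (P : CompatiblePair X₀ X₁ X) (φ : ClassP) : Set P.sum :=
  {x | x ∈ P.calderonLozanovskii φ ∧ ∀ ε : ℝ, 0 < ε →
    ∃ y ∈ P.inter ∩ P.calderonLozanovskii φ, P.clNorm φ (x - y) < ε}

end

end CompatiblePair

/-! ### `(∞,1)`-regular operators -/

section

variable {E F : Type*} [AddCommGroup E] [Lattice E] [AddCommGroup F] [Lattice F]

/-- `K` is an `(∞,1)`-regularity constant of `T` on the subspace `A` of `E`:
`‖⋁ᵢ |T xᵢ|‖ ≤ K ‖∑ᵢ |xᵢ|‖` for all nonempty finite families in `A`. -/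
def IsRegularityConstant (A : Set E) (normE : E → ℝ) (normF : F → ℝ) (T : E → F) (K : ℝ) : Prop :=
  ∀ (n : ℕ) (x : Fin (n + 1) → E), (∀ i, x i ∈ A) →
    normF (Finset.univ.sup' Finset.univ_nonempty fun i => |T (x i)|) ≤ K * normE (∑ i, |x i|)

/-- `T` is `(∞,1)`-regular on `A`. -/
def IsInftyOneRegular (A : Set E) (normE : E → ℝ) (normF : F → ℝ) (T : E → F) : Prop :=
  ∃ K : ℝ, 0 < K ∧ IsRegularityConstant A normE normF T K

/-- `ρ_{∞,1}(T|_A)`, the infimum of the `(∞,1)`-regularity constants of `T` on `A`. -/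
noncomputable def rhoInftyOne (A : Set E) (normE : E → ℝ) (normF : F → ℝ) (T : E → F) : ℝ :=
  sInf {K : ℝ | 0 < K ∧ IsRegularityConstant A normE normF T K}

end

open Set Filter Topology

set_option linter.unusedSectionVars false

/-! ### Real vector lattices -/

section VectorLattice

variable {E : Type*} [AddCommGroup E] [Module ℝ E] [Lattice E] [IsOrderedAddMonoid E]
  [IsOrderedModule ℝ E]

/-! An `(∞,1)`-regular operator turns an ℓ¹ bound on a family into an ℓ^∞ bound on its image, and a
function φ ≠ 0 of the class `𝒫` can be recovered from such weaker bounds. If 0 ≤ w ≤ φ(s, t) and w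
lies below a multiple of s and of t, there are weights p_k, q_k > 0 and finitely many v_k ≥ 0 with
sum w, ∑ p_k v_k ≤ 2s and ∑ q_k v_k ≤ 2t. Conversely, for the same weights, p_k v_k ≤ s' and q_k v_k
≤ t' for each single k already give ∑ v_k ≤ 8 φ(s', t'). The weights are read off at nodes between
which f = φ(1, ·) at least doubles and f(r)/r at least halves, except perhaps in the last gap
(`exists_nodes`, `exists_discretization`).

For x_i in X₀ ∩ X₁, let w = ∑ |x_i|, decompose w as above and refine by Riesz decomposition: u_ik ≥
0 sum over k to the positive and negative parts of the x_i, and over i to v_k. Regularity on X₀,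
applied to the family of all p_k u_ik, gives one y₀ above every p_k |T u_ik| with ‖y₀‖ ≤ 2K‖s‖. The
weights q_k give y₁ in the same way. The converse half then bounds all |T x_i| at once by 16 φ(y₀,
y₁); this is `isBoundedBy_sup'_of_mem_inter`.

Lattice inequalities are reduced to inequalities between real numbers by states, functionals that
are lattice homomorphisms on a principal ideal. In an Archimedean lattice they separate the points
of that ideal (`le_of_forall_isState`), and they commute with Krivine's calculus
(`IsKrivineCalculus.state_apply`).

The passage to the closure does not use completeness of φ(Y₀, Y₁). Rapidly converging approximants
y_n of x have images whose increments are dominated by 2⁻ⁿ Z for a single Z in φ(Y₀, Y₁), and the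
Hausdorff locally solid topology identifies their limit with T x (`exists_approx_of_mem_phiZero`).
-/

theorem smul_sup_of_nonneg {c : ℝ} (hc : 0 ≤ c) (x y : E) : c • (x ⊔ y) = c • x ⊔ c • y := by
  rcases hc.eq_or_lt with rfl | hc
  · simp
  · exact (OrderIso.smulRight (β := E) hc).map_sup x y

theorem smul_abs_of_nonneg {c : ℝ} (hc : 0 ≤ c) (x : E) : c • |x| = |c • x| := by
  change c • (x ⊔ -x) = c • x ⊔ -(c • x)
  rw [smul_sup_of_nonneg hc, smul_neg]

theorem abs_smul_eq (c : ℝ) (x : E) : |c • x| = |c| • |x| := by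
  rcases le_total 0 c with hc | hc
  · rw [abs_of_nonneg hc, smul_abs_of_nonneg hc]
  · rw [abs_of_nonpos hc, smul_abs_of_nonneg (neg_nonneg.2 hc), neg_smul, abs_neg]

theorem sup_eq_half_smul_add (x y : E) : x ⊔ y = (1 / 2 : ℝ) • (x + y + |y - x|) := by
  rw [← two_nsmul_sup_eq_add_add_abs_sub x y, ← Nat.cast_smul_eq_nsmul ℝ, smul_smul]
  norm_num

theorem abs_le_of_neg_le_of_le {x y : E} (h1 : -y ≤ x) (h2 : x ≤ y) : |x| ≤ y :=
  abs_le'.2 ⟨h2, neg_le.1 h1⟩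

theorem abs_finset_sum_le {ι : Type*} (s : Finset ι) (f : ι → E) :
    |∑ i ∈ s, f i| ≤ ∑ i ∈ s, |f i| := by
  classical
  induction s using Finset.induction_on with
  | empty => simp
  | insert a s ha ih =>
    rw [Finset.sum_insert ha, Finset.sum_insert ha]
    exact (abs_add_le _ _).trans (by gcongr)

variable (E) in
/-- The Archimedean property of a vector lattice. -/
def IsArchimedeanLattice : Prop := ∀ x y : E, (∀ n : ℕ, (n : ℝ) • x ≤ y) → x ≤ 0

/-- The ideal generated by `e`. -/
def idealOf (e : E) : Submodule ℝ E where
  carrier := {x | ∃ c : ℝ, |x| ≤ c • e}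
  add_mem' := by
    rintro x y ⟨c, hc⟩ ⟨d, hd⟩
    exact ⟨c + d, (abs_add_le x y).trans (by rw [add_smul]; gcongr)⟩
  zero_mem' := ⟨0, by simp⟩
  smul_mem' := by
    rintro a x ⟨c, hc⟩
    refine ⟨|a| * c, ?_⟩
    rw [abs_smul_eq, mul_smul]
    exact smul_le_smul_of_nonneg_left hc (abs_nonneg a)

theorem mem_idealOf_of_abs_le {e x : E} (h : |x| ≤ e) : x ∈ idealOf e := ⟨1, by simpa using h⟩

theorem self_mem_idealOf {e : E} (he : 0 ≤ e) : e ∈ idealOf e :=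
  mem_idealOf_of_abs_le (abs_of_nonneg he).le

/-- Solid linear subspaces, i.e. order ideals. -/
def IsOrderIdeal (M : Submodule ℝ E) : Prop := ∀ ⦃x y : E⦄, |x| ≤ |y| → y ∈ M → x ∈ M

theorem IsOrderIdeal.abs_mem {M : Submodule ℝ E} (hM : IsOrderIdeal M) {x : E} (hx : x ∈ M) :
    |x| ∈ M := hM (abs_abs x).le hx

theorem IsOrderIdeal.mem_of_abs_le {M : Submodule ℝ E} (hM : IsOrderIdeal M) {x y : E}
    (hy : y ∈ M) (h : |x| ≤ y) : x ∈ M := hM (h.trans (le_abs_self y)) hy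

theorem IsOrderIdeal.mem_of_nonneg_of_le {M : Submodule ℝ E} (hM : IsOrderIdeal M) {x y : E}
    (hy : y ∈ M) (hx : 0 ≤ x) (h : x ≤ y) : x ∈ M :=
  hM.mem_of_abs_le hy (by rwa [abs_of_nonneg hx])

theorem IsOrderIdeal.sup_mem {M : Submodule ℝ E} (hM : IsOrderIdeal M) {x y : E}
    (hx : x ∈ M) (hy : y ∈ M) : x ⊔ y ∈ M := by
  rw [sup_eq_half_smul_add]
  exact M.smul_mem _ (M.add_mem (M.add_mem hx hy) (hM.abs_mem (M.sub_mem hy hx)))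

theorem IsOrderIdeal.inf_mem {M : Submodule ℝ E} (hM : IsOrderIdeal M) {x y : E}
    (hx : x ∈ M) (hy : y ∈ M) : x ⊓ y ∈ M := by
  have h := M.neg_mem (hM.sup_mem (M.neg_mem hx) (M.neg_mem hy))
  rwa [neg_sup, neg_neg, neg_neg] at h

theorem isOrderIdeal_idealOf (e : E) : IsOrderIdeal (idealOf e) := by
  rintro x y h ⟨c, hc⟩
  exact ⟨c, h.trans hc⟩

/-- The order ideal generated by an order ideal `M` and a further positive element `a`. -/
def adjoinIdeal (M : Submodule ℝ E) (a : E) : Submodule ℝ E where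
  carrier := {x | ∃ m ∈ M, ∃ c : ℝ, |x| ≤ m + c • a}
  add_mem' := by
    rintro x y ⟨m, hm, c, hc⟩ ⟨m', hm', d, hd⟩
    refine ⟨m + m', M.add_mem hm hm', c + d, (abs_add_le x y).trans ?_⟩
    calc |x| + |y| ≤ (m + c • a) + (m' + d • a) := add_le_add hc hd
      _ = _ := by rw [add_smul]; abel
  zero_mem' := ⟨0, M.zero_mem, 0, by simp⟩
  smul_mem' := by
    rintro b x ⟨m, hm, c, hc⟩
    refine ⟨|b| • m, M.smul_mem _ hm, |b| * c, ?_⟩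
    rw [abs_smul_eq, mul_smul, ← smul_add]
    exact smul_le_smul_of_nonneg_left hc (abs_nonneg b)

theorem isOrderIdeal_adjoinIdeal (M : Submodule ℝ E) (a : E) :
    IsOrderIdeal (adjoinIdeal M a) := by
  rintro x y h ⟨m, hm, c, hc⟩
  exact ⟨m, hm, c, h.trans hc⟩

theorem smul_inf_smul_eq_zero {a b : E} (h : a ⊓ b = 0) {c : ℝ} (hc : 0 ≤ c) :
    c • a ⊓ c • b = 0 := by
  rcases hc.eq_or_lt with rfl | hc
  · simp
  · rw [← smul_zero c, ← h]
    exact ((OrderIso.smulRight (β := E) hc).map_inf a b).symm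

/-- Maximal order ideals among those that do not contain `e`. -/
structure IsMaxIdeal (e : E) (M : Submodule ℝ E) : Prop where
  ideal : IsOrderIdeal M
  notMem : e ∉ M
  maximal : ∀ N : Submodule ℝ E, IsOrderIdeal N → e ∉ N → M ≤ N → N ≤ M

theorem exists_isMaxIdeal {e : E} {N : Submodule ℝ E} (hN : IsOrderIdeal N) (heN : e ∉ N) :
    ∃ M : Submodule ℝ E, IsMaxIdeal e M ∧ N ≤ M := by
  obtain ⟨M, hNM, hM⟩ := zorn_le_nonempty₀ {M : Submodule ℝ E | IsOrderIdeal M ∧ e ∉ M}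
    (fun c hc hchain y hy => by
      have hdir : DirectedOn (· ≤ ·) c := hchain.directedOn
      refine ⟨sSup c, ⟨?_, ?_⟩, fun z hz => le_sSup hz⟩
      · intro u v huv hv
        obtain ⟨K, hK, hvK⟩ := (Submodule.mem_sSup_of_directed ⟨y, hy⟩ hdir).1 hv
        exact (Submodule.mem_sSup_of_directed ⟨y, hy⟩ hdir).2 ⟨K, hK, (hc hK).1 huv hvK⟩
      · intro he
        obtain ⟨K, hK, hvK⟩ := (Submodule.mem_sSup_of_directed ⟨y, hy⟩ hdir).1 he
        exact (hc hK).2 hvK) N ⟨hN, heN⟩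
  exact ⟨M, ⟨hM.1.1, hM.1.2, fun K hK heK hMK => hM.2 ⟨hK, heK⟩ hMK⟩, hNM⟩

/-! ### Maximal ideals avoiding `e` are prime, and `e` spans its ideal modulo them -/

namespace IsMaxIdeal

variable {e : E} {M : Submodule ℝ E}

/-- By maximality the ideal generated by `M` and `a` contains `e`. Since `a ≥ 0`, the coefficient
may be enlarged until it is positive. -/
theorem exists_le_add (h : IsMaxIdeal e M) {a : E} (ha : 0 ≤ a) (haM : a ∉ M) :
    ∃ m ∈ M, 0 ≤ m ∧ ∃ c : ℝ, 0 < c ∧ |e| ≤ m + c • a := by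
  by_contra hcon
  push Not at hcon
  have hnot : e ∉ adjoinIdeal M a := by
    rintro ⟨m, hm, c, hc⟩
    refine hcon |m| (h.ideal.abs_mem hm) (abs_nonneg m) (max c 1) (by positivity) ?_
    refine hc.trans ?_
    gcongr
    · exact le_abs_self m
    · exact le_max_left _ _
  have hle : M ≤ adjoinIdeal M a := fun x hx =>
    ⟨|x|, h.ideal.abs_mem hx, 0, by simp⟩
  exact haM (h.maximal _ (isOrderIdeal_adjoinIdeal M a) hnot hle
    ⟨0, M.zero_mem, 1, by simp [abs_of_nonneg ha]⟩)

/-- If both elements were outside `M`, `|e|` would lie below `m + m'` plus a common multiple of `a`,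
and also below `m + m'` plus that multiple of `b`. The infimum of the two bounds is `m + m'` by
disjointness, so `e` would be in `M`. -/
theorem mem_or_mem (h : IsMaxIdeal e M) {a b : E} (hab : a ⊓ b = 0) : a ∈ M ∨ b ∈ M := by
  have ha : 0 ≤ a := hab ▸ inf_le_left
  have hb : 0 ≤ b := hab ▸ inf_le_right
  by_contra hcon
  push Not at hcon
  obtain ⟨m, hm, hm0, c, hc, h1⟩ := h.exists_le_add ha hcon.1
  obtain ⟨m', hm', hm0', d, hd, h2⟩ := h.exists_le_add hb hcon.2
  apply h.notMem
  refine h.ideal.mem_of_abs_le (M.add_mem hm hm') ?_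
  have h3 : |e| ≤ (m + m') + (max c d) • a := h1.trans (by
    gcongr
    · exact le_add_of_nonneg_right hm0'
    · exact le_max_left _ _)
  have h4 : |e| ≤ (m + m') + (max c d) • b := h2.trans (by
    gcongr
    · exact le_add_of_nonneg_left hm0
    · exact le_max_right _ _)
  have := le_inf h3 h4
  rwa [← add_inf, smul_inf_smul_eq_zero hab (by positivity), add_zero] at this

/-- This is the Archimedean property of the quotient by `M`, relative to `e`. If `e ≤ m + c • x⁺`,
the choice ε = 1/(2c) makes the error at most `e / 2`, which can be absorbed on the left. -/
theorem posPart_mem_of_forall (h : IsMaxIdeal e M) (he : 0 ≤ e) {x : E}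
    (hx : ∀ ε : ℝ, 0 < ε → (x - ε • e)⁺ ∈ M) : x⁺ ∈ M := by
  by_contra hcon
  obtain ⟨m, hm, hm0, c, hc, h1⟩ := h.exists_le_add (posPart_nonneg x) hcon
  rw [abs_of_nonneg he] at h1
  have hε : (0 : ℝ) < 1 / (2 * c) := by positivity
  have h2 := hx _ hε
  have h3 : x⁺ ≤ (x - (1 / (2 * c)) • e)⁺ + (1 / (2 * c)) • e := by
    refine sup_le ?_ ?_
    · rw [← sub_le_iff_le_add]; exact le_posPart _
    · exact add_nonneg (posPart_nonneg _) (smul_nonneg hε.le he)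
  have h4 : e ≤ m + c • (x - (1 / (2 * c)) • e)⁺ + (1 / 2 : ℝ) • e := by
    refine h1.trans ?_
    rw [add_assoc]
    gcongr
    refine (smul_le_smul_of_nonneg_left h3 hc.le).trans_eq ?_
    rw [smul_add, smul_smul]
    congr 2
    field_simp
  have h5 : (1 / 2 : ℝ) • e ≤ m + c • (x - (1 / (2 * c)) • e)⁺ := by
    have : (1 / 2 : ℝ) • e = e - (1 / 2 : ℝ) • e := by
      rw [eq_sub_iff_add_eq, ← add_smul]; norm_num
    rw [this, sub_le_iff_le_add]; exact h4
  have h6 : (1 / 2 : ℝ) • e ∈ M := h.ideal.mem_of_nonneg_of_le (M.add_mem hm (M.smul_mem _ h2))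
    (smul_nonneg (by norm_num) he) h5
  have := M.smul_mem 2 h6
  rw [smul_smul] at this
  norm_num at this
  exact h.notMem this

/-- The number is a Dedekind cut, the infimum of the r with `(x - r • e)⁺ ∈ M`. At the cut both the
positive and the negative part lie in `M`. -/
theorem exists_sub_smul_mem (h : IsMaxIdeal e M) (he : 0 ≤ e) {x : E} (hx : x ∈ idealOf e) :
    ∃ r : ℝ, x - r • e ∈ M := by
  obtain ⟨c, hc⟩ := hx
  set S : Set ℝ := {r | (x - r • e)⁺ ∈ M} with hS
  have hup : ∀ r ∈ S, ∀ s, r ≤ s → s ∈ S := fun r hr s hrs =>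
    h.ideal.mem_of_nonneg_of_le hr (posPart_nonneg _) (posPart_mono (by gcongr))
  have hne : c ∈ S := by
    have : (x - c • e)⁺ = 0 := posPart_eq_zero.2 (sub_nonpos.2 ((le_abs_self x).trans hc))
    simp [hS, this]
  have hbdd : ∀ r ∈ S, -c ≤ r := by
    intro r hr
    by_contra hlt
    push Not at hlt
    have h1 : (-c - r) • e ≤ (x - r • e)⁺ := by
      refine le_trans ?_ (le_posPart _)
      rw [sub_smul, neg_smul]
      gcongr
      exact neg_le.1 ((neg_le_abs x).trans hc)
    have h2 : (-c - r) • e ∈ M :=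
      h.ideal.mem_of_nonneg_of_le hr (smul_nonneg (by linarith) he) h1
    have h3 := M.smul_mem (-c - r)⁻¹ h2
    rw [smul_smul, inv_mul_cancel₀ (by linarith), one_smul] at h3
    exact h.notMem h3
  have hB : BddBelow S := ⟨-c, hbdd⟩
  refine ⟨sInf S, ?_⟩
  have hp : (x - sInf S • e)⁺ ∈ M := by
    refine h.posPart_mem_of_forall he fun ε hε => ?_
    obtain ⟨r, hr, hrε⟩ := exists_lt_of_csInf_lt ⟨c, hne⟩ (lt_add_of_pos_right (sInf S) hε)
    have := hup r hr _ hrε.le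
    rwa [hS, mem_ofPred_eq, add_smul, ← sub_sub] at this
  have hn : (x - sInf S • e)⁻ ∈ M := by
    rw [← posPart_neg]
    refine h.posPart_mem_of_forall he fun ε hε => ?_
    -- Strictly below the cut the positive part is not in `M`, so primeness puts the disjoint
    -- negative part there.
    have hnot : sInf S - ε ∉ S := fun hmem => by
      have := csInf_le hB hmem
      linarith
    have h1 := (h.mem_or_mem (posPart_inf_negPart_eq_zero (x - (sInf S - ε) • e))).resolve_left hnot
    rw [← posPart_neg] at h1
    convert h1 using 2
    rw [sub_smul]; abel
  rw [← posPart_sub_negPart (x - sInf S • e)]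
  exact M.sub_mem hp hn

end IsMaxIdeal

/-- A linear functional that is a lattice homomorphism on the ideal generated by `e` and is
normalised at `e`. -/
structure IsState (e : E) (ω : E →ₗ[ℝ] ℝ) : Prop where
  map_abs : ∀ x ∈ idealOf e, ω |x| = |ω x|
  map_unit : ω e = 1

namespace IsState

variable {e : E} {ω : E →ₗ[ℝ] ℝ}

theorem map_nonneg (h : IsState e ω) {x : E} (hx : x ∈ idealOf e) (hx0 : 0 ≤ x) : 0 ≤ ω x := by
  rw [← abs_of_nonneg hx0, h.map_abs x hx]
  exact abs_nonneg _

theorem mono (h : IsState e ω) {x y : E} (hx : x ∈ idealOf e) (hy : y ∈ idealOf e) (hxy : x ≤ y) :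
    ω x ≤ ω y := by
  have := h.map_nonneg ((idealOf e).sub_mem hy hx) (sub_nonneg.2 hxy)
  rwa [map_sub, sub_nonneg] at this

theorem map_sup (h : IsState e ω) {x y : E} (hx : x ∈ idealOf e) (hy : y ∈ idealOf e) :
    ω (x ⊔ y) = ω x ⊔ ω y := by
  rw [sup_eq_half_smul_add x y, sup_eq_half_smul_add (ω x) (ω y), map_smul, map_add, map_add,
    h.map_abs _ ((idealOf e).sub_mem hy hx), map_sub]

theorem map_inf (h : IsState e ω) {x y : E} (hx : x ∈ idealOf e) (hy : y ∈ idealOf e) :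
    ω (x ⊓ y) = ω x ⊓ ω y := by
  have := h.map_sup ((idealOf e).neg_mem hx) ((idealOf e).neg_mem hy)
  rw [← neg_inf, map_neg, map_neg, map_neg, ← neg_inf] at this
  exact neg_injective this

end IsState

/-- Any functional vanishing on `M` and not at `e` will do after normalisation. On the ideal of `e`
it reads off the r with `x - r • e ∈ M`, and `||x| - |r| • e| ≤ |x - r • e|` shows that the modulus
is preserved. Nothing is controlled outside that ideal. -/
theorem IsMaxIdeal.exists_isState {e : E} {M : Submodule ℝ E} (h : IsMaxIdeal e M) (he : 0 ≤ e) :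
    ∃ ω : E →ₗ[ℝ] ℝ, IsState e ω ∧ ∀ x ∈ M, ω x = 0 := by
  obtain ⟨f, hf, hM⟩ := Submodule.exists_le_ker_of_notMem h.notMem
  have hker : ∀ x ∈ M, ((f e)⁻¹ • f) x = 0 := fun x hx => by
    simp [LinearMap.mem_ker.1 (hM hx)]
  have hunit : ((f e)⁻¹ • f) e = 1 := by simp [hf]
  refine ⟨(f e)⁻¹ • f, ⟨fun x hx => ?_, hunit⟩, hker⟩
  obtain ⟨r, hr⟩ := h.exists_sub_smul_mem he hx
  have key : ∀ (y : E) (s : ℝ), y - s • e ∈ M → ((f e)⁻¹ • f) y = s := fun y s hy => by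
    have := hker _ hy
    rw [map_sub, map_smul, hunit, smul_eq_mul, mul_one] at this
    linarith
  rw [key x r hr]
  refine key _ _ (h.ideal (y := x - r • e) ?_ hr)
  have := abs_abs_sub_abs_le x (r • e)
  rwa [abs_smul_eq, abs_of_nonneg he] at this

/-- For a suitable n, z = n w - e is not ≤ 0. A state that kills `z⁻` satisfies n ω(w) ≥ ω(e) = 1,
and it comes from a maximal ideal containing `z⁻`. -/
theorem exists_isState_pos (hE : IsArchimedeanLattice E) {e w : E} (he : 0 ≤ e)
    (hw : w ∈ idealOf e) (hpos : ¬ w ≤ 0) : ∃ ω : E →ₗ[ℝ] ℝ, IsState e ω ∧ 0 < ω w := by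
  have : ∃ n : ℕ, ¬ (n : ℝ) • w ≤ e := by
    by_contra hcon
    push Not at hcon
    exact hpos (hE w e hcon)
  obtain ⟨n, hn⟩ := this
  set z := (n : ℝ) • w - e with hz
  have hzmem : z ∈ idealOf e := (idealOf e).sub_mem ((idealOf e).smul_mem _ hw) (self_mem_idealOf he)
  -- Otherwise `z⁺`, which lies below a multiple of `e`, would lie below a multiple of the disjoint
  -- element `z⁻` and hence vanish.
  have hnot : e ∉ idealOf z⁻ := by
    rintro ⟨k, hk⟩
    rw [abs_of_nonneg he] at hk
    obtain ⟨c, hc⟩ := hzmem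
    have h1 : z⁺ ≤ (max 1 (max c 0 * k)) • z⁻ := by
      calc z⁺ ≤ |z| := sup_le (le_abs_self z) (abs_nonneg z)
        _ ≤ c • e := hc
        _ ≤ (max c 0) • e := by gcongr; exact le_max_left _ _
        _ ≤ (max c 0) • (k • z⁻) := smul_le_smul_of_nonneg_left hk (le_max_right _ _)
        _ = (max c 0 * k) • z⁻ := smul_smul _ _ _
        _ ≤ _ := by exact smul_le_smul_of_nonneg_right (le_max_right _ _) (negPart_nonneg z)
    have h2 : z⁺ ≤ (max 1 (max c 0 * k)) • z⁺ := by
      calc z⁺ = (1 : ℝ) • z⁺ := (one_smul _ _).symm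
        _ ≤ _ := by exact smul_le_smul_of_nonneg_right (le_max_left _ _) (posPart_nonneg z)
    have h3 := le_inf h2 h1
    rw [smul_inf_smul_eq_zero (posPart_inf_negPart_eq_zero z) (by positivity)] at h3
    exact hn (sub_nonpos.1 ((le_posPart z).trans h3))
  obtain ⟨M, hM, hle⟩ := exists_isMaxIdeal (isOrderIdeal_idealOf z⁻) hnot
  obtain ⟨ω, hω, hker⟩ := hM.exists_isState he
  refine ⟨ω, hω, ?_⟩
  have h0 : ω z⁻ = 0 := hker _ (hle (self_mem_idealOf (negPart_nonneg z)))
  have h1 : 0 ≤ ω z⁺ := by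
    refine hω.map_nonneg ((isOrderIdeal_idealOf e).mem_of_nonneg_of_le
      ((isOrderIdeal_idealOf e).abs_mem hzmem) (posPart_nonneg z) ?_) (posPart_nonneg z)
    exact sup_le (le_abs_self z) (abs_nonneg z)
  have h2 : 0 ≤ ω z := by
    rw [← posPart_sub_negPart z, map_sub, h0, sub_zero]
    exact h1
  rw [hz, map_sub, map_smul, hω.map_unit, smul_eq_mul] at h2
  by_contra hcon
  push Not at hcon
  have := mul_nonpos_of_nonneg_of_nonpos (Nat.cast_nonneg (α := ℝ) n) hcon
  linarith

/-- States separate the points of the ideal generated by `e`. -/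
theorem le_of_forall_isState (hE : IsArchimedeanLattice E) {e x y : E} (he : 0 ≤ e)
    (hx : x ∈ idealOf e) (hy : y ∈ idealOf e) (h : ∀ ω : E →ₗ[ℝ] ℝ, IsState e ω → ω x ≤ ω y) :
    x ≤ y := by
  by_contra hcon
  obtain ⟨ω, hω, hpos⟩ := exists_isState_pos hE he ((idealOf e).sub_mem hx hy)
    (fun hle => hcon (sub_nonpos.1 hle))
  have := h ω hω
  rw [map_sub] at hpos
  linarith

theorem eq_of_forall_isState (hE : IsArchimedeanLattice E) {e x y : E} (he : 0 ≤ e)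
    (hx : x ∈ idealOf e) (hy : y ∈ idealOf e) (h : ∀ ω : E →ₗ[ℝ] ℝ, IsState e ω → ω x = ω y) :
    x = y :=
  le_antisymm (le_of_forall_isState hE he hx hy fun ω hω => (h ω hω).le)
    (le_of_forall_isState hE he hy hx fun ω hω => (h ω hω).ge)

/-! ### Riesz decomposition -/

theorem exists_sum_eq_of_le_sum {ι : Type*} (s : Finset ι) (z : ι → E) (hz : ∀ i ∈ s, 0 ≤ z i)
    {v : E} (hv : 0 ≤ v) (h : v ≤ ∑ i ∈ s, z i) :
    ∃ u : ι → E, (∀ i ∈ s, 0 ≤ u i ∧ u i ≤ z i) ∧ ∑ i ∈ s, u i = v := by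
  classical
  induction s using Finset.induction_on generalizing v with
  | empty =>
    refine ⟨0, by simp, ?_⟩
    simp only [Finset.sum_empty] at h ⊢
    exact le_antisymm hv h
  | insert a s ha ih =>
    have hza := hz a (Finset.mem_insert_self a s)
    have hsum : 0 ≤ ∑ i ∈ s, z i :=
      Finset.sum_nonneg fun i hi => hz i (Finset.mem_insert_of_mem hi)
    rw [Finset.sum_insert ha] at h
    obtain ⟨u, hu, hsu⟩ := ih (fun i hi => hz i (Finset.mem_insert_of_mem hi))
      (v := v - v ⊓ z a) (sub_nonneg.2 inf_le_left) (by
        rw [sub_le_iff_le_add, add_inf]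
        exact le_inf (le_add_of_nonneg_left hsum) (by rwa [add_comm]))
    have hne : ∀ i ∈ s, i ≠ a := fun i hi hia => ha (hia ▸ hi)
    refine ⟨Function.update u a (v ⊓ z a), ?_, ?_⟩
    · intro i hi
      rcases Finset.mem_insert.1 hi with rfl | hi
      · simp only [Function.update_self]
        exact ⟨le_inf hv hza, inf_le_right⟩
      · rw [Function.update_of_ne (hne i hi)]
        exact hu i hi
    · rw [Finset.sum_insert ha, Function.update_self,
        Finset.sum_congr rfl fun i hi => Function.update_of_ne (hne i hi) _ _, hsu]
      abel

/-- A matrix with row sums `z` and column sums `v` is built column by column: the last column is a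
Riesz decomposition of `v N` along the `z i`, and the remainders `z i - a i` are the row sums left
for the induction. -/
theorem exists_refinement {ι : Type*} (s : Finset ι) (N : ℕ) (z : ι → E) (v : ℕ → E)
    (hz : ∀ i ∈ s, 0 ≤ z i) (hv : ∀ k < N, 0 ≤ v k)
    (h : ∑ i ∈ s, z i = ∑ k ∈ Finset.range N, v k) :
    ∃ u : ι → ℕ → E, (∀ i ∈ s, ∀ k < N, 0 ≤ u i k) ∧
      (∀ i ∈ s, ∑ k ∈ Finset.range N, u i k = z i) ∧ ∀ k < N, ∑ i ∈ s, u i k = v k := by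
  induction N generalizing z with
  | zero =>
    refine ⟨fun _ _ => 0, by simp, fun i hi => ?_, by simp⟩
    rw [Finset.range_zero, Finset.sum_empty] at h ⊢
    exact ((Finset.sum_eq_zero_iff_of_nonneg hz).1 h i hi).symm
  | succ N ih =>
    rw [Finset.sum_range_succ] at h
    obtain ⟨a, ha, hsa⟩ := exists_sum_eq_of_le_sum s z hz (hv N N.lt_succ_self) (by
      rw [h]
      exact le_add_of_nonneg_left (Finset.sum_nonneg fun k hk =>
        hv k ((Finset.mem_range.1 hk).trans N.lt_succ_self)))
    obtain ⟨u, hu0, hu1, hu2⟩ := ih (fun i => z i - a i) (fun i hi => sub_nonneg.2 (ha i hi).2)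
      (fun k hk => hv k (hk.trans N.lt_succ_self)) (by
        rw [Finset.sum_sub_distrib, h, hsa, add_sub_cancel_right])
    refine ⟨fun i k => if k = N then a i else u i k, ?_, ?_, ?_⟩
    · intro i hi k hk
      by_cases hkN : k = N
      · simp only [hkN, if_true]; exact (ha i hi).1
      · simp only [hkN, if_false]; exact hu0 i hi k (by omega)
    · intro i hi
      simp only [Finset.sum_range_succ, if_true]
      rw [Finset.sum_congr rfl fun k hk =>
        if_neg (Finset.mem_range.1 hk).ne, hu1 i hi]
      abel
    · intro k hk
      by_cases hkN : k = N
      · simp only [hkN, if_true]; exact hsa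
      · simp only [hkN, if_false]; exact hu2 k (by omega)

end VectorLattice

/-! ### Krivine's functional calculus -/

namespace HomFun

theorem apply_smul (h : HomFun) {a : ℝ} (ha : 0 ≤ a) (p : ℝ × ℝ) : h.1 (a • p) = a * h.1 p :=
  h.2 a ha p

theorem apply_zero (h : HomFun) : h.1 (0 : ℝ × ℝ) = 0 := by
  simpa using HomFun.apply_smul h le_rfl 0

/-- The first coordinate. -/
def fst : HomFun := ⟨⟨Prod.fst, continuous_fst⟩, fun _ _ _ => rfl⟩

/-- The second coordinate. -/
def snd : HomFun := ⟨⟨Prod.snd, continuous_snd⟩, fun _ _ _ => rfl⟩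

/-- The pointwise supremum. -/
def sup (f g : HomFun) : HomFun :=
  ⟨f.1 ⊔ g.1, fun a ha p => by
    simp only [ContinuousMap.sup_apply, HomFun.apply_smul f ha, HomFun.apply_smul g ha, mul_max_of_nonneg _ _ ha]⟩

/-- The pointwise modulus. -/
def abs (f : HomFun) : HomFun := sup f (-f)

/-- The `ℓ¹`-norm on `ℝ²`. -/
def norm₁ : HomFun := abs fst + abs snd

theorem abs_apply (f : HomFun) (p : ℝ × ℝ) : (abs f).1 p = |f.1 p| := rfl

theorem norm₁_apply (p : ℝ × ℝ) : norm₁.1 p = |p.1| + |p.2| := rfl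

theorem isCompact_sphere : IsCompact {p : ℝ × ℝ | norm₁.1 p = 1} := by
  refine Metric.isCompact_of_isClosed_isBounded (isClosed_eq norm₁.1.continuous continuous_const) ?_
  refine (Metric.isBounded_closedBall (x := (0 : ℝ × ℝ)) (r := 1)).subset fun p hp => ?_
  have h1 : |p.1| + |p.2| = 1 := hp
  rw [mem_closedBall_zero_iff, Prod.norm_def, Real.norm_eq_abs, Real.norm_eq_abs]
  exact max_le (by linarith [abs_nonneg p.2]) (by linarith [abs_nonneg p.1])

/-- On the compact part of the ℓ¹ sphere where |h| ≥ ε, `d` has a positive minimum, so n = max |h| /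
min d works; homogeneity extends this to the plane. An inclusion of zero sets thus becomes an
inequality, which every lattice homomorphism respects. -/
theorem exists_abs_le_add (h d : HomFun) (hd : ∀ p, 0 ≤ d.1 p) (hdh : ∀ p, d.1 p = 0 → h.1 p = 0)
    {ε : ℝ} (hε : 0 < ε) :
    ∃ n : ℝ, 0 ≤ n ∧ ∀ p, |h.1 p| ≤ ε * norm₁.1 p + n * d.1 p := by
  have key : ∃ n : ℝ, 0 ≤ n ∧ ∀ p, norm₁.1 p = 1 → |h.1 p| ≤ ε + n * d.1 p := by
    set K : Set (ℝ × ℝ) := {p | norm₁.1 p = 1} ∩ {p | ε ≤ |h.1 p|} with hK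
    have hKc : IsCompact K := isCompact_sphere.inter_right
      (isClosed_le continuous_const (h.1.continuous.abs))
    rcases K.eq_empty_or_nonempty with hemp | hne
    · refine ⟨0, le_rfl, fun p hp => ?_⟩
      by_contra hcon
      have : p ∈ K := ⟨hp, by
        simp only [zero_mul, add_zero, not_le] at hcon
        exact hcon.le⟩
      rw [hemp] at this
      exact this
    · obtain ⟨q, hq, hqmin⟩ := hKc.exists_isMinOn hne d.1.continuous.continuousOn
      obtain ⟨r, hr, hrmax⟩ := hKc.exists_isMaxOn hne h.1.continuous.abs.continuousOn
      have hδ : 0 < d.1 q := by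
        refine (hd q).lt_of_ne' fun h0 => ?_
        have : ε ≤ |h.1 q| := hq.2
        rw [hdh q h0, abs_zero] at this
        linarith
      refine ⟨|h.1 r| / d.1 q, by positivity, fun p hp => ?_⟩
      by_cases hpK : ε ≤ |h.1 p|
      · have h1 : |h.1 p| ≤ |h.1 r| := hrmax (⟨hp, hpK⟩ : p ∈ K)
        have h2 : d.1 q ≤ d.1 p := hqmin (⟨hp, hpK⟩ : p ∈ K)
        have h3 : |h.1 r| ≤ |h.1 r| / d.1 q * d.1 p := by
          rw [div_mul_eq_mul_div, le_div_iff₀ hδ]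
          gcongr
        linarith
      · have : 0 ≤ |h.1 r| / d.1 q * d.1 p := mul_nonneg (by positivity) (hd p)
        linarith
  obtain ⟨n, hn, hnp⟩ := key
  refine ⟨n, hn, fun p => ?_⟩
  have hN0 : 0 ≤ norm₁.1 p := by rw [norm₁_apply]; positivity
  rcases hN0.eq_or_lt with h0 | hpos
  · have hp : p = 0 := by
      rw [norm₁_apply] at h0
      have h1 : |p.1| = 0 := by linarith [abs_nonneg p.1, abs_nonneg p.2]
      have h2 : |p.2| = 0 := by linarith [abs_nonneg p.1, abs_nonneg p.2]
      exact Prod.ext (abs_eq_zero.1 h1) (abs_eq_zero.1 h2)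
    rw [hp, HomFun.apply_zero h, HomFun.apply_zero d, HomFun.apply_zero norm₁]
    simp
  · set q := (norm₁.1 p)⁻¹ • p with hq
    have hpq : p = norm₁.1 p • q := by rw [hq, smul_smul, mul_inv_cancel₀ hpos.ne', one_smul]
    have hq1 : norm₁.1 q = 1 := by
      rw [hq, HomFun.apply_smul norm₁ (inv_nonneg.2 hN0), inv_mul_cancel₀ hpos.ne']
    have e1 : h.1 p = norm₁.1 p * h.1 q := by conv_lhs => rw [hpq, HomFun.apply_smul h hN0]
    have e2 : d.1 p = norm₁.1 p * d.1 q := by conv_lhs => rw [hpq, HomFun.apply_smul d hN0]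
    rw [e1, e2, abs_mul, abs_of_pos hpos]
    calc norm₁.1 p * |h.1 q| ≤ norm₁.1 p * (ε + n * d.1 q) := by
          gcongr
          exact hnp q hq1
      _ = _ := by ring

end HomFun

section Krivine

variable {E : Type*} [AddCommGroup E] [Module ℝ E] [Lattice E] [IsOrderedAddMonoid E]
  [IsOrderedModule ℝ E]

namespace IsKrivineCalculus

variable {u v : E} {τ : HomFun →ₗ[ℝ] E}

theorem mono (hτ : IsKrivineCalculus u v τ) {f g : HomFun} (h : ∀ p, f.1 p ≤ g.1 p) :
    τ f ≤ τ g := by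
  have := hτ.map_sup f g g fun p => (sup_eq_right.2 (h p)).symm
  rw [this]
  exact le_sup_left

theorem map_abs (hτ : IsKrivineCalculus u v τ) (f : HomFun) : τ (HomFun.abs f) = |τ f| := by
  rw [hτ.map_sup f (-f) (HomFun.abs f) fun p => rfl, map_neg]
  rfl

theorem map_norm₁ (hτ : IsKrivineCalculus u v τ) (hu : 0 ≤ u) (hv : 0 ≤ v) :
    τ HomFun.norm₁ = u + v := by
  rw [HomFun.norm₁, map_add, hτ.map_abs, hτ.map_abs, hτ.map_fst HomFun.fst fun _ => rfl,
    hτ.map_snd HomFun.snd fun _ => rfl, abs_of_nonneg hu, abs_of_nonneg hv]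

theorem mem_idealOf (hτ : IsKrivineCalculus u v τ) (hu : 0 ≤ u) (hv : 0 ≤ v) (h : HomFun) :
    τ h ∈ idealOf (u + v) := by
  obtain ⟨n, -, hn⟩ := HomFun.exists_abs_le_add h HomFun.norm₁
    (fun p => by rw [HomFun.norm₁_apply]; positivity) (fun p hp => by
      rw [HomFun.norm₁_apply] at hp
      have h1 : |p.1| = 0 := by linarith [abs_nonneg p.1, abs_nonneg p.2]
      have h2 : |p.2| = 0 := by linarith [abs_nonneg p.1, abs_nonneg p.2]
      rw [show p = 0 from Prod.ext (abs_eq_zero.1 h1) (abs_eq_zero.1 h2), HomFun.apply_zero h]) one_pos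
  refine ⟨1 + n, ?_⟩
  rw [← hτ.map_abs, ← hτ.map_norm₁ hu hv, ← map_smul]
  refine hτ.mono fun p => ?_
  have := hn p
  rw [HomFun.abs_apply]
  change _ ≤ (1 + n) * HomFun.norm₁.1 p
  linarith

/-- States commute with Krivine's functional calculus. -/
theorem state_apply (hτ : IsKrivineCalculus u v τ) (hu : 0 ≤ u) (hv : 0 ≤ v)
    {ω : E →ₗ[ℝ] ℝ} (hω : IsState (u + v) ω) (h : HomFun) : ω (τ h) = h.1 (ω u, ω v) := by
  have hmem := hτ.mem_idealOf hu hv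
  have hωu : 0 ≤ ω u := hω.map_nonneg ((isOrderIdeal_idealOf _).mem_of_nonneg_of_le
    (self_mem_idealOf (add_nonneg hu hv)) hu (le_add_of_nonneg_right hv)) hu
  have hωv : 0 ≤ ω v := hω.map_nonneg ((isOrderIdeal_idealOf _).mem_of_nonneg_of_le
    (self_mem_idealOf (add_nonneg hu hv)) hv (le_add_of_nonneg_left hu)) hv
  have hunit : ω u + ω v = 1 := by rw [← map_add, hω.map_unit]
  have hfst : τ HomFun.fst = u := hτ.map_fst _ fun _ => rfl
  have hsnd : τ HomFun.snd = v := hτ.map_snd _ fun _ => rfl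
  have habs : ∀ f : HomFun, ω (τ (HomFun.abs f)) = |ω (τ f)| := fun f => by
    rw [hτ.map_abs, hω.map_abs _ (hmem f)]
  have hnorm : ω (τ HomFun.norm₁) = 1 := by rw [hτ.map_norm₁ hu hv, hω.map_unit]
  -- `g` vanishes on the ray through (ω u, ω v), and `d ≥ 0` vanishes exactly there. Since `ω (τ d)
  -- = 0`, the inequality |g| ≤ ε norm₁ + n d yields `|ω (τ g)| ≤ ε` for every ε. As `ω (τ norm₁) =
  -- 1`, `ω (τ g) = 0` is the claim.
  set g : HomFun := h - h.1 (ω u, ω v) • HomFun.norm₁ with hg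
  set d : HomFun := HomFun.abs (ω v • HomFun.fst - ω u • HomFun.snd) +
    ((HomFun.abs HomFun.fst - HomFun.fst) + (HomFun.abs HomFun.snd - HomFun.snd)) with hd
  have hdp : ∀ p : ℝ × ℝ, d.1 p = |ω v * p.1 - ω u * p.2| + ((|p.1| - p.1) + (|p.2| - p.2)) :=
    fun p => rfl
  have hgp : ∀ p : ℝ × ℝ, g.1 p = h.1 p - h.1 (ω u, ω v) * (|p.1| + |p.2|) := fun p => rfl
  have hd0 : ω (τ d) = 0 := by
    rw [hd, map_add, map_add, map_add, map_add, map_sub, map_sub, map_sub, map_sub, habs, habs,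
      habs, map_sub, map_sub, map_smul, map_smul, map_smul, map_smul, hfst, hsnd,
      abs_of_nonneg hωu, abs_of_nonneg hωv, smul_eq_mul, smul_eq_mul, mul_comm, sub_self, abs_zero]
    ring
  have hg0 : ω (τ g) = 0 := by
    have hle : ∀ ε : ℝ, 0 < ε → |ω (τ g)| ≤ ε := by
      intro ε hε
      obtain ⟨n, -, hn⟩ := HomFun.exists_abs_le_add g d
        (fun p => by
          rw [hdp]
          linarith [abs_nonneg (ω v * p.1 - ω u * p.2), le_abs_self p.1, le_abs_self p.2])
        (fun p hp => by
          rw [hdp] at hp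
          have h0 := abs_nonneg (ω v * p.1 - ω u * p.2)
          have h1 := le_abs_self p.1
          have h2 := le_abs_self p.2
          have e0 : ω v * p.1 - ω u * p.2 = 0 := abs_eq_zero.1 (by linarith)
          have e1 : |p.1| = p.1 := by linarith
          have e2 : |p.2| = p.2 := by linarith
          have hp1 : 0 ≤ p.1 := abs_eq_self.1 e1
          have hp2 : 0 ≤ p.2 := abs_eq_self.1 e2
          have hpp : p = (p.1 + p.2) • (ω u, ω v) := by
            refine Prod.ext ?_ ?_
            · change p.1 = (p.1 + p.2) * ω u
              linear_combination (-p.1) * hunit + e0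
            · change p.2 = (p.1 + p.2) * ω v
              linear_combination (-p.2) * hunit - e0
          rw [hgp, e1, e2]
          conv_lhs => enter [1]; rw [hpp]
          rw [HomFun.apply_smul h (add_nonneg hp1 hp2)]
          ring) hε
      have h1 : τ (HomFun.abs g) ≤ τ (ε • HomFun.norm₁ + n • d) := hτ.mono fun p => hn p
      have h2 := hω.mono (hmem _) (hmem _) h1
      rw [habs, map_add, map_add, map_smul, map_smul, map_smul, map_smul, hnorm, hd0] at h2
      simpa using h2
    have : |ω (τ g)| ≤ 0 := le_of_forall_pos_le_add fun ε hε => by simpa using hle ε hε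
    exact abs_nonpos_iff.1 this
  rw [hg, map_sub, map_sub, map_smul, map_smul, hnorm, smul_eq_mul, mul_one] at hg0
  linarith

end IsKrivineCalculus

/-- Completeness for uniform convergence relative to `e`. -/
def IsUniformlyCompleteAt (e : E) : Prop :=
  ∀ x : ℕ → E, (∀ n, |x (n + 1) - x n| ≤ ((1 / 2 : ℝ) ^ n) • e) →
    ∃ l : E, ∀ n, |x n - l| ≤ (2 * (1 / 2 : ℝ) ^ n) • e

/-- Lattice form of Stone–Weierstrass. A state normalised at `u + v` is seen by `u` and `v` only
through s = ω u ∈ [0, 1]. The functions of s realised by lattice elements form a sublattice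
containing the affine functions, hence are dense; uniform completeness makes the set closed. -/
theorem exists_state_eq_apply (hE : IsArchimedeanLattice E) {u v : E} (hu : 0 ≤ u) (hv : 0 ≤ v)
    (hc : IsUniformlyCompleteAt (u + v)) (g : C(unitInterval, ℝ)) :
    ∃ x ∈ idealOf (u + v), ∀ ω : E →ₗ[ℝ] ℝ, IsState (u + v) ω →
      ∀ s : unitInterval, (s : ℝ) = ω u → ω x = g s := by
  have he : 0 ≤ u + v := add_nonneg hu hv
  have hemem := self_mem_idealOf he
  have humem : u ∈ idealOf (u + v) := (isOrderIdeal_idealOf _).mem_of_nonneg_of_le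
    hemem hu (le_add_of_nonneg_right hv)
  set L : Set C(unitInterval, ℝ) := {g | ∃ x ∈ idealOf (u + v), ∀ ω : E →ₗ[ℝ] ℝ,
    IsState (u + v) ω → ∀ s : unitInterval, (s : ℝ) = ω u → ω x = g s} with hL
  have hdense : closure L = ⊤ := by
    refine ContinuousMap.sublattice_closure_eq_top L ⟨0, 0, Submodule.zero_mem _, by simp⟩ ?_ ?_ ?_
    · rintro f ⟨x, hx, hfx⟩ g ⟨y, hy, hgy⟩
      exact ⟨x ⊓ y, (isOrderIdeal_idealOf _).inf_mem hx hy, fun ω hω s hs => by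
        rw [hω.map_inf hx hy, hfx ω hω s hs, hgy ω hω s hs]; rfl⟩
    · rintro f ⟨x, hx, hfx⟩ g ⟨y, hy, hgy⟩
      exact ⟨x ⊔ y, (isOrderIdeal_idealOf _).sup_mem hx hy, fun ω hω s hs => by
        rw [hω.map_sup hx hy, hfx ω hω s hs, hgy ω hω s hs]; rfl⟩
    · intro w x y
      have haff : ∀ a b : ℝ, (⟨fun s : unitInterval => a + b * (s : ℝ), by fun_prop⟩ :
          C(unitInterval, ℝ)) ∈ L := fun a b =>
        ⟨a • (u + v) + b • u, Submodule.add_mem _ (Submodule.smul_mem _ _ hemem)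
          (Submodule.smul_mem _ _ humem), fun ω hω s hs => by
            rw [map_add, map_smul, map_smul, hω.map_unit, ← hs]; simp⟩
      by_cases hxy : x = y
      · subst hxy
        exact ⟨_, haff (w x) 0, by simp, by simp⟩
      · have hne : (y : ℝ) - x ≠ 0 := sub_ne_zero.2 fun h => hxy (Subtype.ext h.symm)
        refine ⟨_, haff (w x - (w y - w x) / (y - x) * x) ((w y - w x) / (y - x)), ?_, ?_⟩
        · simp
        · simp only [ContinuousMap.coe_mk]
          field_simp
          ring
  have hg : g ∈ closure L := by rw [hdense]; trivial
  -- With tolerance 2⁻ⁿ/2, consecutive approximants differ by at most 3/4 · 2⁻ⁿ, within what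
  -- `IsUniformlyCompleteAt` demands.
  have happ : ∀ n : ℕ, ∃ f ∈ L, dist g f < (1 / 2 : ℝ) ^ n / 2 := fun n =>
    Metric.mem_closure_iff.1 hg _ (by positivity)
  choose f hfL hfd using happ
  choose x hx hfx using hfL
  have hest : ∀ n (s : unitInterval), |g s - f n s| ≤ (1 / 2 : ℝ) ^ n / 2 := fun n s => by
    rw [← Real.dist_eq]
    exact (ContinuousMap.dist_apply_le_dist s).trans (hfd n).le
  have hval : ∀ ω : E →ₗ[ℝ] ℝ, IsState (u + v) ω → ∃ s : unitInterval, (s : ℝ) = ω u := by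
    intro ω hω
    refine ⟨⟨ω u, hω.map_nonneg humem hu, ?_⟩, rfl⟩
    have := hω.mono humem hemem (le_add_of_nonneg_right hv)
    rwa [hω.map_unit] at this
  obtain ⟨l, hl⟩ := hc x fun n => by
    refine le_of_forall_isState hE he
      ((isOrderIdeal_idealOf _).abs_mem (Submodule.sub_mem _ (hx _) (hx _)))
      (Submodule.smul_mem _ _ hemem) fun ω hω => ?_
    obtain ⟨s, hs⟩ := hval ω hω
    rw [hω.map_abs _ (Submodule.sub_mem _ (hx _) (hx _)), map_sub, map_smul, hω.map_unit,
      hfx _ ω hω s hs, hfx _ ω hω s hs, smul_eq_mul, mul_one]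
    have h1 := abs_le.1 (hest n s)
    have h2 := abs_le.1 (hest (n + 1) s)
    rw [pow_succ] at h2
    have h3 : (0 : ℝ) < (1 / 2) ^ n := by positivity
    rw [abs_le]
    constructor <;> linarith [h1.1, h1.2, h2.1, h2.2]
  have hdiff : ∀ n, x n - l ∈ idealOf (u + v) := fun n => ⟨_, hl n⟩
  have hlmem : l ∈ idealOf (u + v) := by
    have := Submodule.sub_mem _ (hx 0) (hdiff 0)
    rwa [sub_sub_cancel] at this
  refine ⟨l, hlmem, fun ω hω s hs => ?_⟩
  have hlim : Tendsto (fun n : ℕ => 3 * (1 / 2 : ℝ) ^ n) atTop (𝓝 (3 * 0)) :=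
    (tendsto_pow_atTop_nhds_zero_of_lt_one (by norm_num) (by norm_num)).const_mul 3
  have hle : ∀ n : ℕ, |ω l - g s| ≤ 3 * (1 / 2 : ℝ) ^ n := by
    intro n
    have h1 := hω.mono ((isOrderIdeal_idealOf _).abs_mem (hdiff n))
      (Submodule.smul_mem _ _ hemem) (hl n)
    rw [hω.map_abs _ (hdiff n), map_sub, map_smul, hω.map_unit, hfx n ω hω s hs, smul_eq_mul,
      mul_one] at h1
    have h1 := abs_le.1 h1
    have h2 := abs_le.1 (hest n s)
    have h3 : (0 : ℝ) < (1 / 2) ^ n := by positivity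
    rw [abs_le]
    constructor <;> linarith [h1.1, h1.2, h2.1, h2.2]
  have := ge_of_tendsto' hlim hle
  rw [mul_zero] at this
  exact sub_eq_zero.1 (abs_nonpos_iff.1 this)

/-- Existence of Krivine's functional calculus. -/
theorem exists_isKrivineCalculus (hE : IsArchimedeanLattice E) {u v : E} (hu : 0 ≤ u) (hv : 0 ≤ v)
    (hc : IsUniformlyCompleteAt (u + v)) : ∃ τ : HomFun →ₗ[ℝ] E, IsKrivineCalculus u v τ := by
  have he : 0 ≤ u + v := add_nonneg hu hv
  have hemem := self_mem_idealOf he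
  have humem : u ∈ idealOf (u + v) := (isOrderIdeal_idealOf _).mem_of_nonneg_of_le
    hemem hu (le_add_of_nonneg_right hv)
  have hvmem : v ∈ idealOf (u + v) := (isOrderIdeal_idealOf _).mem_of_nonneg_of_le
    hemem hv (le_add_of_nonneg_left hu)
  have hex : ∀ h : HomFun, ∃ x ∈ idealOf (u + v), ∀ ω : E →ₗ[ℝ] ℝ, IsState (u + v) ω →
      ω x = h.1 (ω u, ω v) := by
    intro h
    obtain ⟨x, hx, hxω⟩ := exists_state_eq_apply hE hu hv hc
      ⟨fun s : unitInterval => h.1 ((s : ℝ), 1 - (s : ℝ)), by fun_prop⟩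
    refine ⟨x, hx, fun ω hω => ?_⟩
    have hunit : ω u + ω v = 1 := by rw [← map_add, hω.map_unit]
    rw [hxω ω hω ⟨ω u, hω.map_nonneg humem hu, by linarith [hω.map_nonneg hvmem hv]⟩ rfl]
    simp only [ContinuousMap.coe_mk]
    rw [← hunit, add_sub_cancel_left]
  -- States separate points of the ideal, so the chosen elements are unique, and `τ` is linear and
  -- preserves suprema because evaluation does.
  choose τ hτmem hτ using hex
  refine ⟨{ toFun := τ, map_add' := fun f g => ?_, map_smul' := fun c f => ?_ }, ?_, ?_, ?_⟩
  · refine eq_of_forall_isState hE he (hτmem _) (Submodule.add_mem _ (hτmem _) (hτmem _))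
      fun ω hω => ?_
    rw [map_add, hτ _ ω hω, hτ _ ω hω, hτ _ ω hω]
    rfl
  · refine eq_of_forall_isState hE he (hτmem _) (Submodule.smul_mem _ _ (hτmem _)) fun ω hω => ?_
    rw [map_smul, hτ _ ω hω, hτ _ ω hω]
    rfl
  · exact fun h hh => eq_of_forall_isState hE he (hτmem _) humem fun ω hω => (hτ _ ω hω).trans (hh _)
  · exact fun h hh => eq_of_forall_isState hE he (hτmem _) hvmem fun ω hω => (hτ _ ω hω).trans (hh _)
  · exact fun f g h hh => eq_of_forall_isState hE he (hτmem _)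
      ((isOrderIdeal_idealOf _).sup_mem (hτmem _) (hτmem _)) fun ω hω => by
        change ω (τ h) = ω (τ f ⊔ τ g)
        rw [hω.map_sup (hτmem _) (hτmem _), hτ _ ω hω, hτ _ ω hω, hτ _ ω hω, hh]

end Krivine

/-! ### Discretisation of quasi-concave functions -/

/-- Positive quasi-concave functions on the half-line. -/
structure IsQuasiConcave (f : ℝ → ℝ) : Prop where
  mono : Monotone f
  cont : Continuous f
  mul_le : ∀ s t : ℝ, 0 < s → s ≤ t → s * f t ≤ t * f s
  pos : ∀ t : ℝ, 0 < t → 0 < f t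

namespace IsQuasiConcave

variable {f : ℝ → ℝ}

theorem div_mul_le (hf : IsQuasiConcave f) {a r : ℝ} (hr : 0 < r) (har : r ≤ a) :
    f a / a * r ≤ f r := by
  rw [div_mul_eq_mul_div, div_le_iff₀ (hr.trans_le har)]
  linarith [hf.mul_le r a hr har]

theorem min_self_le (hf : IsQuasiConcave f) {a r : ℝ} (hr : 0 < r) :
    min (f a) (f a / a * r) ≤ f r := by
  rcases le_total a r with h | h
  · exact (min_le_left _ _).trans (hf.mono h)
  · exact (min_le_right _ _).trans (hf.div_mul_le hr h)

/-- `c` is the larger of a point where f has doubled and a point where f(r)/r has halved. The two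
changes together force c ≥ 4a. Up to `c`, whichever change came last has not exceeded the factor 2,
so one of the two terms of the minimum is at most 2 f(r). -/
theorem exists_step (hf : IsQuasiConcave f) {a b : ℝ} (ha : 0 < a) (hab : a ≤ b)
    (h1 : 2 * f a ≤ f b) (h2 : 2 * a * f b ≤ b * f a) :
    ∃ c, 4 * a ≤ c ∧ c ≤ b ∧ 2 * f a ≤ f c ∧ 2 * a * f c ≤ c * f a ∧
      ∀ r, a ≤ r → r ≤ c → min (f c) (f a / a * r) ≤ 2 * f r := by
  have hfa := hf.pos a ha
  obtain ⟨c₁, hc₁, e₁⟩ : 2 * f a ∈ f '' Icc a b :=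
    intermediate_value_Icc hab hf.cont.continuousOn ⟨by linarith, h1⟩
  obtain ⟨c₂, hc₂, e₂⟩ : (0 : ℝ) ∈ (fun c => c * f a - 2 * a * f c) '' Icc a b :=
    intermediate_value_Icc hab
      (Continuous.continuousOn (by have := hf.cont; fun_prop)) ⟨by nlinarith, by linarith⟩
  simp only at e₂
  have hd1 : 2 * f a ≤ f (max c₁ c₂) := e₁ ▸ hf.mono (le_max_left _ _)
  have hc0 : 0 < c₂ := ha.trans_le hc₂.1
  have hm0 : 0 < max c₁ c₂ := hc0.trans_le (le_max_right _ _)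
  have hd2 : 2 * a * f (max c₁ c₂) ≤ max c₁ c₂ * f a := by
    have h3 := hf.mul_le c₂ (max c₁ c₂) hc0 (le_max_right _ _)
    have h4 : c₂ * (2 * a * f (max c₁ c₂)) ≤ c₂ * (max c₁ c₂ * f a) := by
      calc c₂ * (2 * a * f (max c₁ c₂)) = 2 * a * (c₂ * f (max c₁ c₂)) := by ring
        _ ≤ 2 * a * (max c₁ c₂ * f c₂) := by gcongr
        _ = max c₁ c₂ * (2 * a * f c₂) := by ring
        _ = max c₁ c₂ * (c₂ * f a) := by rw [show 2 * a * f c₂ = c₂ * f a by linarith]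
        _ = _ := by ring
    exact le_of_mul_le_mul_left h4 hc0
  refine ⟨max c₁ c₂, ?_, max_le hc₁.2 hc₂.2, hd1, hd2, fun r har hrc => ?_⟩
  · have : (4 * a) * f a ≤ max c₁ c₂ * f a := by nlinarith
    exact le_of_mul_le_mul_right this hfa
  · rcases le_total c₁ c₂ with h | h
    · rw [max_eq_right h] at hrc ⊢
      refine (min_le_right _ _).trans ?_
      have h5 := hf.mul_le r c₂ (ha.trans_le har) hrc
      rw [div_mul_eq_mul_div, div_le_iff₀ ha]
      have h6 : c₂ * (f a * r) ≤ c₂ * (2 * f r * a) := by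
        calc c₂ * (f a * r) = r * (c₂ * f a) := by ring
          _ = r * (2 * a * f c₂) := by rw [show 2 * a * f c₂ = c₂ * f a by linarith]
          _ = 2 * a * (r * f c₂) := by ring
          _ ≤ 2 * a * (c₂ * f r) := by gcongr
          _ = _ := by ring
      exact le_of_mul_le_mul_left h6 hc0
    · rw [max_eq_left h] at hrc ⊢
      refine (min_le_left _ _).trans ?_
      rw [e₁]
      have := hf.mono har
      linarith

/-- Nodes are added from the right, and each step costs a factor of at least 4, so n steps suffice.
The term `- 2 * f a` is the slack that lets the induction close: for r beyond the next node c, the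
new summand is at most f(c), while the slack changes from 2 f(c) to 2 f(a) ≤ f(c). To the left of
the nodes the sum is geometric because f(c)/c ≤ f(a)/(2a). -/
theorem exists_nodes (hf : IsQuasiConcave f) (n : ℕ) {a b : ℝ} (ha : 0 < a) (hab : a ≤ b)
    (hn : b ≤ 4 ^ n * a) :
    ∃ (N : ℕ) (t : ℕ → ℝ), t 0 = a ∧ t N = b ∧ (∀ k < N, t k ≤ t (k + 1)) ∧
      (∀ r, a ≤ r → ∑ k ∈ Finset.range N, min (f (t (k + 1))) (f (t k) / t k * r)
        ≤ 6 * f r - 2 * f a) ∧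
      ∀ r, 0 < r → r ≤ a → ∑ k ∈ Finset.range N, min (f (t (k + 1))) (f (t k) / t k * r)
        ≤ 2 * (f a / a * r) := by
  induction n generalizing a with
  | zero =>
    obtain rfl : a = b := le_antisymm hab (by simpa using hn)
    refine ⟨0, fun _ => a, rfl, rfl, by simp, fun r hr => ?_, fun r hr _ => ?_⟩
    · have := hf.mono hr
      have := hf.pos a ha
      simp only [Finset.range_zero, Finset.sum_empty]
      linarith
    · have := hf.pos a ha
      simp only [Finset.range_zero, Finset.sum_empty]
      positivity
  | succ n ih =>
    have hfa := hf.pos a ha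
    by_cases hD : 2 * f a ≤ f b ∧ 2 * a * f b ≤ b * f a
    · obtain ⟨c, h4, hcb, h1, h2, hgood⟩ := hf.exists_step ha hab hD.1 hD.2
      have hc : 0 < c := by linarith
      obtain ⟨N, t, ht0, htN, htm, hge, hle⟩ := ih hc hcb (hn.trans (by
        rw [pow_succ, mul_assoc]
        gcongr))
      refine ⟨N + 1, fun k => Nat.casesOn k a t, rfl, htN, ?_, ?_, ?_⟩
      · intro k hk
        cases k with
        | zero =>
          change a ≤ t 0
          rw [ht0]; linarith
        | succ k => exact htm k (by omega)
      · intro r hr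
        rw [Finset.sum_range_succ']
        change ∑ k ∈ Finset.range N, min (f (t (k + 1))) (f (t k) / t k * r) +
          min (f (t 0)) (f a / a * r) ≤ _
        rw [ht0]
        have hr0 : 0 < r := ha.trans_le hr
        have har := hf.mono hr
        rcases le_total c r with hcr | hrc
        · have := hge r hcr
          have := min_le_left (f c) (f a / a * r)
          linarith
        · have h3 := hle r hr0 hrc
          have h5 := hf.div_mul_le hr0 hrc
          have h6 := hgood r hr hrc
          linarith
      · intro r hr0 hr
        rw [Finset.sum_range_succ']
        change ∑ k ∈ Finset.range N, min (f (t (k + 1))) (f (t k) / t k * r) +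
          min (f (t 0)) (f a / a * r) ≤ _
        rw [ht0]
        have h3 := hle r hr0 (hr.trans (by linarith))
        have h5 := min_le_right (f c) (f a / a * r)
        have h6 : 2 * (f c / c * r) ≤ f a / a * r := by
          rw [div_mul_eq_mul_div, div_mul_eq_mul_div, mul_div_assoc', div_le_div_iff₀ hc ha]
          nlinarith
        linarith
    -- Over [a, b] either f stays below 2 f(a) or f(r)/r stays above half of f(a)/a, so a single gap
    -- is enough.
    · refine ⟨1, fun k => Nat.casesOn k a fun _ => b, rfl, rfl, ?_, ?_, ?_⟩
      · intro k hk
        obtain rfl : k = 0 := by omega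
        exact hab
      · intro r hr
        rw [Finset.sum_range_one]
        change min (f b) (f a / a * r) ≤ _
        have hr0 : 0 < r := ha.trans_le hr
        have har := hf.mono hr
        have key : min (f b) (f a / a * r) ≤ 2 * f r := by
          rcases le_total b r with hbr | hrb
          · have := min_le_left (f b) (f a / a * r)
            have := hf.mono hbr
            have := hf.pos r hr0
            linarith
          · by_cases h1 : 2 * f a ≤ f b
            · have h2 : b * f a < 2 * a * f b := not_le.1 fun h => hD ⟨h1, h⟩
              refine (min_le_right _ _).trans ?_
              have hb : 0 < b := ha.trans_le hab
              have h5 := hf.mul_le r b hr0 hrb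
              rw [div_mul_eq_mul_div, div_le_iff₀ ha]
              have h6 : b * (f a * r) ≤ b * (2 * f r * a) := by
                calc b * (f a * r) = r * (b * f a) := by ring
                  _ ≤ r * (2 * a * f b) := by gcongr
                  _ = 2 * a * (r * f b) := by ring
                  _ ≤ 2 * a * (b * f r) := by gcongr
                  _ = _ := by ring
              exact le_of_mul_le_mul_left h6 hb
            · have := min_le_left (f b) (f a / a * r)
              linarith
        linarith
      · intro r hr0 hr
        rw [Finset.sum_range_one]
        change min (f b) (f a / a * r) ≤ _
        have := min_le_right (f b) (f a / a * r)
        have : 0 ≤ f a / a * r := by positivity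
        linarith

end IsQuasiConcave

/-- Capping at `M` makes the supremum finite, and a point within a factor 2 of it exists. With g =
f(r)/r and g = f this supplies the two end nodes; the cap is harmless because the elements to be
decomposed lie below M s and M t. -/
theorem exists_min_le_two_mul {g : ℝ → ℝ} (hg : ∀ r, 0 < r → 0 < g r) {M : ℝ} (hM : 0 < M) :
    ∃ a, 0 < a ∧ ∀ r, 0 < r → min M (g r) ≤ 2 * g a := by
  set S : Set ℝ := (fun r => min M (g r)) '' Ioi 0 with hS
  have hB : BddAbove S := ⟨M, by rintro _ ⟨r, -, rfl⟩; exact min_le_left _ _⟩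
  have h1 : min M (g 1) ∈ S := ⟨1, mem_Ioi.2 one_pos, rfl⟩
  have hpos : 0 < sSup S := (lt_min hM (hg 1 one_pos)).trans_le (le_csSup hB h1)
  obtain ⟨_, ⟨a, ha, rfl⟩, haS⟩ := exists_lt_of_lt_csSup ⟨_, h1⟩ (half_lt_self hpos)
  refine ⟨a, ha, fun r hr => ?_⟩
  have h2 : min M (g r) ≤ sSup S := le_csSup hB ⟨r, hr, rfl⟩
  have h3 := min_le_right M (g a)
  simp only at haS
  linarith

/-- The truncation of `x` to the region where `A s - B t` is large. -/
def truncation {E : Type*} [AddCommGroup E] [Module ℝ E] [Lattice E] (A B : ℝ) (x s t : E) : E :=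
  x ⊓ ((A • s - B • t) ⊔ 0)

/-! ### Weights and truncations that discretise φ -/

namespace ClassP

theorem toFun_eq_zero_or_pos (φ : ClassP) :
    (∀ s t : ℝ, 0 < s → 0 < t → φ.toFun s t = 0) ∨ 0 < φ.toFun 1 1 := by
  rcases (φ.nonneg 1 1 one_pos one_pos).eq_or_lt with h | h
  · left
    intro s t hs ht
    have hm : 0 < max s t := hs.trans_le (le_max_left _ _)
    have h1 : φ.toFun s t ≤ φ.toFun (max s t) t :=
      φ.mono_left t ht hs hm (le_max_left _ _)
    have h2 : φ.toFun (max s t) t ≤ φ.toFun (max s t) (max s t) :=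
      φ.mono_right _ hm ht hm (le_max_right _ _)
    have h3 := φ.homogeneous (max s t) 1 1 hm one_pos one_pos
    rw [← h, mul_one, mul_zero] at h3
    exact le_antisymm (h3 ▸ h1.trans h2) (φ.nonneg s t hs ht)
  · exact Or.inr h

theorem isQuasiConcave_ext₁ (φ : ClassP) (h : 0 < φ.toFun 1 1) : IsQuasiConcave φ.ext₁ where
  mono := φ.monotone_ext₁
  cont := φ.continuous_ext₁
  mul_le _ _ hs hst := φ.mul_ext₁_le hs hst
  pos t ht := by
    have e1 : φ.ext₁ 1 = φ.toFun 1 1 := by simp [ext₁]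
    rcases le_total 1 t with h1 | h1
    · have := φ.monotone_ext₁ h1
      linarith
    · have := φ.mul_ext₁_le ht h1
      have h2 : 0 < t * φ.ext₁ 1 := mul_pos ht (e1 ▸ h)
      linarith

/-- The data that discretise `φ` down to the level `1 / M`. -/
structure Discretization (φ : ClassP) (M : ℝ) where
  N : ℕ
  A : ℕ → ℝ
  B : ℕ → ℝ
  p : ℕ → ℝ
  q : ℕ → ℝ
  p_pos : ∀ k, 0 < p k
  q_pos : ∀ k, 0 < q k
  truncation_zero : ∀ x s t : ℝ, 0 ≤ x → truncation (A 0) (B 0) x s t = 0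
  truncation_N : ∀ x s t : ℝ, x ≤ M * s → truncation (A N) (B N) x s t = x
  truncation_mono : ∀ x s t : ℝ, 0 ≤ s → 0 ≤ t → x ≤ M * s → ∀ k < N,
    truncation (A k) (B k) x s t ≤ truncation (A (k + 1)) (B (k + 1)) x s t
  sum_p_le : ∀ x s t : ℝ, 0 ≤ s → 0 ≤ t → 0 ≤ x → x ≤ φ.hatFun (s, t) → x ≤ M * s → x ≤ M * t →
    ∑ k ∈ Finset.range N,
      p k * (truncation (A (k + 1)) (B (k + 1)) x s t - truncation (A k) (B k) x s t) ≤ 2 * s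
  sum_q_le : ∀ x s t : ℝ, 0 ≤ s → 0 ≤ t → 0 ≤ x → x ≤ φ.hatFun (s, t) → x ≤ M * s → x ≤ M * t →
    ∑ k ∈ Finset.range N,
      q k * (truncation (A (k + 1)) (B (k + 1)) x s t - truncation (A k) (B k) x s t) ≤ 2 * t
  sum_le : ∀ (s t : ℝ) (v : ℕ → ℝ), 0 ≤ s → 0 ≤ t → (∀ k < N, p k * v k ≤ s) →
    (∀ k < N, q k * v k ≤ t) → ∑ k ∈ Finset.range N, v k ≤ 8 * φ.hatFun (s, t)

/-- The increments of `w` are nonnegative with total `x`, so the sum is `x` times an average of the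
`p k` over the strictly positive increments. -/
theorem sum_mul_le_of_active {N : ℕ} {w p : ℕ → ℝ} {x c : ℝ} (hx : 0 < x) (h0 : w 0 = 0)
    (hN : w N = x) (hw : ∀ k < N, w k ≤ w (k + 1))
    (h : ∀ k < N, w k < w (k + 1) → p k * x ≤ c) :
    ∑ k ∈ Finset.range N, p k * (w (k + 1) - w k) ≤ c := by
  have h1 : ∑ k ∈ Finset.range N, p k * (w (k + 1) - w k) * x ≤
      ∑ k ∈ Finset.range N, c * (w (k + 1) - w k) := by
    refine Finset.sum_le_sum fun k hk => ?_
    have hk := Finset.mem_range.1 hk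
    rcases (hw k hk).eq_or_lt with he | hlt
    · rw [he]; simp
    · have := mul_le_mul_of_nonneg_right (h k hk hlt) (sub_nonneg.2 hlt.le)
      linarith
  rw [← Finset.sum_mul, ← Finset.mul_sum, Finset.sum_range_sub, hN, h0, sub_zero] at h1
  exact le_of_mul_le_mul_right h1 hx

/-- With f = φ(1, ·) and nodes t_0 ≤ … ≤ t_N, the k-th increment (1 ≤ k ≤ N) is active only if t/s
lies between t_{k-1}/2 and t_k. There x ≤ s f(t/s) gives x ≤ s f(t_k) and t_{k-1} x ≤ 2 t
f(t_{k-1}), which dictates p_k = 1/f(t_k) and q_k = t_{k-1}/f(t_{k-1}). The first and last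
increments lack one of the two constraints; the choice of the end nodes replaces it. -/
theorem exists_discretization (φ : ClassP) (h : 0 < φ.toFun 1 1) {M : ℝ} (hM : 0 < M) :
    Nonempty (Discretization φ M) := by
  have hf := φ.isQuasiConcave_ext₁ h
  set f := φ.ext₁ with hfdef
  obtain ⟨a₀, ha₀, hleft₀⟩ := exists_min_le_two_mul (g := fun r => f r / r)
    (fun r hr => div_pos (hf.pos r hr) hr) hM
  obtain ⟨b, hb, hright⟩ := exists_min_le_two_mul (g := f) (fun r hr => hf.pos r hr) hM
  -- Lowering a only increases f(a)/a, so the left end estimate survives while a ≤ b is secured.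
  set a := min a₀ b with ha
  have hapos : 0 < a := lt_min ha₀ hb
  have hab : a ≤ b := min_le_right _ _
  have hleft : ∀ r, 0 < r → min M (f r / r) ≤ 2 * (f a / a) := by
    intro r hr
    have h1 : f a₀ / a₀ ≤ f a / a := by
      rw [div_le_div_iff₀ ha₀ hapos]
      linarith [hf.mul_le a a₀ hapos (min_le_left _ _)]
    linarith [hleft₀ r hr]
  obtain ⟨n, hn⟩ := pow_unbounded_of_one_lt (b / a) (by norm_num : (1 : ℝ) < 4)
  obtain ⟨N, t, ht0, htN, htm, hge, hle⟩ := hf.exists_nodes n hapos hab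
    ((div_le_iff₀ hapos).1 hn.le)
  have hta : ∀ k ≤ N, a ≤ t k := by
    intro k hk
    induction k with
    | zero => rw [ht0]
    | succ k ih => exact (ih (by omega)).trans (htm k (by omega))
  have htmin : ∀ k, 0 < t (min k N) := fun k => hapos.trans_le (hta _ (min_le_right _ _))
  have hsum : ∀ r, 0 < r →
      ∑ k ∈ Finset.range N, min (f (t (k + 1))) (f (t k) / t k * r) ≤ 6 * f r := by
    intro r hr
    rcases le_total a r with har | hra
    · linarith [hge r har, hf.pos a hapos]
    · linarith [hle r hr hra, hf.div_mul_le hr hra, hf.pos r hr]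
  -- Steep enough for the truncation at t_k to return all of x once t_k s ≥ 2t: then m (t_k s - t) ≥
  -- m a s / 2 = M s ≥ x.
  set m := 2 * M / a with hm
  have hmpos : 0 < m := by positivity
  -- Index 0 truncates to 0, index k + 1 belongs to the node t_k, and index N + 2 returns x itself.
  -- The N + 1 nodes thus give N + 2 increments.
  set A : ℕ → ℝ := fun k => if k = 0 then 0 else if N + 1 < k then M else m * t (k - 1) with hA
  set B : ℕ → ℝ := fun k => if k = 0 then 0 else if N + 1 < k then 0 else m with hB
  have hA0 : A 0 = 0 := by simp [hA]
  have hB0 : B 0 = 0 := by simp [hB]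
  have hAN : A (N + 2) = M := by simp [hA]
  have hBN : B (N + 2) = 0 := by simp [hB]
  have hAk : ∀ k ≤ N, A (k + 1) = m * t k := fun k hk => by
    simp [hA, show ¬ (N < k) by omega]
  have hBk : ∀ k ≤ N, B (k + 1) = m := fun k hk => by
    simp [hB, show ¬ (N < k) by omega]
  have htr0 : ∀ x s t : ℝ, 0 ≤ x → truncation (A 0) (B 0) x s t = 0 := fun x s t hx => by
    simp [truncation, hA0, hB0, hx]
  have htrN : ∀ x s t : ℝ, x ≤ M * s → truncation (A (N + 2)) (B (N + 2)) x s t = x :=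
    fun x s t hx => by
      simp [truncation, hAN, hBN, hx]
  have htrk : ∀ x s u : ℝ, ∀ k ≤ N,
      truncation (A (k + 1)) (B (k + 1)) x s u = min x (max (m * (t k * s - u)) 0) :=
    fun x s u k hk => by
      simp only [truncation, hAk k hk, hBk k hk, smul_eq_mul]
      congr 2
      ring
  have htrmono : ∀ x s u : ℝ, 0 ≤ s → 0 ≤ u → x ≤ M * s → ∀ k < N + 2,
      truncation (A k) (B k) x s u ≤ truncation (A (k + 1)) (B (k + 1)) x s u := by
    intro x s u hs hu hx k hk
    rcases Nat.lt_or_ge k (N + 1) with hk1 | hk1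
    · cases k with
      | zero =>
        rw [htrk x s u 0 (by omega)]
        simp only [truncation, hA0, hB0, zero_smul, sub_zero, sup_idem]
        exact min_le_min_left _ (le_max_right _ _)
      | succ k =>
        rw [htrk x s u k (by omega), htrk x s u (k + 1) (by omega)]
        have := htm k (by omega)
        gcongr
    · obtain rfl : k = N + 1 := by omega
      rw [show N + 1 + 1 = N + 2 from rfl, htrN x s u hx]
      exact inf_le_left
  have hpos_lt : ∀ x s u : ℝ, 0 < x → ∀ k ≤ N,
      0 < truncation (A (k + 1)) (B (k + 1)) x s u → u < t k * s := by
    intro x s u hx k hk hlt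
    rw [htrk x s u k hk] at hlt
    by_contra hcon
    have h1 : m * (t k * s - u) ≤ 0 :=
      mul_nonpos_of_nonneg_of_nonpos hmpos.le (by linarith)
    rw [max_eq_right h1] at hlt
    exact absurd (hlt.trans_le (min_le_right _ _)) (lt_irrefl _)
  have hlt_pos : ∀ x s u : ℝ, 0 ≤ s → x ≤ M * s → ∀ k ≤ N,
      truncation (A (k + 1)) (B (k + 1)) x s u < x → t k * s < 2 * u := by
    intro x s u hs hx k hk hlt
    rw [htrk x s u k hk] at hlt
    by_contra hcon
    push Not at hcon
    have h1 : x ≤ m * (t k * s - u) := by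
      have h2 : a * s ≤ t k * s := mul_le_mul_of_nonneg_right (hta k hk) hs
      calc x ≤ M * s := hx
        _ = m * (a * s / 2) := by rw [hm]; field_simp
        _ ≤ _ := by gcongr; linarith
    rw [min_eq_left (h1.trans (le_max_left _ _))] at hlt
    exact lt_irrefl _ hlt
  have hhat : ∀ s u : ℝ, 0 < s → φ.hatFun (s, u) = s * f (u / s) := fun s u hs =>
    φ.hatFun_of_fst_pos (p := (s, u)) hs
  have hzero : ∀ (c : ℕ → ℝ) (s u : ℝ), ∑ k ∈ Finset.range (N + 2), c k *
      (truncation (A (k + 1)) (B (k + 1)) 0 s u - truncation (A k) (B k) 0 s u) = 0 := by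
    intro c s u
    refine Finset.sum_eq_zero fun k _ => ?_
    simp [truncation]
  refine ⟨{
    N := N + 2, A := A, B := B
    -- The clamp at N and the truncated subtraction k - 1 make the two extreme increments reuse the
    -- end nodes.
    p := fun k => 1 / f (t (min k N))
    q := fun k => t (min (k - 1) N) / f (t (min (k - 1) N))
    p_pos := fun k => one_div_pos.2 (hf.pos _ (htmin k))
    q_pos := fun k => div_pos (htmin _) (hf.pos _ (htmin _))
    truncation_zero := htr0, truncation_N := htrN, truncation_mono := htrmono
    sum_p_le := ?_, sum_q_le := ?_, sum_le := ?_ }⟩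
  · intro x s u hs hu hx hxφ hxs hxu
    rcases hx.eq_or_lt with rfl | hx
    · rw [hzero]; linarith
    have hs0 : 0 < s := by
      by_contra hcon
      rw [show s = 0 by linarith] at hxs
      linarith
    rw [hhat s u hs0] at hxφ
    refine sum_mul_le_of_active (w := fun k => truncation (A k) (B k) x s u) hx
      (htr0 x s u hx.le) (htrN x s u hxs) (htrmono x s u hs hu hxs) fun k hk hlt => ?_
    rw [one_div, inv_mul_le_iff₀ (hf.pos _ (htmin k))]
    rcases Nat.lt_or_ge k (N + 1) with hk1 | hk1
    · have h0 : 0 ≤ truncation (A k) (B k) x s u := le_inf hx.le le_sup_right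
      have h1 := hpos_lt x s u hx k (by omega) (h0.trans_lt hlt)
      rw [min_eq_left (by omega)]
      have h2 : f (u / s) ≤ f (t k) := hf.mono ((div_le_iff₀ hs0).2 h1.le)
      have h3 : s * f (u / s) ≤ s * f (t k) := by gcongr
      have h4 : 0 < s * f (t k) := mul_pos hs0 (hf.pos _ (hapos.trans_le (hta k (by omega))))
      linarith
    · rw [min_eq_right (by omega), htN]
      have hu0 : 0 < u := by
        by_contra hcon
        rw [show u = 0 by linarith] at hxu
        linarith
      have h1 := hright (u / s) (div_pos hu0 hs0)
      have h2 : x ≤ s * min M (f (u / s)) := by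
        rw [mul_min_of_nonneg _ _ hs]
        exact le_min (by linarith) hxφ
      have h3 : s * min M (f (u / s)) ≤ s * (2 * f b) := by gcongr
      linarith
  · intro x s u hs hu hx hxφ hxs hxu
    rcases hx.eq_or_lt with rfl | hx
    · rw [hzero]; linarith
    have hs0 : 0 < s := by
      by_contra hcon
      rw [show s = 0 by linarith] at hxs
      linarith
    have hu0 : 0 < u := by
      by_contra hcon
      rw [show u = 0 by linarith] at hxu
      linarith
    rw [hhat s u hs0] at hxφ
    refine sum_mul_le_of_active (w := fun k => truncation (A k) (B k) x s u) hx
      (htr0 x s u hx.le) (htrN x s u hxs) (htrmono x s u hs hu hxs) fun k hk hlt => ?_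
    rw [div_mul_eq_mul_div, div_le_iff₀ (hf.pos _ (htmin _))]
    cases k with
    | zero =>
      simp only [Nat.zero_sub, Nat.zero_min, ht0]
      have h1 := hleft (u / s) (div_pos hu0 hs0)
      have h2 : x ≤ u * min M (f (u / s) / (u / s)) := by
        rw [mul_min_of_nonneg _ _ hu]
        refine le_min (by linarith) (hxφ.trans_eq ?_)
        field_simp
      have h3 : u * min M (f (u / s) / (u / s)) ≤ u * (2 * (f a / a)) := by gcongr
      calc a * x ≤ a * (u * (2 * (f a / a))) := by gcongr; exact h2.trans h3
        _ = _ := by field_simp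
    | succ k =>
      rw [Nat.add_sub_cancel, min_eq_left (show k ≤ N by omega)]
      have hlt' : truncation (A (k + 1)) (B (k + 1)) x s u < x := hlt.trans_le inf_le_left
      have h1 := hlt_pos x s u hs hxs k (by omega) hlt'
      set c := t k with hc
      have hc0 : 0 < c := hapos.trans_le (hta k (by omega))
      have h2 : c / 2 ≤ u / s := by
        rw [le_div_iff₀ hs0]; linarith
      have h3 := hf.mul_le (c / 2) (u / s) (by positivity) h2
      have h4 : f (c / 2) ≤ f c := hf.mono (by linarith)
      calc c * x ≤ c * (s * f (u / s)) := by gcongr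
        _ = 2 * s * (c / 2 * f (u / s)) := by ring
        _ ≤ 2 * s * (u / s * f (c / 2)) := by gcongr
        _ = 2 * u * f (c / 2) := by field_simp
        _ ≤ 2 * u * f c := by gcongr
  · intro y₀ y₁ v hy₀ hy₁ hp hq
    have hp' : ∀ k < N + 2, v k ≤ y₀ * f (t (min k N)) := fun k hk => by
      have := hp k hk
      rwa [one_div, inv_mul_le_iff₀ (hf.pos _ (htmin k)), mul_comm] at this
    have hq' : ∀ k < N + 2, v k ≤ y₁ * (f (t (min (k - 1) N)) / t (min (k - 1) N)) := fun k hk => by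
      have := hq k hk
      rw [div_mul_eq_mul_div, div_le_iff₀ (hf.pos _ (htmin _))] at this
      rw [mul_div_assoc', le_div_iff₀ (htmin _)]
      linarith
    have hneg : (∀ k < N + 2, v k ≤ 0) →
        ∑ k ∈ Finset.range (N + 2), v k ≤ 8 * φ.hatFun (y₀, y₁) := fun hv => by
      have h1 := Finset.sum_nonpos fun k hk => hv k (Finset.mem_range.1 hk)
      have h2 := φ.hatFun_nonneg (y₀, y₁)
      linarith
    rcases hy₀.eq_or_lt with rfl | hy₀
    · exact hneg fun k hk => by simpa using hp' k hk
    rcases hy₁.eq_or_lt with rfl | hy₁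
    · exact hneg fun k hk => by simpa using hq' k hk
    rw [hhat y₀ y₁ hy₀]
    set r := y₁ / y₀ with hr
    have hr0 : 0 < r := div_pos hy₁ hy₀
    have hv : ∀ k < N + 2, v k ≤ y₀ * min (f (t (min k N)))
        (f (t (min (k - 1) N)) / t (min (k - 1) N) * r) := fun k hk => by
      rw [mul_min_of_nonneg _ _ hy₀.le]
      refine le_min (hp' k hk) ((hq' k hk).trans_eq ?_)
      rw [hr]
      field_simp
    have h1 : ∑ k ∈ Finset.range (N + 2), v k ≤ y₀ * ∑ k ∈ Finset.range (N + 2),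
        min (f (t (min k N))) (f (t (min (k - 1) N)) / t (min (k - 1) N) * r) := by
      rw [Finset.mul_sum]
      exact Finset.sum_le_sum fun k hk => hv k (Finset.mem_range.1 hk)
    have h2 : ∑ k ∈ Finset.range (N + 2),
        min (f (t (min k N))) (f (t (min (k - 1) N)) / t (min (k - 1) N) * r) ≤ 8 * f r := by
      -- The constant is 8 = 6 + 1 + 1: the inner gaps, and one summand for each end node.
      rw [Finset.sum_range_succ', Finset.sum_range_succ]
      have e1 : ∑ k ∈ Finset.range N, min (f (t (min (k + 1) N)))
          (f (t (min (k + 1 - 1) N)) / t (min (k + 1 - 1) N) * r) =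
          ∑ k ∈ Finset.range N, min (f (t (k + 1))) (f (t k) / t k * r) := by
        refine Finset.sum_congr rfl fun k hk => ?_
        have hk := Finset.mem_range.1 hk
        rw [Nat.add_sub_cancel, min_eq_left (show k + 1 ≤ N by omega),
          min_eq_left (show k ≤ N by omega)]
      rw [e1, Nat.add_sub_cancel, min_eq_right (show N ≤ N + 1 by omega), min_self N, Nat.zero_min]
      have := hsum r hr0
      have := hf.min_self_le (a := t N) hr0
      have := hf.min_self_le (a := t 0) hr0
      linarith
    have h3 : y₀ * ∑ k ∈ Finset.range (N + 2),
        min (f (t (min k N))) (f (t (min (k - 1) N)) / t (min (k - 1) N) * r) ≤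
        y₀ * (8 * f r) := by gcongr
    linarith

end ClassP

/-! ### Krivine values at states, and the discretisation in vector lattices -/

section KrivineValue

variable {E : Type*} [AddCommGroup E] [Module ℝ E] [Lattice E] [IsOrderedAddMonoid E]
  [IsOrderedModule ℝ E]

theorem left_mem_idealOf_add {u v : E} (hu : 0 ≤ u) (hv : 0 ≤ v) : u ∈ idealOf (u + v) :=
  (isOrderIdeal_idealOf _).mem_of_nonneg_of_le (self_mem_idealOf (add_nonneg hu hv)) hu
    (le_add_of_nonneg_right hv)

theorem right_mem_idealOf_add {u v : E} (hu : 0 ≤ u) (hv : 0 ≤ v) : v ∈ idealOf (u + v) :=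
  (isOrderIdeal_idealOf _).mem_of_nonneg_of_le (self_mem_idealOf (add_nonneg hu hv)) hv
    (le_add_of_nonneg_left hu)

theorem IsKrivineValue.mem_idealOf {h : HomFun} {u v y : E} (hy : IsKrivineValue h u v y)
    (hu : 0 ≤ u) (hv : 0 ≤ v) : y ∈ idealOf (u + v) := by
  obtain ⟨τ, hτ, rfl⟩ := hy
  exact hτ.mem_idealOf hu hv h

theorem IsKrivineValue.state_apply {h : HomFun} {u v y : E} (hy : IsKrivineValue h u v y)
    (hu : 0 ≤ u) (hv : 0 ≤ v) {ω : E →ₗ[ℝ] ℝ} (hω : IsState (u + v) ω) :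
    ω y = h.1 (ω u, ω v) := by
  obtain ⟨τ, hτ, rfl⟩ := hy
  exact hτ.state_apply hu hv hω h

theorem IsKrivineValue.smul {h : HomFun} {u v y : E} (hy : IsKrivineValue h u v y) {c : ℝ}
    (hc : 0 ≤ c) : IsKrivineValue h (c • u) (c • v) (c • y) := by
  obtain ⟨τ, hτ, rfl⟩ := hy
  refine ⟨c • τ, ⟨fun f hf => ?_, fun f hf => ?_, fun f g k hk => ?_⟩, rfl⟩
  · rw [LinearMap.smul_apply, hτ.map_fst f hf]
  · rw [LinearMap.smul_apply, hτ.map_snd f hf]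
  · rw [LinearMap.smul_apply, LinearMap.smul_apply, LinearMap.smul_apply, hτ.map_sup f g k hk,
      smul_sup_of_nonneg hc]

theorem IsKrivineValue.nonneg (φ : ClassP) {u v y : E} (hy : IsKrivineValue φ.hat u v y) :
    0 ≤ y := by
  obtain ⟨τ, hτ, rfl⟩ := hy
  have := hτ.mono (f := 0) (g := φ.hat) fun p => φ.hatFun_nonneg p
  rwa [map_zero] at this

theorem IsKrivineValue.eq_zero {φ : ClassP} (h0 : ∀ s t : ℝ, 0 < s → 0 < t → φ.toFun s t = 0)
    {u v y : E} (hy : IsKrivineValue φ.hat u v y) : y = 0 := by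
  obtain ⟨τ, hτ, rfl⟩ := hy
  have hle : ∀ p, φ.hat.1 p ≤ (0 : HomFun).1 p := by
    intro p
    refine (φ.hatFun_le p).trans ?_
    rw [h0 1 1 one_pos one_pos, mul_zero]
    exact le_rfl
  have := hτ.mono hle
  rw [map_zero] at this
  exact le_antisymm this (IsKrivineValue.nonneg φ ⟨τ, hτ, rfl⟩)

theorem ClassP.hatFun_mono (φ : ClassP) {s t s' t' : ℝ} (hs : s ≤ s') (ht : t ≤ t') :
    φ.hatFun (s, t) ≤ φ.hatFun (s', t') := by
  have key : ∀ (ψ : ClassP) {a b b' : ℝ}, b ≤ b' → ψ.hatFun (a, b) ≤ ψ.hatFun (a, b') := by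
    intro ψ a b b' hb
    by_cases ha : 0 < a
    · rw [ψ.hatFun_of_fst_pos (p := (a, b)) ha, ψ.hatFun_of_fst_pos (p := (a, b')) ha]
      have : ψ.ext₁ (b / a) ≤ ψ.ext₁ (b' / a) := ψ.monotone_ext₁ (by gcongr)
      exact mul_le_mul_of_nonneg_left this ha.le
    · have hr : 0 ≤ ψ.rightLim₀ := Real.sInf_nonneg
        (by rintro _ ⟨t, ht, rfl⟩; exact ψ.nonneg t 1 ht one_pos)
      simp only [ClassP.hatFun, ha, if_false]
      split_ifs with h1 h2 h2
      · exact mul_le_mul_of_nonneg_right hb hr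
      · linarith
      · exact mul_nonneg h2.le hr
      · exact le_rfl
  refine (key φ ht).trans ?_
  rw [← φ.hatFun_swap, ← φ.hatFun_swap (s', t')]
  exact key φ.swap hs

/-- Krivine values of functions in `𝒫` are monotone in the arguments. -/
theorem IsKrivineValue.mono (hE : IsArchimedeanLattice E) {φ : ClassP} {u v u' v' y y' : E}
    (hu : 0 ≤ u) (hv : 0 ≤ v) (hy : IsKrivineValue φ.hat u v y)
    (hy' : IsKrivineValue φ.hat u' v' y') (huu : u ≤ u') (hvv : v ≤ v') : y ≤ y' := by
  have hu' := hu.trans huu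
  have hv' := hv.trans hvv
  have hum := left_mem_idealOf_add hu' hv'
  have hvm := right_mem_idealOf_add hu' hv'
  have hum0 := (isOrderIdeal_idealOf (u' + v')).mem_of_nonneg_of_le hum hu huu
  have hvm0 := (isOrderIdeal_idealOf (u' + v')).mem_of_nonneg_of_le hvm hv hvv
  obtain ⟨τ, hτ, rfl⟩ := hy
  by_contra hcon
  have hym : τ φ.hat ∈ idealOf (u' + v') := by
    obtain ⟨c, hc⟩ := hτ.mem_idealOf hu hv φ.hat
    refine ⟨max c 0, hc.trans ?_⟩
    calc c • (u + v) ≤ max c 0 • (u + v) :=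
          smul_le_smul_of_nonneg_right (le_max_left _ _) (add_nonneg hu hv)
      _ ≤ _ := smul_le_smul_of_nonneg_left (add_le_add huu hvv) (le_max_right _ _)
  refine hcon (le_of_forall_isState hE (add_nonneg hu' hv') hym (hy'.mem_idealOf hu' hv')
    fun ω hω => ?_)
  rw [hy'.state_apply hu' hv' hω]
  -- normalise `ω` at `u + v`
  have hω0 : 0 ≤ ω (u + v) := hω.map_nonneg (Submodule.add_mem _ hum0 hvm0) (add_nonneg hu hv)
  have hmono : φ.hatFun (ω u, ω v) ≤ φ.hatFun (ω u', ω v') :=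
    φ.hatFun_mono (hω.mono hum0 hum huu) (hω.mono hvm0 hvm hvv)
  have hsub : ∀ x ∈ idealOf (u + v), x ∈ idealOf (u' + v') := fun x ⟨c, hc⟩ =>
    (isOrderIdeal_idealOf _).mem_of_abs_le
      (Submodule.smul_mem _ c (Submodule.add_mem _ hum0 hvm0)) hc
  refine le_trans ?_ hmono
  -- A state normalised at `u' + v'` may vanish at `u + v`; it is then ≤ 0 on the smaller value,
  -- which lies below a multiple of `u + v`.
  rcases hω0.eq_or_lt with h0 | hpos
  · obtain ⟨c, hc⟩ := hτ.mem_idealOf hu hv φ.hat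
    have h1 := hω.mono hym (Submodule.smul_mem _ c (Submodule.add_mem _ hum0 hvm0))
      ((le_abs_self _).trans hc)
    rw [map_smul, ← h0, smul_zero] at h1
    exact h1.trans (φ.hatFun_nonneg _)
  · have hω' : IsState (u + v) ((ω (u + v))⁻¹ • ω) := by
      refine ⟨fun x hx => ?_, ?_⟩
      · rw [LinearMap.smul_apply, LinearMap.smul_apply, hω.map_abs x (hsub x hx), smul_eq_mul,
          smul_eq_mul, abs_mul, abs_of_pos (inv_pos.2 hpos)]
      · rw [LinearMap.smul_apply, smul_eq_mul, inv_mul_cancel₀ hpos.ne']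
    have h1 := hτ.state_apply hu hv hω' φ.hat
    have h2 := φ.hatFun_smul (ω (u + v))⁻¹ (inv_nonneg.2 hω0) (ω u, ω v)
    change (ω (u + v))⁻¹ * ω (τ φ.hat) = φ.hatFun ((ω (u + v))⁻¹ • (ω u, ω v)) at h1
    rw [h2] at h1
    exact (mul_left_cancel₀ (inv_ne_zero hpos.ne') h1).le

theorem IsKrivineValue.le_smul_add (hE : IsArchimedeanLattice E) {φ : ClassP} {u v y : E}
    (hu : 0 ≤ u) (hv : 0 ≤ v) (hy : IsKrivineValue φ.hat u v y) :
    y ≤ φ.toFun 1 1 • (u + v) := by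
  have he := add_nonneg hu hv
  refine le_of_forall_isState hE he (hy.mem_idealOf hu hv)
    (Submodule.smul_mem _ _ (self_mem_idealOf he)) fun ω hω => ?_
  rw [hy.state_apply hu hv hω, map_smul, map_add, smul_eq_mul, mul_comm]
  have h1 := hω.map_nonneg (left_mem_idealOf_add hu hv) hu
  have h2 := hω.map_nonneg (right_mem_idealOf_add hu hv) hv
  refine (φ.hatFun_le _).trans (mul_le_mul_of_nonneg_right ?_ (φ.nonneg 1 1 one_pos one_pos))
  exact sup_le (sup_le (by simpa using h2) (by simpa using h1)) (add_nonneg h1 h2)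

namespace ClassP.Discretization

variable {φ : ClassP} {M : ℝ}

/-- The pieces are increments of lattice truncations. States commute with truncation, so every claim
is the corresponding scalar field of `D`, tested at each state of `s + t`. -/
theorem exists_decomposition (D : Discretization φ M) (hE : IsArchimedeanLattice E)
    {s t x y : E} (hs : 0 ≤ s) (ht : 0 ≤ t) (hx : 0 ≤ x) (hy : IsKrivineValue φ.hat s t y)
    (hxy : x ≤ y) (hxs : x ≤ M • s) (hxt : x ≤ M • t) :
    ∃ v : ℕ → E, (∀ k < D.N, 0 ≤ v k) ∧ ∑ k ∈ Finset.range D.N, v k = x ∧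
      ∑ k ∈ Finset.range D.N, D.p k • v k ≤ (2 : ℝ) • s ∧
      ∑ k ∈ Finset.range D.N, D.q k • v k ≤ (2 : ℝ) • t := by
  have he := add_nonneg hs ht
  have hsm := left_mem_idealOf_add hs ht
  have htm := right_mem_idealOf_add hs ht
  have hxm := (isOrderIdeal_idealOf (s + t)).mem_of_nonneg_of_le (hy.mem_idealOf hs ht) hx hxy
  have hzm : ∀ A B : ℝ, A • s - B • t ∈ idealOf (s + t) := fun A B =>
    Submodule.sub_mem _ (Submodule.smul_mem _ _ hsm) (Submodule.smul_mem _ _ htm)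
  have hzm' : ∀ A B : ℝ, (A • s - B • t) ⊔ 0 ∈ idealOf (s + t) := fun A B =>
    (isOrderIdeal_idealOf _).sup_mem (hzm A B) (Submodule.zero_mem _)
  have hWm : ∀ A B : ℝ, truncation A B x s t ∈ idealOf (s + t) := fun A B =>
    (isOrderIdeal_idealOf _).inf_mem hxm (hzm' A B)
  have hW : ∀ ω : E →ₗ[ℝ] ℝ, IsState (s + t) ω → ∀ A B : ℝ,
      ω (truncation A B x s t) = truncation A B (ω x) (ω s) (ω t) := by
    intro ω hω A B
    rw [truncation, hω.map_inf hxm (hzm' A B), hω.map_sup (hzm A B) (Submodule.zero_mem _),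
      map_sub, map_smul, map_smul, map_zero, truncation]
  have hωs : ∀ ω : E →ₗ[ℝ] ℝ, IsState (s + t) ω → 0 ≤ ω s := fun ω hω => hω.map_nonneg hsm hs
  have hωt : ∀ ω : E →ₗ[ℝ] ℝ, IsState (s + t) ω → 0 ≤ ω t := fun ω hω => hω.map_nonneg htm ht
  have hωx : ∀ ω : E →ₗ[ℝ] ℝ, IsState (s + t) ω → 0 ≤ ω x := fun ω hω => hω.map_nonneg hxm hx
  have hωxs : ∀ ω : E →ₗ[ℝ] ℝ, IsState (s + t) ω → ω x ≤ M * ω s := fun ω hω => by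
    have := hω.mono hxm (Submodule.smul_mem _ M hsm) hxs
    rwa [map_smul, smul_eq_mul] at this
  have hωxt : ∀ ω : E →ₗ[ℝ] ℝ, IsState (s + t) ω → ω x ≤ M * ω t := fun ω hω => by
    have := hω.mono hxm (Submodule.smul_mem _ M htm) hxt
    rwa [map_smul, smul_eq_mul] at this
  have hωφ : ∀ ω : E →ₗ[ℝ] ℝ, IsState (s + t) ω → ω x ≤ φ.hatFun (ω s, ω t) := fun ω hω => by
    have := hω.mono hxm (hy.mem_idealOf hs ht) hxy
    rwa [hy.state_apply hs ht hω] at this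
  refine ⟨fun k => truncation (D.A (k + 1)) (D.B (k + 1)) x s t - truncation (D.A k) (D.B k) x s t,
    fun k hk => ?_, ?_, ?_, ?_⟩
  · refine sub_nonneg.2 (le_of_forall_isState hE he (hWm _ _) (hWm _ _) fun ω hω => ?_)
    rw [hW ω hω, hW ω hω]
    exact D.truncation_mono _ _ _ (hωs ω hω) (hωt ω hω) (hωxs ω hω) k hk
  · rw [Finset.sum_range_sub (fun k => truncation (D.A k) (D.B k) x s t)]
    refine eq_of_forall_isState hE he (Submodule.sub_mem _ (hWm _ _) (hWm _ _)) hxm fun ω hω => ?_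
    rw [map_sub, hW ω hω, hW ω hω, D.truncation_N _ _ _ (hωxs ω hω),
      D.truncation_zero _ _ _ (hωx ω hω), sub_zero]
  · refine le_of_forall_isState hE he (Submodule.sum_mem _ fun k _ => Submodule.smul_mem _ _
      (Submodule.sub_mem _ (hWm _ _) (hWm _ _))) (Submodule.smul_mem _ _ hsm) fun ω hω => ?_
    simp only [map_sum, map_smul, map_sub, hW ω hω, smul_eq_mul]
    exact D.sum_p_le _ _ _ (hωs ω hω) (hωt ω hω) (hωx ω hω) (hωφ ω hω) (hωxs ω hω) (hωxt ω hω)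
  · refine le_of_forall_isState hE he (Submodule.sum_mem _ fun k _ => Submodule.smul_mem _ _
      (Submodule.sub_mem _ (hWm _ _) (hWm _ _))) (Submodule.smul_mem _ _ htm) fun ω hω => ?_
    simp only [map_sum, map_smul, map_sub, hW ω hω, smul_eq_mul]
    exact D.sum_q_le _ _ _ (hωs ω hω) (hωt ω hω) (hωx ω hω) (hωφ ω hω) (hωxs ω hω) (hωxt ω hω)

theorem sum_le_krivineValue (D : Discretization φ M) (hE : IsArchimedeanLattice E)
    {s t y : E} (hs : 0 ≤ s) (ht : 0 ≤ t) (hy : IsKrivineValue φ.hat s t y) {v : ℕ → E}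
    (hv : ∀ k < D.N, 0 ≤ v k) (hvs : ∀ k < D.N, D.p k • v k ≤ s)
    (hvt : ∀ k < D.N, D.q k • v k ≤ t) : ∑ k ∈ Finset.range D.N, v k ≤ (8 : ℝ) • y := by
  have he := add_nonneg hs ht
  have hsm := left_mem_idealOf_add hs ht
  have htm := right_mem_idealOf_add hs ht
  have hvm : ∀ k < D.N, v k ∈ idealOf (s + t) := fun k hk => by
    have h1 := (isOrderIdeal_idealOf (s + t)).mem_of_nonneg_of_le hsm
      (smul_nonneg (D.p_pos k).le (hv k hk)) (hvs k hk)
    have h2 := Submodule.smul_mem _ (D.p k)⁻¹ h1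
    rwa [smul_smul, inv_mul_cancel₀ (D.p_pos k).ne', one_smul] at h2
  refine le_of_forall_isState hE he (Submodule.sum_mem _ fun k hk =>
    hvm k (Finset.mem_range.1 hk)) (Submodule.smul_mem _ _ (hy.mem_idealOf hs ht)) fun ω hω => ?_
  rw [map_sum, map_smul, hy.state_apply hs ht hω, smul_eq_mul]
  refine D.sum_le _ _ _ (hω.map_nonneg hsm hs) (hω.map_nonneg htm ht) (fun k hk => ?_)
    fun k hk => ?_
  · have := hω.mono (Submodule.smul_mem _ _ (hvm k hk)) hsm (hvs k hk)
    rwa [map_smul, smul_eq_mul] at this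
  · have := hω.mono (Submodule.smul_mem _ _ (hvm k hk)) htm (hvt k hk)
    rwa [map_smul, smul_eq_mul] at this

end ClassP.Discretization

end KrivineValue

/-! ### Quasi-Banach lattices -/

theorem abs_sub_le_of_geometric {E : Type*} [AddCommGroup E] [Module ℝ E] [Lattice E]
    [IsOrderedAddMonoid E] {x : ℕ → E} {y : E}
    (h : ∀ n, |x (n + 1) - x n| ≤ ((1 / 2 : ℝ) ^ n) • y) (n k : ℕ) :
    |x (n + k) - x n| ≤ (2 * (1 / 2 : ℝ) ^ n - 2 * (1 / 2 : ℝ) ^ (n + k)) • y := by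
  induction k with
  | zero => simp
  | succ k ih =>
    have e : x (n + (k + 1)) - x n = (x (n + k + 1) - x (n + k)) + (x (n + k) - x n) := by
      rw [← add_assoc]; abel
    rw [e]
    refine (abs_add_le _ _).trans ((add_le_add (h (n + k)) ih).trans_eq ?_)
    rw [← add_smul]
    congr 1
    rw [← add_assoc, pow_succ _ (n + k)]
    ring

namespace QuasiBanachLattice

section

variable {E : Type*} [AddCommGroup E] [Module ℝ E] [Lattice E] [QuasiBanachLattice E]

theorem qnorm_zero : qnorm (0 : E) = 0 := (qnorm_eq_zero_iff 0).2 rfl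

theorem qnorm_abs (x : E) : qnorm |x| = qnorm x :=
  le_antisymm (qnorm_le_of_abs_le _ _ (abs_abs x).le) (qnorm_le_of_abs_le _ _ (abs_abs x).ge)

theorem qnorm_mono {x y : E} (hx : 0 ≤ x) (hxy : x ≤ y) : qnorm x ≤ qnorm y :=
  qnorm_le_of_abs_le _ _ (by rwa [abs_of_nonneg hx, abs_of_nonneg (hx.trans hxy)])

theorem qnorm_smul_of_nonneg {c : ℝ} (hc : 0 ≤ c) (x : E) : qnorm (c • x) = c * qnorm x := by
  rw [qnorm_smul, abs_of_nonneg hc]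

theorem qnorm_sub_comm (x y : E) : qnorm (x - y) = qnorm (y - x) := by
  rw [← qnorm_abs, abs_sub_comm, qnorm_abs]

/-- A quasi-norm need not be continuous, so the order is compared directly: `(y - l)⁺ ≤ |x n - l|`
eventually. -/
theorem le_of_tendsto_qnorm {x : ℕ → E} {l y : E}
    (h : Tendsto (fun n => qnorm (x n - l)) atTop (𝓝 0)) {N : ℕ} (hy : ∀ n ≥ N, y ≤ x n) :
    y ≤ l := by
  have h1 : qnorm (y - l)⁺ ≤ 0 := by
    refine ge_of_tendsto h (eventually_atTop.2 ⟨N, fun n hn => qnorm_le_of_abs_le _ _ ?_⟩)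
    rw [abs_of_nonneg (posPart_nonneg _)]
    exact sup_le ((sub_le_sub_right (hy n hn) l).trans (le_abs_self _)) (abs_nonneg _)
  have h2 := (qnorm_eq_zero_iff _).1 (le_antisymm h1 (qnorm_nonneg _))
  exact sub_nonpos.1 (posPart_eq_zero.1 h2)

theorem isUniformlyCompleteAt {y : E} (hy : 0 ≤ y) : IsUniformlyCompleteAt y := by
  intro x hx
  have hle : ∀ n k, |x (n + k) - x n| ≤ (2 * (1 / 2 : ℝ) ^ n) • y := fun n k =>
    (abs_sub_le_of_geometric hx n k).trans
      (smul_le_smul_of_nonneg_right (sub_le_self _ (by positivity)) hy)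
  have hq : ∀ n k, qnorm (x (n + k) - x n) ≤ (2 * (1 / 2 : ℝ) ^ n) * qnorm y := fun n k => by
    rw [← qnorm_smul_of_nonneg (by positivity)]
    refine qnorm_le_of_abs_le _ _ ((hle n k).trans (le_abs_self _))
  obtain ⟨C, hC1, hC⟩ := qnorm_add_le (E := E)
  obtain ⟨l, hl⟩ := complete x fun ε hε => by
    have hlim : Tendsto (fun n : ℕ => C * (2 * ((2 * (1 / 2 : ℝ) ^ n) * qnorm y))) atTop
        (𝓝 (C * (2 * ((2 * 0) * qnorm y)))) :=
      ((((tendsto_pow_atTop_nhds_zero_of_lt_one (by norm_num) (by norm_num)).const_mul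
        2).mul_const _).const_mul 2).const_mul C
    have h0 : C * (2 * ((2 * 0) * qnorm y)) < ε := by simpa using hε
    obtain ⟨N, hN⟩ := (hlim.eventually_lt_const h0).exists
    refine ⟨N, fun m hm n hn => ?_⟩
    obtain ⟨i, rfl⟩ := Nat.exists_eq_add_of_le hm
    obtain ⟨j, rfl⟩ := Nat.exists_eq_add_of_le hn
    have e : x (N + i) - x (N + j) = (x (N + i) - x N) + (x N - x (N + j)) := by abel
    rw [e]
    have h1 := hq N i
    have h2 := hq N j
    rw [qnorm_sub_comm] at h2
    refine (hC _ _).trans_lt (lt_of_le_of_lt ?_ hN)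
    gcongr
    linarith
  refine ⟨l, fun n => ?_⟩
  refine abs_le_of_neg_le_of_le ?_ ?_
  · rw [neg_le_sub_iff_le_add]
    have : Tendsto (fun m => qnorm ((-x m) - (-l))) atTop (𝓝 0) := by
      refine hl.congr fun m => ?_
      rw [neg_sub_neg, qnorm_sub_comm]
    have h2 : -(x n + (2 * (1 / 2 : ℝ) ^ n) • y) ≤ -l := by
      refine le_of_tendsto_qnorm this (N := n) fun m hm => neg_le_neg ?_
      obtain ⟨k, rfl⟩ := Nat.exists_eq_add_of_le hm
      have := (le_abs_self _).trans (hle n k)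
      rwa [sub_le_iff_le_add'] at this
    exact neg_le_neg_iff.1 h2
  · rw [sub_le_comm]
    refine le_of_tendsto_qnorm hl (N := n) fun m hm => ?_
    obtain ⟨k, rfl⟩ := Nat.exists_eq_add_of_le hm
    have := (neg_le_abs _).trans (hle n k)
    rw [neg_sub] at this
    exact sub_le_comm.1 this

/-- Peeling off the first summand each time charges the i-th one C^(i+1), independently of the
number of summands. -/
theorem qnorm_sum_range_le {C : ℝ} (hC1 : 1 ≤ C)
    (hC : ∀ x y : E, qnorm (x + y) ≤ C * (qnorm x + qnorm y)) (m : ℕ) (z : ℕ → E) :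
    qnorm (∑ i ∈ Finset.range m, z i) ≤ ∑ i ∈ Finset.range m, C ^ (i + 1) * qnorm (z i) := by
  induction m generalizing z with
  | zero => simp [qnorm_zero]
  | succ m ih =>
    rw [Finset.sum_range_succ', Finset.sum_range_succ']
    refine (hC _ _).trans ?_
    rw [mul_add, zero_add, pow_one]
    gcongr
    refine (mul_le_mul_of_nonneg_left (ih _) (by linarith)).trans_eq ?_
    rw [Finset.mul_sum]
    exact Finset.sum_congr rfl fun i _ => by ring

variable (E) in
/-- Geometrically damped sequences in the positive unit ball have a common upper bound. -/
theorem exists_damping : ∃ θ : ℝ, 0 < θ ∧ θ ≤ 1 ∧ ∀ a : ℕ → E, (∀ k, 0 ≤ a k) →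
    (∀ k, qnorm (a k) ≤ 1) → ∃ l : E, 0 ≤ l ∧ ∀ k, θ ^ k • a k ≤ l := by
  obtain ⟨C, hC1, hC⟩ := qnorm_add_le (E := E)
  have hC0 : 0 < C := by linarith
  -- Cθ = 1/2 beats the growing constants of the quasi-triangle inequality, so ∑ θᵏ a_k converges;
  -- its sum is the bound.
  refine ⟨1 / (2 * C), by positivity, by rw [div_le_one (by positivity)]; linarith,
    fun a ha0 ha1 => ?_⟩
  set θ := 1 / (2 * C) with hθ
  have hθ0 : 0 < θ := by positivity
  have hθC : C * θ = 1 / 2 := by rw [hθ]; field_simp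
  have hθ1 : θ < 1 := by rw [hθ, div_lt_one (by positivity)]; linarith
  set S : ℕ → E := fun n => ∑ k ∈ Finset.range n, θ ^ k • a k with hS
  have hinc : ∀ n k, S (n + k) - S n = ∑ i ∈ Finset.range k, θ ^ (n + i) • a (n + i) := fun n k => by
    rw [hS]
    simp only
    rw [Finset.sum_range_add, add_sub_cancel_left]
  have hnn : ∀ n k, 0 ≤ S (n + k) - S n := fun n k => by
    rw [hinc]
    exact Finset.sum_nonneg fun i _ => smul_nonneg (by positivity) (ha0 _)
  have hq : ∀ n k, qnorm (S (n + k) - S n) ≤ 2 * C * θ ^ n := fun n k => by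
    rw [hinc]
    refine (qnorm_sum_range_le hC1 hC k _).trans ?_
    calc ∑ i ∈ Finset.range k, C ^ (i + 1) * qnorm (θ ^ (n + i) • a (n + i))
        ≤ ∑ i ∈ Finset.range k, C * θ ^ n * (1 / 2) ^ i := by
          refine Finset.sum_le_sum fun i _ => ?_
          rw [qnorm_smul_of_nonneg (by positivity)]
          calc C ^ (i + 1) * (θ ^ (n + i) * qnorm (a (n + i)))
              ≤ C ^ (i + 1) * (θ ^ (n + i) * 1) := by
                have := ha1 (n + i)
                gcongr
            _ = C * θ ^ n * (C * θ) ^ i := by ring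
            _ = _ := by rw [hθC]
      _ = C * θ ^ n * ∑ i ∈ Finset.range k, (1 / 2 : ℝ) ^ i := by rw [Finset.mul_sum]
      _ ≤ C * θ ^ n * 2 := by
          gcongr
          have := sum_geometric_two_le k
          simpa using this
      _ = _ := by ring
  obtain ⟨l, hl⟩ := complete S fun ε hε => by
    have hlim : Tendsto (fun n : ℕ => C * (2 * (2 * C * θ ^ n))) atTop
        (𝓝 (C * (2 * (2 * C * 0)))) :=
      (((tendsto_pow_atTop_nhds_zero_of_lt_one hθ0.le hθ1).const_mul _).const_mul 2).const_mul C
    have h0 : C * (2 * (2 * C * 0)) < ε := by simpa using hε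
    obtain ⟨N, hN⟩ := (hlim.eventually_lt_const h0).exists
    refine ⟨N, fun m hm n hn => ?_⟩
    obtain ⟨i, rfl⟩ := Nat.exists_eq_add_of_le hm
    obtain ⟨j, rfl⟩ := Nat.exists_eq_add_of_le hn
    have e : S (N + i) - S (N + j) = (S (N + i) - S N) + (S N - S (N + j)) := by abel
    rw [e]
    have h1 := hq N i
    have h2 := hq N j
    rw [qnorm_sub_comm] at h2
    refine (hC _ _).trans_lt (lt_of_le_of_lt ?_ hN)
    gcongr
    linarith
  have hle : ∀ n, S n ≤ l := fun n => le_of_tendsto_qnorm hl (N := n) fun m hm => by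
    obtain ⟨k, rfl⟩ := Nat.exists_eq_add_of_le hm
    exact sub_nonneg.1 (hnn n k)
  refine ⟨l, (by simpa [hS] using hle 0), fun k => le_trans ?_ (hle (k + 1))⟩
  rw [hS]
  simp only
  rw [Finset.sum_range_succ]
  exact le_add_of_nonneg_left (Finset.sum_nonneg fun i _ => smul_nonneg (by positivity) (ha0 _))

end

end QuasiBanachLattice

/-! ### Embeddings onto ideals -/

/-- Injective interval preserving lattice homomorphisms. -/
structure IsIdealEmbedding {E F : Type*} [AddCommGroup E] [Module ℝ E] [Lattice E]
    [AddCommGroup F] [Module ℝ F] [Lattice F] (j : E →ₗ[ℝ] F) : Prop where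
  injective : Function.Injective j
  map_sup : ∀ x y : E, j (x ⊔ y) = j x ⊔ j y
  exists_of_le : ∀ (x : E) (z : F), 0 ≤ x → 0 ≤ z → z ≤ j x → ∃ y : E, j y = z

namespace IsIdealEmbedding

variable {E F : Type*} [AddCommGroup E] [Module ℝ E] [Lattice E] [IsOrderedAddMonoid E]
  [AddCommGroup F] [Module ℝ F] [Lattice F] [IsOrderedAddMonoid F] {j : E →ₗ[ℝ] F}

theorem map_abs (hj : IsIdealEmbedding j) (x : E) : j |x| = |j x| := by
  change j (x ⊔ -x) = j x ⊔ -j x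
  rw [hj.map_sup, map_neg]

theorem le_iff (hj : IsIdealEmbedding j) {x y : E} : j x ≤ j y ↔ x ≤ y := by
  rw [← sup_eq_right, ← hj.map_sup, hj.injective.eq_iff, sup_eq_right]

theorem nonneg_iff (hj : IsIdealEmbedding j) {x : E} : 0 ≤ j x ↔ 0 ≤ x := by
  rw [← hj.le_iff, map_zero]

theorem exists_of_abs_le (hj : IsIdealEmbedding j) {x : E} {z : F} (hz : |z| ≤ j x) :
    ∃ y : E, j y = z ∧ |y| ≤ x := by
  have hx : 0 ≤ x := hj.nonneg_iff.1 ((abs_nonneg z).trans hz)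
  obtain ⟨a, ha⟩ := hj.exists_of_le x z⁺ hx (posPart_nonneg z)
    ((sup_le (le_abs_self z) (abs_nonneg z)).trans hz)
  obtain ⟨b, hb⟩ := hj.exists_of_le x z⁻ hx (negPart_nonneg z)
    ((sup_le (neg_le_abs z) (abs_nonneg z)).trans hz)
  have h : j (a - b) = z := by rw [map_sub, ha, hb, posPart_sub_negPart]
  refine ⟨a - b, h, hj.le_iff.1 ?_⟩
  rwa [hj.map_abs, h]

theorem exists_of_mem_range (hj : IsIdealEmbedding j) {w z : F} (hw : w ∈ range j)
    (h : |z| ≤ |w|) : z ∈ range j := by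
  obtain ⟨x, rfl⟩ := hw
  rw [← hj.map_abs] at h
  obtain ⟨y, hy, -⟩ := hj.exists_of_abs_le h
  exact ⟨y, hy⟩

end IsIdealEmbedding

theorem exists_add_of_abs_le_add {F : Type*} [AddCommGroup F] [Lattice F] [IsOrderedAddMonoid F]
    {z a b : F} (ha : 0 ≤ a) (hb : 0 ≤ b) (h : |z| ≤ a + b) :
    ∃ x y : F, z = x + y ∧ |x| ≤ a ∧ |y| ≤ b := by
  have key : ∀ w : F, 0 ≤ w → w ≤ a + b → ∃ x, 0 ≤ x ∧ x ≤ a ∧ 0 ≤ w - x ∧ w - x ≤ b := by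
    intro w hw hwab
    refine ⟨w ⊓ a, le_inf hw ha, inf_le_right, sub_nonneg.2 inf_le_left, ?_⟩
    rw [sub_le_iff_le_add, add_inf]
    exact le_inf (le_add_of_nonneg_left hb) (by rwa [add_comm])
  have hdiff : ∀ {u v c : F}, 0 ≤ u → u ≤ c → 0 ≤ v → v ≤ c → |u - v| ≤ c := by
    intro u v c hu huc hv hvc
    refine abs_le'.2 ⟨(sub_le_self u hv).trans huc, ?_⟩
    rw [neg_sub]
    exact (sub_le_self v hu).trans hvc
  obtain ⟨x, h1, h2, h3, h4⟩ := key z⁺ (posPart_nonneg z)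
    ((sup_le (le_abs_self z) (abs_nonneg z)).trans h)
  obtain ⟨y, k1, k2, k3, k4⟩ := key z⁻ (negPart_nonneg z)
    ((sup_le (neg_le_abs z) (abs_nonneg z)).trans h)
  refine ⟨x - y, (z⁺ - x) - (z⁻ - y), ?_, hdiff h1 h2 k1 k2, hdiff h3 h4 k3 k4⟩
  conv_lhs => rw [← posPart_sub_negPart z]
  abel

/-- Each increment splits by Riesz decomposition into parts from the two ideals, and the parts are
summed there separately. This provides Krivine's calculus in X₀ + X₁ without completeness of the
ambient space. -/
theorem IsUniformlyCompleteAt.map_add_map {E₀ E₁ F : Type*}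
    [AddCommGroup E₀] [Module ℝ E₀] [Lattice E₀] [IsOrderedAddMonoid E₀] [IsOrderedModule ℝ E₀]
    [AddCommGroup E₁] [Module ℝ E₁] [Lattice E₁] [IsOrderedAddMonoid E₁] [IsOrderedModule ℝ E₁]
    [AddCommGroup F] [Module ℝ F] [Lattice F] [IsOrderedAddMonoid F] [IsOrderedModule ℝ F]
    {j₀ : E₀ →ₗ[ℝ] F} {j₁ : E₁ →ₗ[ℝ] F} (h₀ : IsIdealEmbedding j₀) (h₁ : IsIdealEmbedding j₁)
    {a : E₀} {b : E₁} (ha : 0 ≤ a) (hb : 0 ≤ b) (hca : IsUniformlyCompleteAt a)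
    (hcb : IsUniformlyCompleteAt b) : IsUniformlyCompleteAt (j₀ a + j₁ b) := by
  intro x hx
  have hdec : ∀ n, ∃ (α : E₀) (β : E₁), x (n + 1) - x n = j₀ α + j₁ β ∧
      |α| ≤ ((1 / 2 : ℝ) ^ n) • a ∧ |β| ≤ ((1 / 2 : ℝ) ^ n) • b := by
    intro n
    have h := hx n
    rw [smul_add, ← map_smul, ← map_smul] at h
    have hpow : (0 : ℝ) ≤ (1 / 2) ^ n := by positivity
    obtain ⟨u, v, huv, hu, hv⟩ := exists_add_of_abs_le_add (h₀.nonneg_iff.2 (smul_nonneg hpow ha))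
      (h₁.nonneg_iff.2 (smul_nonneg hpow hb)) h
    obtain ⟨α, rfl, hα⟩ := h₀.exists_of_abs_le hu
    obtain ⟨β, rfl, hβ⟩ := h₁.exists_of_abs_le hv
    exact ⟨α, β, huv, hα, hβ⟩
  choose α β hαβ hα hβ using hdec
  obtain ⟨l, hl⟩ := hca (fun n => ∑ k ∈ Finset.range n, α k) fun n => by
    simpa [Finset.sum_range_succ] using hα n
  obtain ⟨m, hm⟩ := hcb (fun n => ∑ k ∈ Finset.range n, β k) fun n => by
    simpa [Finset.sum_range_succ] using hβ n
  refine ⟨x 0 + j₀ l + j₁ m, fun n => ?_⟩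
  have hxn : x n = x 0 + j₀ (∑ k ∈ Finset.range n, α k) + j₁ (∑ k ∈ Finset.range n, β k) := by
    induction n with
    | zero => simp
    | succ n ih =>
      rw [Finset.sum_range_succ, Finset.sum_range_succ, map_add, map_add,
        ← sub_add_cancel (x (n + 1)) (x n), hαβ n, ih]
      abel
  have e : x n - (x 0 + j₀ l + j₁ m) = j₀ (∑ k ∈ Finset.range n, α k - l) +
      j₁ (∑ k ∈ Finset.range n, β k - m) := by
    rw [hxn, map_sub, map_sub]; abel
  rw [e, smul_add]
  refine (abs_add_le _ _).trans (add_le_add ?_ ?_)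
  · rw [← h₀.map_abs, ← map_smul]
    exact h₀.le_iff.2 (hl n)
  · rw [← h₁.map_abs, ← map_smul]
    exact h₁.le_iff.2 (hm n)

/-! ### Locally solid vector lattices and compatible pairs -/

/-- `x⁺` lies below y/(n+1), which tends to 0, so it belongs to every solid neighbourhood of 0; the
space is Hausdorff. -/
theorem LocallySolidVectorLattice.isArchimedeanLattice {X : Type*} [AddCommGroup X] [Module ℝ X]
    [Lattice X] [TopologicalSpace X] [LocallySolidVectorLattice X] : IsArchimedeanLattice X := by
  intro x y h
  have hy : 0 ≤ y := by simpa using h 0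
  have hz : x⁺ = 0 := by
    by_contra hne
    obtain ⟨V, hV, hVU, hsolid⟩ := LocallySolidVectorLattice.locally_solid ({x⁺}ᶜ : Set X)
      (isOpen_compl_singleton.mem_nhds (fun h => hne (mem_singleton_iff.1 h).symm))
    have hlim : Tendsto (fun n : ℕ => ((1 : ℝ) / ((n : ℝ) + 1)) • y) atTop (𝓝 ((0 : ℝ) • y)) :=
      tendsto_one_div_add_atTop_nhds_zero_nat.smul_const y
    rw [zero_smul] at hlim
    obtain ⟨n, hn⟩ := (hlim.eventually hV).exists
    refine hVU (hsolid x⁺ _ ?_ hn) rfl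
    have hpos : (0 : ℝ) < (n : ℝ) + 1 := by positivity
    have hny : 0 ≤ ((1 : ℝ) / ((n : ℝ) + 1)) • y := smul_nonneg (by positivity) hy
    rw [abs_of_nonneg (posPart_nonneg x), abs_of_nonneg hny]
    refine sup_le ?_ hny
    have h1 := smul_le_smul_of_nonneg_left (h (n + 1))
      (show (0 : ℝ) ≤ 1 / ((n : ℝ) + 1) by positivity)
    rw [smul_smul] at h1
    push_cast at h1
    rwa [one_div_mul_cancel hpos.ne', one_smul] at h1
  exact posPart_eq_zero.1 hz

namespace CompatiblePair

section

variable {X₀ X₁ X : Type*}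
  [AddCommGroup X₀] [Module ℝ X₀] [Lattice X₀] [QuasiBanachLattice X₀]
  [AddCommGroup X₁] [Module ℝ X₁] [Lattice X₁] [QuasiBanachLattice X₁]
  [AddCommGroup X] [Module ℝ X] [Lattice X] [TopologicalSpace X]
  [LocallySolidVectorLattice X]

instance instIsOrderedAddMonoidSum (P : CompatiblePair X₀ X₁ X) : IsOrderedAddMonoid P.sum where
  add_le_add_left a b h c := add_le_add_left (show (a : X) ≤ b from h) (c : X)

instance instIsOrderedModuleSum (P : CompatiblePair X₀ X₁ X) : IsOrderedModule ℝ P.sum where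
  smul_le_smul_of_nonneg_left a ha b c h :=
    show a • (b : X) ≤ a • (c : X) from smul_le_smul_of_nonneg_left h ha
  smul_le_smul_of_nonneg_right b hb a c h :=
    show a • (b : X) ≤ c • (b : X) from smul_le_smul_of_nonneg_right h hb

theorem isArchimedeanLattice_sum (P : CompatiblePair X₀ X₁ X) : IsArchimedeanLattice P.sum :=
  fun x y h => LocallySolidVectorLattice.isArchimedeanLattice (x : X) (y : X) fun n => h n

theorem isIdealEmbedding_toSum₀ (P : CompatiblePair X₀ X₁ X) : IsIdealEmbedding P.toSum₀ where
  injective x y h := P.incl₀.injective' (congrArg Subtype.val h)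
  map_sup x y := Subtype.ext (P.incl₀.map_sup' x y)
  exists_of_le x z hx hz hzx := by
    obtain ⟨y, -, hy⟩ := (P.incl₀.image_Icc' x hx).superset (show (z : X) ∈ _ from ⟨hz, hzx⟩)
    exact ⟨y, Subtype.ext hy⟩

theorem isIdealEmbedding_toSum₁ (P : CompatiblePair X₀ X₁ X) : IsIdealEmbedding P.toSum₁ where
  injective x y h := P.incl₁.injective' (congrArg Subtype.val h)
  map_sup x y := Subtype.ext (P.incl₁.map_sup' x y)
  exists_of_le x z hx hz hzx := by
    obtain ⟨y, -, hy⟩ := (P.incl₁.image_Icc' x hx).superset (show (z : X) ∈ _ from ⟨hz, hzx⟩)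
    exact ⟨y, Subtype.ext hy⟩

theorem exists_isKrivineValue (P : CompatiblePair X₀ X₁ X) (h : HomFun) {a : X₀} {b : X₁}
    (ha : 0 ≤ a) (hb : 0 ≤ b) : ∃ y, IsKrivineValue h (P.toSum₀ a) (P.toSum₁ b) y := by
  obtain ⟨τ, hτ⟩ := exists_isKrivineCalculus P.isArchimedeanLattice_sum
    (P.isIdealEmbedding_toSum₀.nonneg_iff.2 ha) (P.isIdealEmbedding_toSum₁.nonneg_iff.2 hb)
    (IsUniformlyCompleteAt.map_add_map P.isIdealEmbedding_toSum₀ P.isIdealEmbedding_toSum₁ ha hb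
      (QuasiBanachLattice.isUniformlyCompleteAt ha) (QuasiBanachLattice.isUniformlyCompleteAt hb))
  exact ⟨τ h, τ, hτ, rfl⟩

/-- An element dominated by sums of arbitrarily small elements of `X₀` and `X₁` vanishes. -/
theorem eq_zero_of_small (P : CompatiblePair X₀ X₁ X) {z : P.sum}
    (h : ∀ ε : ℝ, 0 < ε → ∃ (c : X₀) (d : X₁), QuasiBanachLattice.qnorm c < ε ∧
      QuasiBanachLattice.qnorm d < ε ∧ |z| ≤ |P.toSum₀ c + P.toSum₁ d|) : z = 0 := by
  by_contra hne
  have hne' : (z : X) ≠ 0 := fun h => hne (Subtype.ext h)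
  obtain ⟨V, hV, hVU, hsolid⟩ := LocallySolidVectorLattice.locally_solid ({(z : X)}ᶜ : Set X)
    (isOpen_compl_singleton.mem_nhds (fun h => hne' (mem_singleton_iff.1 h).symm))
  obtain ⟨W, hW, hWV⟩ := exists_nhds_zero_half hV
  obtain ⟨ε₀, hε₀, h₀⟩ := P.incl₀.continuous_zero' W hW
  obtain ⟨ε₁, hε₁, h₁⟩ := P.incl₁.continuous_zero' W hW
  obtain ⟨c, d, hc, hd, hz⟩ := h (min ε₀ ε₁) (lt_min hε₀ hε₁)
  have hmem := hWV _ (h₀ c (hc.trans_le (min_le_left _ _))) _ (h₁ d (hd.trans_le (min_le_right _ _)))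
  exact hVU (hsolid (z : X) _ hz hmem) rfl

end

end CompatiblePair

/-! ### The quasi-norm of `φ(X₀, X₁)` -/

namespace CompatiblePair

section

variable {X₀ X₁ X : Type*}
  [AddCommGroup X₀] [Module ℝ X₀] [Lattice X₀] [QuasiBanachLattice X₀]
  [AddCommGroup X₁] [Module ℝ X₁] [Lattice X₁] [QuasiBanachLattice X₁]
  [AddCommGroup X] [Module ℝ X] [Lattice X] [TopologicalSpace X]
  [LocallySolidVectorLattice X]

/-- `|x| ≤ r φ(x₀, x₁)` for some positive `x₀`, `x₁` in the unit balls. -/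
def IsBoundedBy (P : CompatiblePair X₀ X₁ X) (φ : ClassP) (r : ℝ) (x : P.sum) : Prop :=
  ∃ (x₀ : X₀) (x₁ : X₁) (y : P.sum), 0 ≤ x₀ ∧ 0 ≤ x₁ ∧
    QuasiBanachLattice.qnorm x₀ ≤ 1 ∧ QuasiBanachLattice.qnorm x₁ ≤ 1 ∧
    IsKrivineValue φ.hat (P.toSum₀ x₀) (P.toSum₁ x₁) y ∧ |x| ≤ r • y

/-- `C` is a constant in the quasi-triangle inequalities of `X₀` and `X₁`. -/
def IsModulus (X₀ X₁ : Type*)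
    [AddCommGroup X₀] [Module ℝ X₀] [Lattice X₀] [QuasiBanachLattice X₀]
    [AddCommGroup X₁] [Module ℝ X₁] [Lattice X₁] [QuasiBanachLattice X₁] (C : ℝ) : Prop :=
  1 ≤ C ∧ (∀ x y : X₀, QuasiBanachLattice.qnorm (x + y) ≤
      C * (QuasiBanachLattice.qnorm x + QuasiBanachLattice.qnorm y)) ∧
    ∀ x y : X₁, QuasiBanachLattice.qnorm (x + y) ≤
      C * (QuasiBanachLattice.qnorm x + QuasiBanachLattice.qnorm y)

variable (X₀ X₁) in
theorem exists_isModulus : ∃ C : ℝ, IsModulus X₀ X₁ C := by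
  obtain ⟨C, hC1, hC⟩ := QuasiBanachLattice.qnorm_add_le (E := X₀)
  obtain ⟨D, hD1, hD⟩ := QuasiBanachLattice.qnorm_add_le (E := X₁)
  refine ⟨max C D, hC1.trans (le_max_left _ _), fun x y => (hC x y).trans ?_,
    fun x y => (hD x y).trans ?_⟩
  · exact mul_le_mul_of_nonneg_right (le_max_left _ _)
      (add_nonneg (QuasiBanachLattice.qnorm_nonneg _) (QuasiBanachLattice.qnorm_nonneg _))
  · exact mul_le_mul_of_nonneg_right (le_max_right _ _)
      (add_nonneg (QuasiBanachLattice.qnorm_nonneg _) (QuasiBanachLattice.qnorm_nonneg _))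

variable {P : CompatiblePair X₀ X₁ X} {φ : ClassP}

theorem IsBoundedBy.of_abs_le {r r' : ℝ} {x x' : P.sum} (h : P.IsBoundedBy φ r x)
    (hr : r ≤ r') (hx : |x'| ≤ |x|) : P.IsBoundedBy φ r' x' := by
  obtain ⟨x₀, x₁, y, h0, h1, n0, n1, hy, hle⟩ := h
  exact ⟨x₀, x₁, y, h0, h1, n0, n1, hy,
    (hx.trans hle).trans (smul_le_smul_of_nonneg_right hr (hy.nonneg φ))⟩

theorem isBoundedBy_of_abs_le {r : ℝ} (hr : 0 < r) {x y : P.sum} {a : X₀} {b : X₁} (ha : 0 ≤ a)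
    (hb : 0 ≤ b) (hna : QuasiBanachLattice.qnorm a ≤ r) (hnb : QuasiBanachLattice.qnorm b ≤ r)
    (hy : IsKrivineValue φ.hat (P.toSum₀ a) (P.toSum₁ b) y) (hx : |x| ≤ y) :
    P.IsBoundedBy φ r x := by
  have hr' : 0 ≤ r⁻¹ := inv_nonneg.2 hr.le
  have h := hy.smul hr'
  rw [← map_smul, ← map_smul] at h
  refine ⟨r⁻¹ • a, r⁻¹ • b, r⁻¹ • y, smul_nonneg hr' ha, smul_nonneg hr' hb, ?_, ?_, h, ?_⟩
  · rwa [QuasiBanachLattice.qnorm_smul_of_nonneg hr', inv_mul_le_iff₀ hr, mul_one]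
  · rwa [QuasiBanachLattice.qnorm_smul_of_nonneg hr', inv_mul_le_iff₀ hr, mul_one]
  · rwa [smul_smul, mul_inv_cancel₀ hr.ne', one_smul]

theorem mem_calderonLozanovskii_iff {x : P.sum} :
    x ∈ P.calderonLozanovskii φ ↔ ∃ r : ℝ, 0 < r ∧ P.IsBoundedBy φ r x := by
  constructor
  · rintro ⟨a, b, y, ha, hb, hy, hx⟩
    have h0 := QuasiBanachLattice.qnorm_nonneg a
    have h1 := QuasiBanachLattice.qnorm_nonneg b
    exact ⟨1 + QuasiBanachLattice.qnorm a + QuasiBanachLattice.qnorm b, by positivity,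
      isBoundedBy_of_abs_le (by positivity) ha hb (by linarith) (by linarith) hy hx⟩
  · rintro ⟨r, hr, a, b, y, ha, hb, -, -, hy, hx⟩
    refine ⟨r • a, r • b, r • y, smul_nonneg hr.le ha, smul_nonneg hr.le hb, ?_, hx⟩
    rw [map_smul, map_smul]
    exact hy.smul hr.le

theorem clNorm_nonneg (x : P.sum) : 0 ≤ P.clNorm φ x :=
  Real.sInf_nonneg fun _ h => h.1.le

theorem clNorm_le {r : ℝ} (hr : 0 < r) {x : P.sum} (h : P.IsBoundedBy φ r x) :
    P.clNorm φ x ≤ r :=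
  csInf_le ⟨0, fun _ h => h.1.le⟩ ⟨hr, h⟩

/-- Membership matters: outside φ(X₀, X₁) the infimum is over the empty set and equals 0. -/
theorem isBoundedBy_of_clNorm_lt {x : P.sum} (hx : x ∈ P.calderonLozanovskii φ) {r : ℝ}
    (h : P.clNorm φ x < r) : P.IsBoundedBy φ r x := by
  obtain ⟨r₀, hr₀, h₀⟩ := mem_calderonLozanovskii_iff.1 hx
  obtain ⟨s, hs, hsr⟩ := exists_lt_of_csInf_lt
    (⟨r₀, hr₀, h₀⟩ : {r : ℝ | 0 < r ∧ P.IsBoundedBy φ r x}.Nonempty) h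
  exact hs.2.of_abs_le hsr.le le_rfl

theorem mem_calderonLozanovskii_of_abs_le {x x' : P.sum} (hx : x ∈ P.calderonLozanovskii φ)
    (h : |x'| ≤ |x|) : x' ∈ P.calderonLozanovskii φ := by
  obtain ⟨r, hr, hb⟩ := mem_calderonLozanovskii_iff.1 hx
  exact mem_calderonLozanovskii_iff.2 ⟨r, hr, hb.of_abs_le le_rfl h⟩

theorem clNorm_mono {x x' : P.sum} (hx : x ∈ P.calderonLozanovskii φ) (h : |x'| ≤ |x|) :
    P.clNorm φ x' ≤ P.clNorm φ x := by
  refine le_of_forall_pos_le_add fun ε hε => clNorm_le ?_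
    ((isBoundedBy_of_clNorm_lt hx (lt_add_of_pos_right _ hε)).of_abs_le le_rfl h)
  linarith [clNorm_nonneg (φ := φ) x]

/-- Monotonicity alone puts both bounds below z = φ(r a + r' a', r b + r' b'), hence |x + x'| ≤ 2z.
This costs a factor 2 besides the modulus `C`. -/
theorem IsBoundedBy.add {C : ℝ} (hC : IsModulus X₀ X₁ C) {r r' : ℝ} (hr : 0 < r) (hr' : 0 < r')
    {x x' : P.sum} (h : P.IsBoundedBy φ r x) (h' : P.IsBoundedBy φ r' x') :
    P.IsBoundedBy φ (2 * C * (r + r')) (x + x') := by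
  obtain ⟨a, b, y, ha, hb, na, nb, hy, hx⟩ := h
  obtain ⟨a', b', y', ha', hb', na', nb', hy', hx'⟩ := h'
  obtain ⟨hC1, hC₀, hC₁⟩ := hC
  have ha₀ := smul_nonneg hr.le ha
  have hb₀ := smul_nonneg hr.le hb
  have ha₁ := smul_nonneg hr'.le ha'
  have hb₁ := smul_nonneg hr'.le hb'
  obtain ⟨z, hz⟩ := P.exists_isKrivineValue φ.hat (add_nonneg ha₀ ha₁) (add_nonneg hb₀ hb₁)
  have hE := P.isArchimedeanLattice_sum
  have i₀ := P.isIdealEmbedding_toSum₀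
  have i₁ := P.isIdealEmbedding_toSum₁
  have e := hy.smul hr.le
  have e' := hy'.smul hr'.le
  rw [← map_smul, ← map_smul] at e e'
  have h1 : r • y ≤ z := e.mono hE (i₀.nonneg_iff.2 ha₀) (i₁.nonneg_iff.2 hb₀) hz
    (i₀.le_iff.2 (le_add_of_nonneg_right ha₁)) (i₁.le_iff.2 (le_add_of_nonneg_right hb₁))
  have h2 : r' • y' ≤ z := e'.mono hE (i₀.nonneg_iff.2 ha₁) (i₁.nonneg_iff.2 hb₁) hz
    (i₀.le_iff.2 (le_add_of_nonneg_left ha₀)) (i₁.le_iff.2 (le_add_of_nonneg_left hb₀))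
  have hz2 := hz.smul (c := 2) (by norm_num)
  rw [← map_smul, ← map_smul] at hz2
  refine isBoundedBy_of_abs_le (by positivity)
    (smul_nonneg (by norm_num : (0 : ℝ) ≤ 2) (add_nonneg ha₀ ha₁))
    (smul_nonneg (by norm_num : (0 : ℝ) ≤ 2) (add_nonneg hb₀ hb₁)) ?_ ?_ hz2 ?_
  · rw [QuasiBanachLattice.qnorm_smul_of_nonneg (by norm_num), mul_assoc]
    refine mul_le_mul_of_nonneg_left ((hC₀ _ _).trans ?_) (by norm_num)
    rw [QuasiBanachLattice.qnorm_smul_of_nonneg hr.le,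
      QuasiBanachLattice.qnorm_smul_of_nonneg hr'.le]
    gcongr <;> nlinarith
  · rw [QuasiBanachLattice.qnorm_smul_of_nonneg (by norm_num), mul_assoc]
    refine mul_le_mul_of_nonneg_left ((hC₁ _ _).trans ?_) (by norm_num)
    rw [QuasiBanachLattice.qnorm_smul_of_nonneg hr.le,
      QuasiBanachLattice.qnorm_smul_of_nonneg hr'.le]
    gcongr <;> nlinarith
  · rw [two_smul]
    exact (abs_add_le _ _).trans (add_le_add (hx.trans h1) (hx'.trans h2))

theorem add_mem_calderonLozanovskii {x x' : P.sum} (hx : x ∈ P.calderonLozanovskii φ)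
    (hx' : x' ∈ P.calderonLozanovskii φ) : x + x' ∈ P.calderonLozanovskii φ := by
  obtain ⟨C, hC⟩ := exists_isModulus X₀ X₁
  have hC1 := hC.1
  obtain ⟨r, hr, hb⟩ := mem_calderonLozanovskii_iff.1 hx
  obtain ⟨r', hr', hb'⟩ := mem_calderonLozanovskii_iff.1 hx'
  exact mem_calderonLozanovskii_iff.2 ⟨_, by positivity, hb.add hC hr hr' hb'⟩

theorem neg_mem_calderonLozanovskii {x : P.sum} (hx : x ∈ P.calderonLozanovskii φ) :
    -x ∈ P.calderonLozanovskii φ :=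
  mem_calderonLozanovskii_of_abs_le hx (abs_neg x).le

theorem sub_mem_calderonLozanovskii {x x' : P.sum} (hx : x ∈ P.calderonLozanovskii φ)
    (hx' : x' ∈ P.calderonLozanovskii φ) : x - x' ∈ P.calderonLozanovskii φ := by
  rw [sub_eq_add_neg]
  exact add_mem_calderonLozanovskii hx (neg_mem_calderonLozanovskii hx')

theorem abs_mem_calderonLozanovskii {x : P.sum} (hx : x ∈ P.calderonLozanovskii φ) :
    |x| ∈ P.calderonLozanovskii φ :=
  mem_calderonLozanovskii_of_abs_le hx (abs_abs x).le

theorem isBoundedBy_zero {r : ℝ} (hr : 0 ≤ r) : P.IsBoundedBy φ r 0 := by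
  obtain ⟨y, hy⟩ := P.exists_isKrivineValue φ.hat (le_refl (0 : X₀)) (le_refl (0 : X₁))
  refine ⟨0, 0, y, le_rfl, le_rfl, ?_, ?_, hy, ?_⟩
  · rw [QuasiBanachLattice.qnorm_zero]; exact zero_le_one
  · rw [QuasiBanachLattice.qnorm_zero]; exact zero_le_one
  · rw [abs_zero]
    exact smul_nonneg hr (hy.nonneg φ)

theorem zero_mem_calderonLozanovskii : (0 : P.sum) ∈ P.calderonLozanovskii φ :=
  mem_calderonLozanovskii_iff.2 ⟨1, one_pos, isBoundedBy_zero zero_le_one⟩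

theorem clNorm_zero : P.clNorm φ (0 : P.sum) = 0 :=
  le_antisymm (le_of_forall_pos_le_add fun ε hε => by
    rw [zero_add]; exact clNorm_le hε (isBoundedBy_zero hε.le)) (clNorm_nonneg 0)

theorem clNorm_add_le {C : ℝ} (hC : IsModulus X₀ X₁ C) {x x' : P.sum}
    (hx : x ∈ P.calderonLozanovskii φ) (hx' : x' ∈ P.calderonLozanovskii φ) :
    P.clNorm φ (x + x') ≤ 2 * C * (P.clNorm φ x + P.clNorm φ x') := by
  have hC1 := hC.1
  have h0 := clNorm_nonneg (φ := φ) x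
  have h0' := clNorm_nonneg (φ := φ) x'
  refine le_of_forall_pos_le_add fun ε hε => ?_
  set δ := ε / (4 * C) with hδ
  have hδ0 : 0 < δ := by positivity
  have h1 := isBoundedBy_of_clNorm_lt hx (lt_add_of_pos_right _ hδ0)
  have h2 := isBoundedBy_of_clNorm_lt hx' (lt_add_of_pos_right _ hδ0)
  refine (clNorm_le (by positivity) (h1.add hC (by positivity) (by positivity) h2)).trans_eq ?_
  rw [hδ]
  field_simp
  ring

theorem sum_mem_calderonLozanovskii {ι : Type*} (s : Finset ι) {z : ι → P.sum}
    (hz : ∀ i ∈ s, z i ∈ P.calderonLozanovskii φ) : ∑ i ∈ s, z i ∈ P.calderonLozanovskii φ :=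
  Finset.sum_induction z (· ∈ P.calderonLozanovskii φ)
    (fun _ _ => add_mem_calderonLozanovskii) zero_mem_calderonLozanovskii hz

variable (P φ) in
-- The constant may depend on the size of the family, since it will only ever multiply an
-- arbitrarily small error.
theorem exists_clNorm_sum_le {ι : Type*} (s : Finset ι) : ∃ K : ℝ, 0 ≤ K ∧ ∀ z : ι → P.sum,
    (∀ i ∈ s, z i ∈ P.calderonLozanovskii φ) →
    P.clNorm φ (∑ i ∈ s, z i) ≤ K * ∑ i ∈ s, P.clNorm φ (z i) := by
  classical
  obtain ⟨C, hC⟩ := exists_isModulus X₀ X₁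
  have hC1 := hC.1
  induction s using Finset.induction_on with
  | empty => exact ⟨0, le_rfl, fun z _ => by simp [clNorm_zero]⟩
  | insert a s ha ih =>
    obtain ⟨K, hK, hle⟩ := ih
    refine ⟨2 * C * (1 + K), by positivity, fun z hz => ?_⟩
    have hzs : ∀ i ∈ s, z i ∈ P.calderonLozanovskii φ :=
      fun i hi => hz i (Finset.mem_insert_of_mem hi)
    rw [Finset.sum_insert ha, Finset.sum_insert ha, mul_assoc]
    refine (clNorm_add_le hC (hz a (Finset.mem_insert_self a s))
      (sum_mem_calderonLozanovskii s hzs)).trans ?_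
    have h1 := hle z hzs
    have h2 := clNorm_nonneg (φ := φ) (z a)
    have h3 : 0 ≤ ∑ i ∈ s, P.clNorm φ (z i) := Finset.sum_nonneg fun i _ => clNorm_nonneg _
    have h4 : 0 ≤ K * P.clNorm φ (z a) := mul_nonneg hK h2
    rw [mul_assoc 2 C, mul_assoc 2 C]
    gcongr
    linarith

/-! ### The intersection `X₀ ∩ X₁` -/

theorem mem_inter_of_abs_le {x x' : P.sum} (hx : x ∈ P.inter) (h : |x'| ≤ |x|) : x' ∈ P.inter :=
  ⟨P.isIdealEmbedding_toSum₀.exists_of_mem_range hx.1 h,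
    P.isIdealEmbedding_toSum₁.exists_of_mem_range hx.2 h⟩

theorem add_mem_inter {x x' : P.sum} (hx : x ∈ P.inter) (hx' : x' ∈ P.inter) :
    x + x' ∈ P.inter := by
  obtain ⟨⟨a, ha⟩, ⟨b, hb⟩⟩ := hx
  obtain ⟨⟨a', ha'⟩, ⟨b', hb'⟩⟩ := hx'
  exact ⟨⟨a + a', by rw [map_add, ha, ha']⟩, ⟨b + b', by rw [map_add, hb, hb']⟩⟩

theorem zero_mem_inter : (0 : P.sum) ∈ P.inter := ⟨⟨0, map_zero _⟩, ⟨0, map_zero _⟩⟩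

theorem sub_mem_inter {x x' : P.sum} (hx : x ∈ P.inter) (hx' : x' ∈ P.inter) :
    x - x' ∈ P.inter := by
  rw [sub_eq_add_neg]
  exact add_mem_inter hx (mem_inter_of_abs_le hx' (abs_neg x').le)

end

end CompatiblePair

/-! ### The interpolation estimate on the intersection -/

theorem Finset.sup'_abs_nonneg {F ι : Type*} [AddCommGroup F] [Lattice F] [IsOrderedAddMonoid F]
    {s : Finset ι} (hs : s.Nonempty) (f : ι → F) : 0 ≤ s.sup' hs fun i => |f i| := by
  obtain ⟨i, hi⟩ := hs
  exact (abs_nonneg (f i)).trans (Finset.le_sup' (fun i => |f i|) hi)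

theorem IsRegularityConstant.exists_bound {E F : Type*}
    [AddCommGroup E] [Module ℝ E] [Lattice E] [QuasiBanachLattice E]
    [AddCommGroup F] [Module ℝ F] [Lattice F] [QuasiBanachLattice F] {T : E →ₗ[ℝ] F} {K : ℝ}
    (h : IsRegularityConstant univ QuasiBanachLattice.qnorm QuasiBanachLattice.qnorm T K)
    {ι : Type*} (s : Finset ι) (a : ι → E) :
    ∃ y : F, 0 ≤ y ∧ (∀ i ∈ s, |T (a i)| ≤ y) ∧
      QuasiBanachLattice.qnorm y ≤ K * QuasiBanachLattice.qnorm (∑ i ∈ s, |a i|) := by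
  rcases s.eq_empty_or_nonempty with rfl | hs
  · exact ⟨0, le_rfl, by simp, by simp [QuasiBanachLattice.qnorm_zero]⟩
  · obtain ⟨n, hn⟩ : ∃ n, s.card = n + 1 := ⟨s.card - 1, by have := hs.card_pos; omega⟩
    let e : Fin (n + 1) ≃ s := (finCongr hn.symm).trans s.equivFin.symm
    refine ⟨_, Finset.sup'_abs_nonneg Finset.univ_nonempty (fun k => T (a (e k))), fun i hi => ?_, ?_⟩
    · have := Finset.le_sup' (fun k => |T (a (e k))|) (Finset.mem_univ (e.symm ⟨i, hi⟩))
      simpa using this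
    · have h1 := h n (fun k => a (e k)) fun _ => mem_univ _
      have h2 : ∑ k, |a (e k)| = ∑ i ∈ s, |a i| := by
        rw [← Finset.sum_coe_sort s]
        exact Equiv.sum_comp e fun i => |a i|
      rwa [h2] at h1

/-- If `Σ cₖ vₖ ≤ j x` and the `uᵢₖ` refine the `vₖ`, then the images under an `(∞,1)`-regular
operator of the elements `cₖ uᵢₖ` have a common bound controlled by `x`. -/
theorem IsIdealEmbedding.exists_bound_refinement {E F G : Type*}
    [AddCommGroup E] [Module ℝ E] [Lattice E] [QuasiBanachLattice E]
    [AddCommGroup F] [Module ℝ F] [Lattice F] [QuasiBanachLattice F]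
    [AddCommGroup G] [Module ℝ G] [Lattice G] [IsOrderedAddMonoid G] [IsOrderedModule ℝ G]
    {j : E →ₗ[ℝ] G} (hj : IsIdealEmbedding j) {T : E →ₗ[ℝ] F} {K : ℝ}
    (h : IsRegularityConstant univ QuasiBanachLattice.qnorm QuasiBanachLattice.qnorm T K)
    (hK : 0 ≤ K) {ι : Type*} (s : Finset ι) {N : ℕ} {c : ℕ → ℝ} (hc : ∀ k, 0 < c k)
    {v : ℕ → G} {u : ι → ℕ → G} (hu : ∀ i ∈ s, ∀ k < N, 0 ≤ u i k)
    (huv : ∀ k < N, ∑ i ∈ s, u i k = v k) {x : E}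
    (hx : ∑ k ∈ Finset.range N, c k • v k ≤ (2 : ℝ) • j x)
    {a : ι → ℕ → E} (ha : ∀ i ∈ s, ∀ k < N, j (a i k) = u i k) :
    ∃ y : F, 0 ≤ y ∧ (∀ i ∈ s, ∀ k < N, c k • |T (a i k)| ≤ y) ∧
      QuasiBanachLattice.qnorm y ≤ K * (2 * QuasiBanachLattice.qnorm x) := by
  -- All c_k a_ik form one family over pairs (i, k), so a single `y` serves every pair; the moduli
  -- of the family sum to an element whose image is ∑ c_k v_k.
  obtain ⟨y, hy0, hy, hyn⟩ := h.exists_bound (s ×ˢ Finset.range N)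
    fun z => c z.2 • a z.1 z.2
  refine ⟨y, hy0, fun i hi k hk => ?_, hyn.trans (mul_le_mul_of_nonneg_left ?_ hK)⟩
  · have := hy (i, k) (Finset.mk_mem_product hi (Finset.mem_range.2 hk))
    rwa [map_smul, abs_smul_eq, abs_of_pos (hc k)] at this
  · rw [← QuasiBanachLattice.qnorm_smul_of_nonneg (by norm_num)]
    refine QuasiBanachLattice.qnorm_mono (Finset.sum_nonneg fun _ _ => abs_nonneg _) ?_
    rw [← hj.le_iff, map_smul]
    refine le_trans (le_of_eq ?_) hx
    rw [map_sum, Finset.sum_product_right]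
    refine Finset.sum_congr rfl fun k hk => ?_
    have hk := Finset.mem_range.1 hk
    rw [← huv k hk, Finset.smul_sum]
    refine Finset.sum_congr rfl fun i hi => ?_
    rw [abs_smul_eq, map_smul, hj.map_abs, ha i hi k hk, abs_of_pos (hc k),
      abs_of_nonneg (hu i hi k hk)]

namespace CompatiblePair

variable {X₀ X₁ Y₀ Y₁ X Y : Type*}
  [AddCommGroup X₀] [Module ℝ X₀] [Lattice X₀] [QuasiBanachLattice X₀]
  [AddCommGroup X₁] [Module ℝ X₁] [Lattice X₁] [QuasiBanachLattice X₁]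
  [AddCommGroup Y₀] [Module ℝ Y₀] [Lattice Y₀] [QuasiBanachLattice Y₀]
  [AddCommGroup Y₁] [Module ℝ Y₁] [Lattice Y₁] [QuasiBanachLattice Y₁]
  [AddCommGroup X] [Module ℝ X] [Lattice X] [TopologicalSpace X] [LocallySolidVectorLattice X]
  [AddCommGroup Y] [Module ℝ Y] [Lattice Y] [TopologicalSpace Y] [LocallySolidVectorLattice Y]
  {P : CompatiblePair X₀ X₁ X} {Q : CompatiblePair Y₀ Y₁ Y} {φ : ClassP}

/-- The constant is 64 C = 2C · 2 · 8 · 2: enlarging x₀ and x₁, decomposing, reassembling the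
pieces, and adding positive and negative parts. -/
theorem isBoundedBy_sup'_of_mem_inter (hφ : 0 < φ.toFun 1 1) {C K : ℝ} (hC : IsModulus X₀ X₁ C)
    (hK : 0 < K) {T : P.sum →ₗ[ℝ] Q.sum} {T₀ : X₀ →ₗ[ℝ] Y₀} {T₁ : X₁ →ₗ[ℝ] Y₁}
    (hT₀ : ∀ x, T (P.toSum₀ x) = Q.toSum₀ (T₀ x)) (hT₁ : ∀ x, T (P.toSum₁ x) = Q.toSum₁ (T₁ x))
    (hK₀ : IsRegularityConstant univ QuasiBanachLattice.qnorm QuasiBanachLattice.qnorm T₀ K)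
    (hK₁ : IsRegularityConstant univ QuasiBanachLattice.qnorm QuasiBanachLattice.qnorm T₁ K)
    {n : ℕ} {x : Fin (n + 1) → P.sum} (hx : ∀ i, x i ∈ P.inter) {r : ℝ} (hr : 0 < r)
    (hb : P.IsBoundedBy φ r (∑ i, |x i|)) :
    Q.IsBoundedBy φ (64 * C * K * r)
      (Finset.univ.sup' Finset.univ_nonempty fun i => |T (x i)|) := by
  obtain ⟨hC1, hC₀, hC₁⟩ := hC
  have i₀ := P.isIdealEmbedding_toSum₀
  have i₁ := P.isIdealEmbedding_toSum₁
  have k₀ := Q.isIdealEmbedding_toSum₀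
  have k₁ := Q.isIdealEmbedding_toSum₁
  have hE := P.isArchimedeanLattice_sum
  have hF := Q.isArchimedeanLattice_sum
  set w := ∑ i, |x i| with hw
  have hw0 : 0 ≤ w := Finset.sum_nonneg fun i _ => abs_nonneg _
  have hwi : w ∈ P.inter := Finset.sum_induction _ (· ∈ P.inter) (fun _ _ => add_mem_inter)
    zero_mem_inter fun i _ => mem_inter_of_abs_le (hx i) (abs_abs (x i)).le
  obtain ⟨⟨a, ha⟩, ⟨b, hb'⟩⟩ := hwi
  have ha0 : 0 ≤ a := i₀.nonneg_iff.1 (ha ▸ hw0)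
  have hb0 : 0 ≤ b := i₁.nonneg_iff.1 (hb' ▸ hw0)
  obtain ⟨x₀, x₁, y, hx₀, hx₁, n₀, n₁, hy, hwy⟩ := hb
  rw [abs_of_nonneg hw0] at hwy
  have hna := QuasiBanachLattice.qnorm_nonneg a
  have hnb := QuasiBanachLattice.qnorm_nonneg b
  -- Adding ε w to both arguments barely changes their size but gives w ≤ ε⁻¹ s and w ≤ ε⁻¹ t, so
  -- the discretisation applies with M = ε⁻¹. This uses w ∈ X₀ ∩ X₁, and the final constant does not
  -- depend on M.
  set ε := r / (1 + QuasiBanachLattice.qnorm a + QuasiBanachLattice.qnorm b) with hε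
  have hε0 : 0 < ε := by positivity
  have hεa : ε * QuasiBanachLattice.qnorm a ≤ r := by
    rw [hε, div_mul_eq_mul_div, div_le_iff₀ (by positivity)]
    gcongr
    linarith
  have hεb : ε * QuasiBanachLattice.qnorm b ≤ r := by
    rw [hε, div_mul_eq_mul_div, div_le_iff₀ (by positivity)]
    gcongr
    linarith
  -- enlarge `x₀`, `x₁` so that they dominate multiples of `w`
  have hrx₀ := smul_nonneg hr.le hx₀
  have hrx₁ := smul_nonneg hr.le hx₁
  have hεa0 := smul_nonneg hε0.le ha0
  have hεb0 := smul_nonneg hε0.le hb0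
  set s := r • x₀ + ε • a with hs
  set t := r • x₁ + ε • b with ht
  have hs0 : 0 ≤ s := add_nonneg hrx₀ hεa0
  have ht0 : 0 ≤ t := add_nonneg hrx₁ hεb0
  have hns : QuasiBanachLattice.qnorm s ≤ 2 * C * r := by
    refine (hC₀ _ _).trans ?_
    rw [QuasiBanachLattice.qnorm_smul_of_nonneg hr.le,
      QuasiBanachLattice.qnorm_smul_of_nonneg hε0.le]
    have : r * QuasiBanachLattice.qnorm x₀ ≤ r := by nlinarith
    calc C * _ ≤ C * (r + r) := by gcongr
      _ = _ := by ring
  have hnt : QuasiBanachLattice.qnorm t ≤ 2 * C * r := by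
    refine (hC₁ _ _).trans ?_
    rw [QuasiBanachLattice.qnorm_smul_of_nonneg hr.le,
      QuasiBanachLattice.qnorm_smul_of_nonneg hε0.le]
    have : r * QuasiBanachLattice.qnorm x₁ ≤ r := by nlinarith
    calc C * _ ≤ C * (r + r) := by gcongr
      _ = _ := by ring
  have hs0' : 0 ≤ P.toSum₀ s := i₀.nonneg_iff.2 hs0
  have ht0' : 0 ≤ P.toSum₁ t := i₁.nonneg_iff.2 ht0
  have hws : w ≤ ε⁻¹ • P.toSum₀ s := by
    rw [← ha, ← map_smul, i₀.le_iff, hs, smul_add, smul_smul ε⁻¹ ε, inv_mul_cancel₀ hε0.ne',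
      one_smul]
    exact le_add_of_nonneg_left (smul_nonneg (inv_nonneg.2 hε0.le) hrx₀)
  have hwt : w ≤ ε⁻¹ • P.toSum₁ t := by
    rw [← hb', ← map_smul, i₁.le_iff, ht, smul_add, smul_smul ε⁻¹ ε, inv_mul_cancel₀ hε0.ne',
      one_smul]
    exact le_add_of_nonneg_left (smul_nonneg (inv_nonneg.2 hε0.le) hrx₁)
  obtain ⟨y', hy'⟩ := P.exists_isKrivineValue φ.hat hs0 ht0
  have hwy' : w ≤ y' := by
    have e := hy.smul hr.le
    rw [← map_smul, ← map_smul] at e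
    exact hwy.trans (e.mono hE (i₀.nonneg_iff.2 hrx₀) (i₁.nonneg_iff.2 hrx₁) hy'
      (i₀.le_iff.2 (le_add_of_nonneg_right hεa0)) (i₁.le_iff.2 (le_add_of_nonneg_right hεb0)))
  -- decompose `w` and refine the decomposition
  obtain ⟨D⟩ := φ.exists_discretization hφ (inv_pos.2 hε0)
  obtain ⟨v, hv0, hvw, hvp, hvq⟩ := D.exists_decomposition hE hs0' ht0' hw0 hy' hwy' hws hwt
  -- The refinement needs positive elements, so positive and negative parts enter as separate rows.
  let z : Fin (n + 1) × Bool → P.sum := fun i => bif i.2 then (x i.1)⁺ else (x i.1)⁻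
  have hz0 : ∀ i, 0 ≤ z i := by
    rintro ⟨i, _ | _⟩
    · exact negPart_nonneg _
    · exact posPart_nonneg _
  have hzw : ∑ i, z i = w := by
    rw [Fintype.sum_prod_type, hw]
    refine Finset.sum_congr rfl fun i _ => ?_
    rw [Fintype.sum_bool]
    exact posPart_add_negPart (x i)
  obtain ⟨u, hu0, huz, huv⟩ := exists_refinement Finset.univ D.N z v (fun i _ => hz0 i) hv0
    (hzw.trans hvw.symm)
  have huw : ∀ i, ∀ k < D.N, |u i k| ≤ w := fun i k hk => by
    rw [abs_of_nonneg (hu0 i (Finset.mem_univ i) k hk), ← hvw]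
    refine le_trans ?_ (Finset.single_le_sum (fun k hk => hv0 k (Finset.mem_range.1 hk))
      (Finset.mem_range.2 hk))
    rw [← huv k hk]
    exact Finset.single_le_sum (f := fun i => u i k)
      (fun i _ => hu0 i (Finset.mem_univ i) k hk) (Finset.mem_univ i)
  -- Every piece lies below w and hence in both ideals; 0 is a dummy value for k ≥ N.
  have hα : ∀ i k, ∃ α : X₀, k < D.N → P.toSum₀ α = u i k := fun i k => by
    by_cases hk : k < D.N
    · obtain ⟨α, hα, -⟩ := i₀.exists_of_abs_le ((huw i k hk).trans_eq ha.symm)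
      exact ⟨α, fun _ => hα⟩
    · exact ⟨0, fun h => absurd h hk⟩
  have hβ : ∀ i k, ∃ β : X₁, k < D.N → P.toSum₁ β = u i k := fun i k => by
    by_cases hk : k < D.N
    · obtain ⟨β, hβ, -⟩ := i₁.exists_of_abs_le ((huw i k hk).trans_eq hb'.symm)
      exact ⟨β, fun _ => hβ⟩
    · exact ⟨0, fun h => absurd h hk⟩
  choose α hα using hα
  choose β hβ using hβ
  obtain ⟨y₀, hy₀, hy₀p, hny₀⟩ := i₀.exists_bound_refinement hK₀ hK.le Finset.univ D.p_pos hu0 huv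
    hvp fun i _ k hk => hα i k hk
  obtain ⟨y₁, hy₁, hy₁q, hny₁⟩ := i₁.exists_bound_refinement hK₁ hK.le Finset.univ D.q_pos hu0 huv
    hvq fun i _ k hk => hβ i k hk
  obtain ⟨Z, hZ⟩ := Q.exists_isKrivineValue φ.hat hy₀ hy₁
  have hTu : ∀ i, ∑ k ∈ Finset.range D.N, |T (u i k)| ≤ (8 : ℝ) • Z := fun i => by
    refine D.sum_le_krivineValue hF (k₀.nonneg_iff.2 hy₀) (k₁.nonneg_iff.2 hy₁) hZ
      (fun k _ => abs_nonneg _) (fun k hk => ?_) fun k hk => ?_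
    · rw [← hα i k hk, hT₀, ← k₀.map_abs, ← map_smul, k₀.le_iff]
      exact hy₀p i (Finset.mem_univ i) k hk
    · rw [← hβ i k hk, hT₁, ← k₁.map_abs, ← map_smul, k₁.le_iff]
      exact hy₁q i (Finset.mem_univ i) k hk
  have hTz : ∀ i, |T (z i)| ≤ (8 : ℝ) • Z := fun i => by
    rw [← huz i (Finset.mem_univ i), map_sum]
    exact (abs_finset_sum_le _ _).trans (hTu i)
  have hTx : ∀ i, |T (x i)| ≤ (16 : ℝ) • Z := fun i => by
    rw [← posPart_sub_negPart (x i), map_sub, sub_eq_add_neg]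
    refine (abs_add_le _ _).trans ?_
    rw [abs_neg, show (16 : ℝ) = 8 + 8 by norm_num, add_smul]
    exact add_le_add (hTz (i, true)) (hTz (i, false))
  have hZ16 := hZ.smul (c := 16) (by norm_num)
  rw [← map_smul, ← map_smul] at hZ16
  refine isBoundedBy_of_abs_le (by positivity) (smul_nonneg (by norm_num : (0 : ℝ) ≤ 16) hy₀)
    (smul_nonneg (by norm_num : (0 : ℝ) ≤ 16) hy₁) ?_ ?_ hZ16 ?_
  · rw [QuasiBanachLattice.qnorm_smul_of_nonneg (by norm_num)]
    calc 16 * QuasiBanachLattice.qnorm y₀ ≤ 16 * (K * (2 * (2 * C * r))) := by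
          refine mul_le_mul_of_nonneg_left (hny₀.trans ?_) (by norm_num)
          gcongr
      _ = _ := by ring
  · rw [QuasiBanachLattice.qnorm_smul_of_nonneg (by norm_num)]
    calc 16 * QuasiBanachLattice.qnorm y₁ ≤ 16 * (K * (2 * (2 * C * r))) := by
          refine mul_le_mul_of_nonneg_left (hny₁.trans ?_) (by norm_num)
          gcongr
      _ = _ := by ring
  · rw [abs_of_nonneg (Finset.sup'_abs_nonneg _ _)]
    exact Finset.sup'_le _ _ fun i _ => hTx i

end CompatiblePair

/-! ### Passage to the closure -/

namespace CompatiblePair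

section

variable {X₀ X₁ X : Type*}
  [AddCommGroup X₀] [Module ℝ X₀] [Lattice X₀] [QuasiBanachLattice X₀]
  [AddCommGroup X₁] [Module ℝ X₁] [Lattice X₁] [QuasiBanachLattice X₁]
  [AddCommGroup X] [Module ℝ X] [Lattice X] [TopologicalSpace X]
  [LocallySolidVectorLattice X] {P : CompatiblePair X₀ X₁ X} {φ : ClassP}

theorem IsBoundedBy.smul_of_abs_le {r c : ℝ} (hc : 0 ≤ c) {x x' : P.sum}
    (h : P.IsBoundedBy φ r x) (hx : |x'| ≤ c • |x|) : P.IsBoundedBy φ (c * r) x' := by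
  obtain ⟨x₀, x₁, y, h0, h1, n0, n1, hy, hle⟩ := h
  refine ⟨x₀, x₁, y, h0, h1, n0, n1, hy, hx.trans ?_⟩
  rw [mul_smul]
  exact smul_le_smul_of_nonneg_left hle hc

theorem IsBoundedBy.exists_eq_add {r : ℝ} (hr : 0 ≤ r) {x : P.sum} (h : P.IsBoundedBy φ r x) :
    ∃ (c : X₀) (d : X₁), x = P.toSum₀ c + P.toSum₁ d ∧
      QuasiBanachLattice.qnorm c ≤ r * φ.toFun 1 1 ∧
      QuasiBanachLattice.qnorm d ≤ r * φ.toFun 1 1 := by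
  obtain ⟨x₀, x₁, y, h0, h1, n0, n1, hy, hle⟩ := h
  have i₀ := P.isIdealEmbedding_toSum₀
  have i₁ := P.isIdealEmbedding_toSum₁
  have hφ := φ.nonneg 1 1 one_pos one_pos
  have hrφ : 0 ≤ r * φ.toFun 1 1 := mul_nonneg hr hφ
  have h2 := hy.le_smul_add P.isArchimedeanLattice_sum (i₀.nonneg_iff.2 h0) (i₁.nonneg_iff.2 h1)
  have h3 : |x| ≤ P.toSum₀ ((r * φ.toFun 1 1) • x₀) + P.toSum₁ ((r * φ.toFun 1 1) • x₁) := by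
    refine hle.trans ((smul_le_smul_of_nonneg_left h2 hr).trans_eq ?_)
    rw [smul_smul, map_smul, map_smul, smul_add]
  obtain ⟨u, v, huv, hu, hv⟩ := exists_add_of_abs_le_add (i₀.nonneg_iff.2 (smul_nonneg hrφ h0))
    (i₁.nonneg_iff.2 (smul_nonneg hrφ h1)) h3
  obtain ⟨c, rfl, hc⟩ := i₀.exists_of_abs_le hu
  obtain ⟨d, rfl, hd⟩ := i₁.exists_of_abs_le hv
  refine ⟨c, d, huv, ?_, ?_⟩
  · refine (QuasiBanachLattice.qnorm_le_of_abs_le _ _ (hc.trans (le_abs_self _))).trans ?_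
    rw [QuasiBanachLattice.qnorm_smul_of_nonneg hrφ]
    exact mul_le_of_le_one_right hrφ n0
  · refine (QuasiBanachLattice.qnorm_le_of_abs_le _ _ (hd.trans (le_abs_self _))).trans ?_
    rw [QuasiBanachLattice.qnorm_smul_of_nonneg hrφ]
    exact mul_le_of_le_one_right hrφ n1

theorem eq_zero_of_mem_calderonLozanovskii
    (h0 : ∀ s t : ℝ, 0 < s → 0 < t → φ.toFun s t = 0) {x : P.sum}
    (hx : x ∈ P.calderonLozanovskii φ) : x = 0 := by
  obtain ⟨a, b, y, -, -, hy, hle⟩ := hx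
  rw [hy.eq_zero h0] at hle
  have h1 := (le_abs_self x).trans hle
  have h2 := (neg_le_abs x).trans hle
  exact le_antisymm h1 (neg_nonpos.1 h2)

theorem zero_mem_phiZero : (0 : P.sum) ∈ P.phiZero φ :=
  ⟨zero_mem_calderonLozanovskii, fun ε hε =>
    ⟨0, ⟨zero_mem_inter, zero_mem_calderonLozanovskii⟩, by rwa [sub_zero, clNorm_zero]⟩⟩

end

end CompatiblePair

theorem IsRegularityConstant.qnorm_apply_le {E F : Type*}
    [AddCommGroup E] [Module ℝ E] [Lattice E] [QuasiBanachLattice E]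
    [AddCommGroup F] [Module ℝ F] [Lattice F] [QuasiBanachLattice F] {T : E →ₗ[ℝ] F} {K : ℝ}
    (h : IsRegularityConstant univ QuasiBanachLattice.qnorm QuasiBanachLattice.qnorm T K) (x : E) :
    QuasiBanachLattice.qnorm (T x) ≤ K * QuasiBanachLattice.qnorm x := by
  have := h 0 (fun _ => x) fun _ => mem_univ _
  simpa [QuasiBanachLattice.qnorm_abs] using this

theorem IsRegularityConstant.mono {E F : Type*} [AddCommGroup E] [Lattice E] [AddCommGroup F]
    [Lattice F] {A : Set E} {normE : E → ℝ} {normF : F → ℝ} {T : E → F} {K K' : ℝ}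
    (h : IsRegularityConstant A normE normF T K) (hn : ∀ x, 0 ≤ normE x) (hK : K ≤ K') :
    IsRegularityConstant A normE normF T K' :=
  fun n x hx => (h n x hx).trans (mul_le_mul_of_nonneg_right hK (hn _))

theorem le_of_forall_pos_le_add_mul {a b c : ℝ} (hc : 0 ≤ c)
    (h : ∀ ε : ℝ, 0 < ε → a ≤ b + c * ε) : a ≤ b := by
  refine le_of_forall_pos_le_add fun η hη => ?_
  have h1 := h (η / (c + 1)) (by positivity)
  have h2 : c * (η / (c + 1)) ≤ η := by
    rw [mul_div_assoc', div_le_iff₀ (by positivity)]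
    nlinarith
  linarith

namespace CompatiblePair

variable {X₀ X₁ Y₀ Y₁ X Y : Type*}
  [AddCommGroup X₀] [Module ℝ X₀] [Lattice X₀] [QuasiBanachLattice X₀]
  [AddCommGroup X₁] [Module ℝ X₁] [Lattice X₁] [QuasiBanachLattice X₁]
  [AddCommGroup Y₀] [Module ℝ Y₀] [Lattice Y₀] [QuasiBanachLattice Y₀]
  [AddCommGroup Y₁] [Module ℝ Y₁] [Lattice Y₁] [QuasiBanachLattice Y₁]
  [AddCommGroup X] [Module ℝ X] [Lattice X] [TopologicalSpace X] [LocallySolidVectorLattice X]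
  [AddCommGroup Y] [Module ℝ Y] [Lattice Y] [TopologicalSpace Y] [LocallySolidVectorLattice Y]
  {P : CompatiblePair X₀ X₁ X} {Q : CompatiblePair Y₀ Y₁ Y} {φ : ClassP}
  {T : P.sum →ₗ[ℝ] Q.sum} {T₀ : X₀ →ₗ[ℝ] Y₀} {T₁ : X₁ →ₗ[ℝ] Y₁} {C K : ℝ}

theorem isBoundedBy_apply_of_mem_inter (hφ : 0 < φ.toFun 1 1) (hC : IsModulus X₀ X₁ C)
    (hK : 0 < K)
    (hT₀ : ∀ x, T (P.toSum₀ x) = Q.toSum₀ (T₀ x)) (hT₁ : ∀ x, T (P.toSum₁ x) = Q.toSum₁ (T₁ x))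
    (hK₀ : IsRegularityConstant univ QuasiBanachLattice.qnorm QuasiBanachLattice.qnorm T₀ K)
    (hK₁ : IsRegularityConstant univ QuasiBanachLattice.qnorm QuasiBanachLattice.qnorm T₁ K)
    {x : P.sum} (hx : x ∈ P.inter) {r : ℝ} (hr : 0 < r) (hb : P.IsBoundedBy φ r x) :
    Q.IsBoundedBy φ (64 * C * K * r) (T x) := by
  have h := isBoundedBy_sup'_of_mem_inter (n := 0) (x := fun _ => x) hφ hC hK hT₀ hT₁ hK₀ hK₁
    (fun _ => hx) hr (by simpa using hb.of_abs_le le_rfl (abs_abs x).le)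
  refine h.of_abs_le le_rfl ?_
  simp

theorem mapsTo_inter (hT₀ : ∀ x, T (P.toSum₀ x) = Q.toSum₀ (T₀ x))
    (hT₁ : ∀ x, T (P.toSum₁ x) = Q.toSum₁ (T₁ x)) : MapsTo T P.inter Q.inter := by
  rintro x ⟨⟨a, ha⟩, ⟨b, hb⟩⟩
  exact ⟨⟨T₀ a, by rw [← hT₀, ha]⟩, ⟨T₁ b, by rw [← hT₁, hb]⟩⟩

/-- Elements of `φ⁰(X₀, X₁)` can be approximated by elements of `X₀ ∩ X₁` together with their
images. -/
theorem exists_approx_of_mem_phiZero (hφ : 0 < φ.toFun 1 1) (hK : 0 < K)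
    (hT₀ : ∀ x, T (P.toSum₀ x) = Q.toSum₀ (T₀ x)) (hT₁ : ∀ x, T (P.toSum₁ x) = Q.toSum₁ (T₁ x))
    (hK₀ : IsRegularityConstant univ QuasiBanachLattice.qnorm QuasiBanachLattice.qnorm T₀ K)
    (hK₁ : IsRegularityConstant univ QuasiBanachLattice.qnorm QuasiBanachLattice.qnorm T₁ K)
    {x : P.sum} (hx : x ∈ P.phiZero φ) :
    ∀ ε : ℝ, 0 < ε → ∃ y ∈ P.inter ∩ P.calderonLozanovskii φ, P.clNorm φ (x - y) < ε ∧
      T y ∈ Q.calderonLozanovskii φ ∧ T x - T y ∈ Q.calderonLozanovskii φ ∧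
      Q.clNorm φ (T x - T y) < ε := by
  obtain ⟨C, hC⟩ := exists_isModulus X₀ X₁
  have hC1 := hC.1
  obtain ⟨θ₀, hθ₀, hθ₀1, hd₀⟩ := QuasiBanachLattice.exists_damping Y₀
  obtain ⟨θ₁, hθ₁, hθ₁1, hd₁⟩ := QuasiBanachLattice.exists_damping Y₁
  have k₀ := Q.isIdealEmbedding_toSum₀
  have k₁ := Q.isIdealEmbedding_toSum₁
  set θ := min θ₀ θ₁ with hθ
  have hθ0 : 0 < θ := lt_min hθ₀ hθ₁
  have hθ1 : θ ≤ 1 := (min_le_left _ _).trans hθ₀1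
  -- Tuned so that the increments of the images are bounded by exactly (θ/2)ⁿ. The factor θⁿ is
  -- spent on a common dominating pair a', b', and 2⁻ⁿ is left for convergence.
  set δ : ℕ → ℝ := fun n => (θ / 2) ^ n / (64 * C * K * (4 * C)) with hδ
  have hδ0 : ∀ n, 0 < δ n := fun n => by positivity
  have hδs : ∀ n, δ (n + 1) ≤ δ n := fun n => by
    rw [hδ]
    refine div_le_div_of_nonneg_right ?_ (by positivity)
    exact pow_le_pow_of_le_one (by positivity) (by linarith) n.le_succ
  have hδL : ∀ n, 64 * C * K * (2 * C * (δ n + δ n)) = (θ / 2) ^ n := fun n => by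
    simp only [hδ]
    field_simp
    ring
  have hδlim : Tendsto δ atTop (𝓝 0) := by
    have := (tendsto_pow_atTop_nhds_zero_of_lt_one (show 0 ≤ θ / 2 by positivity)
      (by linarith)).div_const (64 * C * K * (4 * C))
    rwa [zero_div] at this
  choose y hy hyδ using fun n => hx.2 (δ n) (hδ0 n)
  have hxy : ∀ n, P.IsBoundedBy φ (δ n) (x - y n) := fun n =>
    isBoundedBy_of_clNorm_lt (sub_mem_calderonLozanovskii hx.1 (hy n).2) (hyδ n)
  have hdiff : ∀ n, Q.IsBoundedBy φ ((θ / 2) ^ n) (T (y (n + 1)) - T (y n)) := by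
    intro n
    rw [← map_sub, ← hδL n]
    refine isBoundedBy_apply_of_mem_inter hφ hC hK hT₀ hT₁ hK₀ hK₁
      (sub_mem_inter (hy (n + 1)).1 (hy n).1) (by have := hδ0 n; positivity) ?_
    have h1 : P.IsBoundedBy φ (δ n) (-(x - y (n + 1))) :=
      (hxy (n + 1)).of_abs_le (hδs n) (abs_neg _).le
    have h2 := (hxy n).add hC (hδ0 n) (hδ0 n) h1
    rwa [show x - y n + -(x - y (n + 1)) = y (n + 1) - y n by abel] at h2
  choose a b z ha hb hna hnb hz hle using hdiff
  obtain ⟨a', ha', haa⟩ := hd₀ a ha hna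
  obtain ⟨b', hb', hbb⟩ := hd₁ b hb hnb
  obtain ⟨Z, hZ⟩ := Q.exists_isKrivineValue φ.hat ha' hb'
  have hZ0 := hZ.nonneg φ
  have hgeo : ∀ n, |T (y (n + 1)) - T (y n)| ≤ ((1 / 2 : ℝ) ^ n) • Z := by
    intro n
    have hpow : 0 ≤ θ ^ n := by positivity
    have e := (hz n).smul hpow
    rw [← map_smul, ← map_smul] at e
    have h1 : θ ^ n • z n ≤ Z := e.mono Q.isArchimedeanLattice_sum
      (k₀.nonneg_iff.2 (smul_nonneg hpow (ha n))) (k₁.nonneg_iff.2 (smul_nonneg hpow (hb n))) hZ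
      (k₀.le_iff.2 (le_trans (smul_le_smul_of_nonneg_right
        (pow_le_pow_left₀ hθ0.le (min_le_left _ _) n) (ha n)) (haa n)))
      (k₁.le_iff.2 (le_trans (smul_le_smul_of_nonneg_right
        (pow_le_pow_left₀ hθ0.le (min_le_right _ _) n) (hb n)) (hbb n)))
    have h2 : (θ / 2) ^ n • z n = ((1 / 2 : ℝ) ^ n) • (θ ^ n • z n) := by
      rw [smul_smul, ← mul_pow]
      congr 2
      ring
    exact (hle n).trans (h2.trans_le (smul_le_smul_of_nonneg_left h1 (by positivity)))
  have hlim : ∀ n, |T x - T (y n)| ≤ (2 * (1 / 2 : ℝ) ^ n) • Z := by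
    intro n
    -- The excess over the bound is dominated by |T (x - y_m)| for all large m. Since x - y_m splits
    -- into small parts in X₀ and X₁, T (x - y_m) splits into small parts in Y₀ and Y₁, so the
    -- excess is 0.
    have hzero : (|T x - T (y n)| - (2 * (1 / 2 : ℝ) ^ n) • Z)⁺ = 0 := by
      refine Q.eq_zero_of_small fun ε hε => ?_
      have hlim' : Tendsto (fun m => K * (δ m * φ.toFun 1 1)) atTop (𝓝 (K * (0 * φ.toFun 1 1))) :=
        (hδlim.mul_const _).const_mul K
      rw [zero_mul, mul_zero] at hlim'
      obtain ⟨m, hm, hmn⟩ := ((hlim'.eventually_lt_const hε).and (eventually_ge_atTop n)).exists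
      obtain ⟨k, rfl⟩ := Nat.exists_eq_add_of_le hmn
      obtain ⟨c, d, hcd, hc, hd⟩ := (hxy (n + k)).exists_eq_add (hδ0 _).le
      refine ⟨T₀ c, T₁ d, ?_, ?_, ?_⟩
      · exact ((hK₀.qnorm_apply_le c).trans (mul_le_mul_of_nonneg_left hc hK.le)).trans_lt hm
      · exact ((hK₁.qnorm_apply_le d).trans (mul_le_mul_of_nonneg_left hd hK.le)).trans_lt hm
      · rw [← hT₀, ← hT₁, ← map_add, ← hcd, map_sub, abs_of_nonneg (posPart_nonneg _)]
        refine sup_le ?_ (abs_nonneg _)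
        rw [sub_le_iff_le_add]
        have h1 : |T (y (n + k)) - T (y n)| ≤ (2 * (1 / 2 : ℝ) ^ n) • Z :=
          (abs_sub_le_of_geometric (x := fun n => T (y n)) hgeo n k).trans
            (smul_le_smul_of_nonneg_right (sub_le_self _ (by positivity)) hZ0)
        have h2 := abs_add_le (T x - T (y (n + k))) (T (y (n + k)) - T (y n))
        rw [sub_add_sub_cancel] at h2
        exact h2.trans (by gcongr)
    exact sub_nonpos.1 (posPart_eq_zero.1 hzero)
  have hqa := QuasiBanachLattice.qnorm_nonneg a'
  have hqb := QuasiBanachLattice.qnorm_nonneg b'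
  set R := 1 + QuasiBanachLattice.qnorm a' + QuasiBanachLattice.qnorm b' with hR
  have hR0 : 0 < R := by positivity
  have hZR : Q.IsBoundedBy φ R Z := isBoundedBy_of_abs_le hR0 ha' hb' (by linarith) (by linarith)
    hZ (abs_of_nonneg hZ0).le
  have hTxy : ∀ n, Q.IsBoundedBy φ (2 * (1 / 2 : ℝ) ^ n * R) (T x - T (y n)) := fun n =>
    hZR.smul_of_abs_le (by positivity) (by rw [abs_of_nonneg hZ0]; exact hlim n)
  intro ε hε
  have hlim₂ : Tendsto (fun n : ℕ => 2 * (1 / 2 : ℝ) ^ n * R) atTop (𝓝 (2 * 0 * R)) :=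
    ((tendsto_pow_atTop_nhds_zero_of_lt_one (by norm_num) (by norm_num)).const_mul 2).mul_const R
  rw [mul_zero, zero_mul] at hlim₂
  obtain ⟨n, hn1, hn2⟩ := ((hlim₂.eventually_lt_const hε).and
    (hδlim.eventually_lt_const hε)).exists
  refine ⟨y n, hy n, (hyδ n).trans hn2, ?_, ?_, ?_⟩
  · obtain ⟨r, hr, hb⟩ := mem_calderonLozanovskii_iff.1 (hy n).2
    exact mem_calderonLozanovskii_iff.2 ⟨_, by positivity,
      isBoundedBy_apply_of_mem_inter hφ hC hK hT₀ hT₁ hK₀ hK₁ (hy n).1 hr hb⟩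
  · exact mem_calderonLozanovskii_iff.2 ⟨_, by positivity, hTxy n⟩
  · exact (clNorm_le (by positivity) (hTxy n)).trans_lt hn1

theorem mapsTo_phiZero (hK : 0 < K)
    (hT₀ : ∀ x, T (P.toSum₀ x) = Q.toSum₀ (T₀ x)) (hT₁ : ∀ x, T (P.toSum₁ x) = Q.toSum₁ (T₁ x))
    (hK₀ : IsRegularityConstant univ QuasiBanachLattice.qnorm QuasiBanachLattice.qnorm T₀ K)
    (hK₁ : IsRegularityConstant univ QuasiBanachLattice.qnorm QuasiBanachLattice.qnorm T₁ K) :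
    MapsTo T (P.phiZero φ) (Q.phiZero φ) := by
  intro x hx
  rcases φ.toFun_eq_zero_or_pos with h0 | hφ
  · rw [eq_zero_of_mem_calderonLozanovskii h0 hx.1, map_zero]
    exact zero_mem_phiZero
  · have happ := exists_approx_of_mem_phiZero hφ hK hT₀ hT₁ hK₀ hK₁ hx
    refine ⟨?_, fun ε hε => ?_⟩
    · obtain ⟨y, -, -, h1, h2, -⟩ := happ 1 one_pos
      have := add_mem_calderonLozanovskii h2 h1
      rwa [sub_add_cancel] at this
    · obtain ⟨y, hy, -, h1, -, h3⟩ := happ ε hε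
      exact ⟨T y, ⟨mapsTo_inter hT₀ hT₁ hy.1, h1⟩, h3⟩

/-- The estimate on X₀ ∩ X₁ is applied to approximants y_i. Passing from ∑ |x_i| to ∑ |y_i| costs
2C, and from the supremum of the |T y_i| back to that of the |T x_i| costs 2D, so 256 D C² = 2D · 64
C · 2C. -/
theorem isRegularityConstant_phiZero {D : ℝ} (hC : IsModulus X₀ X₁ C) (hD : IsModulus Y₀ Y₁ D)
    (hK : 0 < K)
    (hT₀ : ∀ x, T (P.toSum₀ x) = Q.toSum₀ (T₀ x)) (hT₁ : ∀ x, T (P.toSum₁ x) = Q.toSum₁ (T₁ x))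
    (hK₀ : IsRegularityConstant univ QuasiBanachLattice.qnorm QuasiBanachLattice.qnorm T₀ K)
    (hK₁ : IsRegularityConstant univ QuasiBanachLattice.qnorm QuasiBanachLattice.qnorm T₁ K) :
    IsRegularityConstant (P.phiZero φ) (P.clNorm φ) (Q.clNorm φ) T (256 * D * C ^ 2 * K) := by
  intro n x hx
  have hC1 := hC.1
  have hD1 := hD.1
  rcases φ.toFun_eq_zero_or_pos with h0 | hφ
  · have hxz : ∀ i, T (x i) = 0 := fun i => by
      rw [eq_zero_of_mem_calderonLozanovskii h0 (hx i).1, map_zero]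
    simp only [hxz, abs_zero, Finset.sup'_const, clNorm_zero]
    exact mul_nonneg (by positivity) (clNorm_nonneg _)
  obtain ⟨A, hA, hsumP⟩ := exists_clNorm_sum_le P φ (Finset.univ : Finset (Fin (n + 1)))
  obtain ⟨B, hB, hsumQ⟩ := exists_clNorm_sum_le Q φ (Finset.univ : Finset (Fin (n + 1)))
  -- The constants that depend on n are all collected in the coefficient of ε.
  refine le_of_forall_pos_le_add_mul
    (c := 2 * D * (64 * C * K * (2 * C * (A * (n + 1)) + 1) + B * (n + 1))) (by positivity)
    fun ε hε => ?_
  choose y hy hxy hTy hTxy hTε using fun i =>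
    exists_approx_of_mem_phiZero hφ hK hT₀ hT₁ hK₀ hK₁ (hx i) ε hε
  have hsx : ∑ i, |x i| ∈ P.calderonLozanovskii φ :=
    sum_mem_calderonLozanovskii _ fun i _ => abs_mem_calderonLozanovskii (hx i).1
  have hdP : ∀ i, |x i - y i| ∈ P.calderonLozanovskii φ := fun i =>
    abs_mem_calderonLozanovskii (sub_mem_calderonLozanovskii (hx i).1 (hy i).2)
  have hsd : ∑ i, |x i - y i| ∈ P.calderonLozanovskii φ :=
    sum_mem_calderonLozanovskii _ fun i _ => hdP i
  have hsy : ∑ i, |y i| ∈ P.calderonLozanovskii φ :=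
    sum_mem_calderonLozanovskii _ fun i _ => abs_mem_calderonLozanovskii (hy i).2
  have hnd : P.clNorm φ (∑ i, |x i - y i|) ≤ A * (n + 1) * ε := by
    refine (hsumP _ fun i _ => hdP i).trans ?_
    rw [mul_assoc]
    refine mul_le_mul_of_nonneg_left ?_ hA
    refine (Finset.sum_le_card_nsmul Finset.univ _ ε fun i _ => ?_).trans_eq ?_
    · exact (clNorm_mono (sub_mem_calderonLozanovskii (hx i).1 (hy i).2) (abs_abs _).le).trans
        (hxy i).le
    · simp
  have hny : P.clNorm φ (∑ i, |y i|) ≤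
      2 * C * (P.clNorm φ (∑ i, |x i|) + A * (n + 1) * ε) := by
    refine (clNorm_mono (x := ∑ i, |x i| + ∑ i, |x i - y i|)
      (add_mem_calderonLozanovskii hsx hsd) ?_).trans
      ((clNorm_add_le hC hsx hsd).trans (by gcongr))
    rw [abs_of_nonneg (Finset.sum_nonneg fun i _ => abs_nonneg _), ← Finset.sum_add_distrib]
    refine (Finset.sum_le_sum fun i _ => ?_).trans (le_abs_self _)
    have h1 := abs_add_le (x i) (y i - x i)
    rwa [add_sub_cancel, abs_sub_comm (y i)] at h1
  have hρ0 := clNorm_nonneg (φ := φ) (∑ i, |y i|)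
  have hbound := isBoundedBy_sup'_of_mem_inter hφ hC hK hT₀ hT₁ hK₀ hK₁ (fun i => (hy i).1)
    (add_pos_of_nonneg_of_pos hρ0 hε)
    (isBoundedBy_of_clNorm_lt hsy (lt_add_of_pos_right _ hε))
  set S := Finset.univ.sup' Finset.univ_nonempty fun i => |T (y i)| with hS
  have hS0 : 0 ≤ S := Finset.sup'_abs_nonneg _ _
  have hSnorm := clNorm_le (by positivity) hbound
  have hSmem : S ∈ Q.calderonLozanovskii φ :=
    mem_calderonLozanovskii_iff.2 ⟨_, by positivity, hbound⟩
  have hdQ : ∀ i, |T (x i) - T (y i)| ∈ Q.calderonLozanovskii φ := fun i =>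
    abs_mem_calderonLozanovskii (hTxy i)
  have hsdQ : ∑ i, |T (x i) - T (y i)| ∈ Q.calderonLozanovskii φ :=
    sum_mem_calderonLozanovskii _ fun i _ => hdQ i
  have hndQ : Q.clNorm φ (∑ i, |T (x i) - T (y i)|) ≤ B * (n + 1) * ε := by
    refine (hsumQ _ fun i _ => hdQ i).trans ?_
    rw [mul_assoc]
    refine mul_le_mul_of_nonneg_left ?_ hB
    refine (Finset.sum_le_card_nsmul Finset.univ _ ε fun i _ => ?_).trans_eq ?_
    · exact (clNorm_mono (hTxy i) (abs_abs _).le).trans (hTε i).le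
    · simp
  have hsup : Q.clNorm φ (Finset.univ.sup' Finset.univ_nonempty fun i => |T (x i)|) ≤
      2 * D * (Q.clNorm φ S + Q.clNorm φ (∑ i, |T (x i) - T (y i)|)) := by
    refine (clNorm_mono (x := S + ∑ i, |T (x i) - T (y i)|)
      (add_mem_calderonLozanovskii hSmem hsdQ) ?_).trans (clNorm_add_le hD hSmem hsdQ)
    rw [abs_of_nonneg (Finset.sup'_abs_nonneg _ _)]
    refine (Finset.sup'_le _ _ fun i _ => ?_).trans (le_abs_self _)
    have h1 := abs_add_le (T (y i)) (T (x i) - T (y i))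
    rw [add_sub_cancel] at h1
    refine h1.trans (add_le_add ?_ ?_)
    · exact Finset.le_sup' (fun i => |T (y i)|) (Finset.mem_univ i)
    · exact Finset.single_le_sum (f := fun i => |T (x i) - T (y i)|)
        (fun i _ => abs_nonneg _) (Finset.mem_univ i)
  calc Q.clNorm φ (Finset.univ.sup' Finset.univ_nonempty fun i => |T (x i)|)
      ≤ 2 * D * (64 * C * K * (2 * C * (P.clNorm φ (∑ i, |x i|) + A * (n + 1) * ε) + ε) +
          B * (n + 1) * ε) := by
        refine hsup.trans (mul_le_mul_of_nonneg_left (add_le_add (hSnorm.trans ?_) hndQ)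
          (by positivity))
        exact mul_le_mul_of_nonneg_left (by linarith) (by positivity)
    _ = _ := by ring

end CompatiblePair

/-! ### Passage to the infima of the regularity constants -/

theorem mainTheorem2 {X₀ X₁ Y₀ Y₁ : Type*}
    [AddCommGroup X₀] [Module ℝ X₀] [Lattice X₀] [QuasiBanachLattice X₀]
    [AddCommGroup X₁] [Module ℝ X₁] [Lattice X₁] [QuasiBanachLattice X₁]
    [AddCommGroup Y₀] [Module ℝ Y₀] [Lattice Y₀] [QuasiBanachLattice Y₀]
    [AddCommGroup Y₁] [Module ℝ Y₁] [Lattice Y₁] [QuasiBanachLattice Y₁]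
    (φ : ClassP) :
    ∃ C : ℝ, 0 < C ∧
      ∀ (X Y : Type*)
        [AddCommGroup X] [Module ℝ X] [Lattice X] [TopologicalSpace X]
        [LocallySolidVectorLattice X]
        [AddCommGroup Y] [Module ℝ Y] [Lattice Y] [TopologicalSpace Y]
        [LocallySolidVectorLattice Y]
        (P : CompatiblePair X₀ X₁ X) (Q : CompatiblePair Y₀ Y₁ Y)
        (T : P.sum →ₗ[ℝ] Q.sum) (T₀ : X₀ →ₗ[ℝ] Y₀) (T₁ : X₁ →ₗ[ℝ] Y₁),
        (∀ x, T (P.toSum₀ x) = Q.toSum₀ (T₀ x)) →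
        (∀ x, T (P.toSum₁ x) = Q.toSum₁ (T₁ x)) →
        IsInftyOneRegular univ QuasiBanachLattice.qnorm QuasiBanachLattice.qnorm T₀ →
        IsInftyOneRegular univ QuasiBanachLattice.qnorm QuasiBanachLattice.qnorm T₁ →
        MapsTo T (P.phiZero φ) (Q.phiZero φ) ∧
        IsInftyOneRegular (P.phiZero φ) (P.clNorm φ) (Q.clNorm φ) T ∧
        rhoInftyOne (P.phiZero φ) (P.clNorm φ) (Q.clNorm φ) T ≤
          C * max
            (rhoInftyOne univ QuasiBanachLattice.qnorm QuasiBanachLattice.qnorm T₀)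
            (rhoInftyOne univ QuasiBanachLattice.qnorm QuasiBanachLattice.qnorm T₁) := by

  obtain ⟨C, hC⟩ := CompatiblePair.exists_isModulus X₀ X₁
  obtain ⟨D, hD⟩ := CompatiblePair.exists_isModulus Y₀ Y₁
  have hC1 := hC.1
  have hD1 := hD.1
  have hL : 0 < 256 * D * C ^ 2 := by positivity
  -- Only the quasi-triangle constants of the four lattices enter, and they are fixed before the
  -- realisations and `T`.
  refine ⟨256 * D * C ^ 2, hL, ?_⟩
  intro X Y _ _ _ _ _ _ _ _ _ _ P Q T T₀ T₁ hT₀ hT₁ hr₀ hr₁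
  have key : ∀ K₀ K₁ : ℝ, 0 < K₀ →
      IsRegularityConstant univ QuasiBanachLattice.qnorm QuasiBanachLattice.qnorm T₀ K₀ →
      IsRegularityConstant univ QuasiBanachLattice.qnorm QuasiBanachLattice.qnorm T₁ K₁ →
      MapsTo T (P.phiZero φ) (Q.phiZero φ) ∧
      IsRegularityConstant (P.phiZero φ) (P.clNorm φ) (Q.clNorm φ) T
        (256 * D * C ^ 2 * max K₀ K₁) := by
    intro K₀ K₁ hpos h₀ h₁
    have hK : 0 < max K₀ K₁ := hpos.trans_le (le_max_left _ _)
    have h₀' := h₀.mono QuasiBanachLattice.qnorm_nonneg (le_max_left K₀ K₁)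
    have h₁' := h₁.mono QuasiBanachLattice.qnorm_nonneg (le_max_right K₀ K₁)
    exact ⟨CompatiblePair.mapsTo_phiZero hK hT₀ hT₁ h₀' h₁',
      CompatiblePair.isRegularityConstant_phiZero hC hD hK hT₀ hT₁ h₀' h₁'⟩
  have hr₀' := hr₀
  have hr₁' := hr₁
  obtain ⟨K₀, hK₀, h₀⟩ := hr₀'
  obtain ⟨K₁, hK₁, h₁⟩ := hr₁'
  have hmax : 0 < max K₀ K₁ := hK₀.trans_le (le_max_left _ _)
  refine ⟨(key K₀ K₁ hK₀ h₀ h₁).1, ⟨_, mul_pos hL hmax, (key K₀ K₁ hK₀ h₀ h₁).2⟩, ?_⟩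
  -- The infima need not be attained, so constants within ε of them are used.
  refine le_of_forall_pos_le_add_mul hL.le fun ε hε => ?_
  obtain ⟨k₀, ⟨hk₀, hreg₀⟩, hlt₀⟩ := exists_lt_of_csInf_lt
    (show {K : ℝ | 0 < K ∧ IsRegularityConstant univ QuasiBanachLattice.qnorm
      QuasiBanachLattice.qnorm T₀ K}.Nonempty from hr₀) (lt_add_of_pos_right _ hε)
  obtain ⟨k₁, ⟨hk₁, hreg₁⟩, hlt₁⟩ := exists_lt_of_csInf_lt
    (show {K : ℝ | 0 < K ∧ IsRegularityConstant univ QuasiBanachLattice.qnorm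
      QuasiBanachLattice.qnorm T₁ K}.Nonempty from hr₁) (lt_add_of_pos_right _ hε)
  have hkmax : 0 < max k₀ k₁ := hk₀.trans_le (le_max_left _ _)
  have hle : rhoInftyOne (P.phiZero φ) (P.clNorm φ) (Q.clNorm φ) T ≤
      256 * D * C ^ 2 * max k₀ k₁ :=
    csInf_le ⟨0, fun _ h => h.1.le⟩ ⟨mul_pos hL hkmax, (key k₀ k₁ hk₀ hreg₀ hreg₁).2⟩
  refine hle.trans ?_
  rw [← mul_add]
  refine mul_le_mul_of_nonneg_left (max_le ?_ ?_) hL.le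
  · exact hlt₀.le.trans (add_le_add_left (le_max_left _ _) ε)
  · exact hlt₁.le.trans (add_le_add_left (le_max_right _ _) ε)
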